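/- Let $R$ be a commutative ring with unity. **Planar diagrams.** Colors are $0$ (empty), $1$ (thin), $2$ (thick). Corollas: $T_n$ ($n\ge 2$) has $n$ thin leaves and a thin root; $M_{j,k}$ ($j+k\ge 1$) has a thick root, a thick leaf, and $j$ (resp. $k$) thin leaves to the left (resp. right) of the thick leaf; $I_{j,k}$ ($j,k\ge 0$) has an empty root (drawn as a thick vertex), a left and a right thick leaf, and $j$ (resp. $k$) thin leaves in the upper (resp. lower) half-plane. Planar diagrams (planar trees, module trees, inner product diagrams) are obtained from corollas by attaching roots to leaves of the same color. For a diagram $D$, $\mathcal L(D)$ is the set of leaves, $\mathcal E(D)$ the set of internal edges, $D/e$ is obtained by contracting $e\in\mathcal E(D)$, and $f_\circlearrowright:\{1,\dots,\#\mathcal L(D)\}\to\mathcal L(D)$ is the canonical labeling (from left to right for trees; clockwise starting with the left thick leaf for inner product diagrams). An orientation of a finite set $\{e_1,\dots,e_k\}$ of edges is a formal skew-commutative product $\pm e_1\wedge\dots\wedge e_k$ ($\pm1$ if $k=0$). **The operad $C_*\hat{\mathcal A}$.** It is the $R$-module generated by a unit of degree $0$ for each color and by triples $(D,f,\omega)$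 modulo $(D,f,-\omega)=-(D,f,\omega)$, where $D$ is a planar diagram, $f:\{1,\dots,k\}\to\mathcal L(D)$ is a bijection, and $\omega$ is an orientation of $\mathcal E(D)$. The degree is $\#\mathcal L(D)-\#\mathcal E(D)-2$; the coloring $\mathbf x\times y$ consists of the colors $\mathbf x$ of the leaves $f(1),\dots,f(k)$ and the color $y$ of the root; $C_n\hat{\mathcal A}^{\mathbf x}_y$ denotes the part of degree $n$ and coloring $\mathbf x\times y$. Further, $$\partial_C(D,f,\omega)=\sum_{D'/e'=D}(D',f,e'\wedge\omega),\qquad \sigma\cdot(D,f,\omega)=\operatorname{sgn}(\sigma)(D,f\circ\sigma,\omega),$$ $$(D,f_D,\omega_D)\circ_i(E,f_E,\omega_E)=(-1)^{i(l+1)+kn}\,(D\circ_{f_D(i)}E,\ f_{D\circ E},\ \omega_D\wedge\omega_E\wedge e)$$ if leaf $f_D(i)$ and the root of $E$ have the same color, and $0$ otherwise. Here $k=\#\mathcal L(D)$, $l=\#\mathcal L(E)$, $n$ is the degree of $E$, the root of $E$ is attached to leaf $f_D(i)$ of $D$, $e$ is the new edge, and $f_{D\circ E}(j)$ is $f_D(j)$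 for $j<i$, $f_E(j-i+1)$ for $i\le j<i+l$, and $f_D(j-l+1)$ for $j\ge i+l$. Units act as identities for the compositions, and $\partial_C$ vanishes on them. **The operad $Q_*\hat{\mathcal A}$.** It is the $R$-module generated by the units and by tuples $(D,f,g,\omega)$ modulo $(D,f,g,-\omega)=-(D,f,g,\omega)$, where $D,f$ are as before, $g:\mathcal E(D)\to\{m,n\}$ marks edges as metric ($m$) or non-metric ($n$), and $\omega$ is an orientation of the set of metric edges. The degree is the number of metric edges ($0$ for units), colorings are as before, and $Q_n\hat{\mathcal A}^{\mathbf x}_y$ is the part of degree $n$ and coloring $\mathbf x\times y$. With $\omega^{\hat e_j}=e_1\wedge\dots\widehat{e_j}\dots\wedge e_l$, $$\partial_Q(D,f,g,e_1\wedge\dots\wedge e_l)=\sum_{j=1}^l(-1)^j\big[(D/e_j,f,g|,\omega^{\hat e_j})-(D,f,g_{e_j},\omega^{\hat e_j})\big],$$ where $g|$ is the restriction of $g$ and $g_{e_j}$ is $g$ with $e_j$ made non-metric; $\sigma\cdot(D,f,g,\omega)=(D,f\circ\sigma,g,\omega)$; and $(D,f_D,g_D,\omega_D)\circ_i(E,f_E,g_E,\omega_E)=(D\circ_{f_D(i)}E,f_{D\circ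 E},g_{D\circ E},\omega_D\wedge\omega_E)$ if the colors match and $0$ otherwise, where $g_{D\circ E}$ makes the new edge non-metric and agrees with $g_D$, $g_E$ on the other edges. Units act as identities for the compositions, and $\partial_Q$ vanishes on them. **Standard orientations.** A diagram is binary if its degree in $C_*\hat{\mathcal A}$ is $0$. Two distinct binary diagrams $B,B'$ are related by a local move if $B/e=B'/e'$ for some edges $e,e'$; all other edges are then identified. The right comb over a corolla has edges $e_1,\dots,e_k$ such that $e_t$ cuts off all leaves except the first $t$ in the canonical numbering. **Proposition.** There is exactly one way to choose an orientation $\omega^{\mathrm{std}}_B$ of every binary diagram $B$ such that $\omega^{\mathrm{std}}_B=e_1\wedge\dots\wedge e_k$ on right combs and such that for every local move from $B$ to $B'$ the orientation $\omega^{\mathrm{std}}_{B'}$ is obtained from $-\omega^{\mathrm{std}}_B$ by replacing $e$ by $e'$. With these orientations, there is exactly one $R$-linear map $q:C_*\hat{\mathcal A}\to Q_*\hat{\mathcal A}$ that is the identity on units, commutes with the actions of the symmetric groups and with all compositions $\circ_i$, and satisfies on every corolla $(c,f_\circlearrowright,+1)$ of coloring $\mathbf x\times y$ $$q(c,f_\circlearrowright,+1)=\sum_{B}(B,f_\circlearrowright,m,\omega^{\mathrm{std}}_B),$$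 the sum of all fully metric binary diagrams $B$ such that $(B,f_\circlearrowright)$ has coloring $\mathbf x\times y$. The map $q$ is a chain map: it maps $C_n\hat{\mathcal A}^{\mathbf x}_y$ to $Q_n\hat{\mathcal A}^{\mathbf x}_y$ for all $n,\mathbf x,y$, and $\partial_Q\circ q=q\circ\partial_C$. -/

import Mathlib

namespace Pairahedra

noncomputable section

/-! ## Colors, corollas, planar diagrams -/

/-- The three colors: `0` is empty, `1` is thin, `2` is thick. -/
abbrev Color : Type := Fin 3

/-- The corollas.  `T n` has `n` thin leaves and a thin root; `M j k` has a thick root, a thick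
leaf, `j` thin leaves to the left and `k` thin leaves to the right of the thick leaf; `I j k` has
an empty root (the thick vertex), a left and a right thick leaf, `j` thin leaves in the upper and
`k` thin leaves in the lower half-plane. -/
inductive Corolla : Type
  | T (n : ℕ) (hn : 2 ≤ n) : Corolla
  | M (j k : ℕ) (hjk : 1 ≤ j + k) : Corolla
  | I (j k : ℕ) : Corolla

/-- The number of leaves. -/
def Corolla.arity : Corolla → ℕ
  | .T n _ => n
  | .M j k _ => j + k + 1
  | .I j k => j + k + 2

/-- The color of the root. -/
def Corolla.root : Corolla → Color
  | .T _ _ => 1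
  | .M _ _ _ => 2
  | .I _ _ => 0

/-- The leaves are identified with `0, …, arity - 1` by the canonical numbering: from left to
right for `T n` and `M j k`, and clockwise starting with the left thick leaf for `I j k` (so that
the right thick leaf of `I j k` has number `j + 1`).  This is the color of leaf number `x`. -/
def Corolla.leafColor : Corolla → ℕ → Color
  | .T _ _, _ => 1
  | .M j _ _, x => if x = j then 2 else 1
  | .I j _, x => if x = 0 ∨ x = j + 1 then 2 else 1

/-- Edges of planar diagrams are recorded by the set of (canonical numbers of) the leaves that lie
outward from them. -/
abbrev Block : Type := Finset ℕ

/-- An interval of at least two, but not all, of the leaves `0, …, N - 1`. -/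
def IsProperInterval (N : ℕ) (b : Block) : Prop :=
  ∃ x y, x + 2 ≤ y ∧ y ≤ N ∧ ¬ (x = 0 ∧ y = N) ∧ b = Finset.Ico x y

/-- The sets of leaves which can be cut off by one edge from a diagram that contracts to the given
corolla.  In an inner product diagram, the edge carries a planar tree or a module tree, hence it
cuts off a clockwise arc of at least two leaves which does not contain both thick leaves `0` and
`j + 1`: the arc either avoids `0`, or it contains `0` and avoids `j + 1`. -/
def Corolla.IsBlock : Corolla → Block → Prop
  | .T n _, b => IsProperInterval n b
  | .M j k _, b => IsProperInterval (j + k + 1) b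
  | .I j k, b =>
      (∃ x y, 1 ≤ x ∧ x + 2 ≤ y ∧ y ≤ j + k + 2 ∧ b = Finset.Ico x y) ∨
      (∃ x y, 1 ≤ y ∧ y ≤ j + 1 ∧ j + 1 < x ∧ x ≤ j + k + 2 ∧ 2 ≤ y + (j + k + 2 - x) ∧
        b = Finset.Ico 0 y ∪ Finset.Ico x (j + k + 2))

/-- Two edges of one diagram: the sets of leaves outward from them are nested or disjoint. -/
def Compatible (b b' : Block) : Prop := b ⊆ b' ∨ b' ⊆ b ∨ Disjoint b b'

/-- A planar diagram (planar tree, module tree, or inner product diagram) which becomes the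
corolla `c` when all its edges are contracted.  The diagram is determined by its finite set of
edges, each edge being given by the leaves outward from it. The vertices are the root vertex and
one vertex for each edge; the edges and leaves entering the vertex of an edge `b` are the maximal
edges strictly inside `b` and the leaves in `b` outside of all these. -/
@[ext]
structure Diagram (c : Corolla) : Type where
  edges : Finset Block
  isBlock : ∀ b ∈ edges, c.IsBlock b
  compatible : ∀ b ∈ edges, ∀ b' ∈ edges, Compatible b b'

/-- The diagram without edges. -/
def Diagram.ofCorolla (c : Corolla) : Diagram c where
  edges := ∅
  isBlock := by simp
  compatible := by simp

/-- `D / e`: contract the edge `e` to a point. -/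
def Diagram.contract {c : Corolla} (D : Diagram c) (e : Block) : Diagram c where
  edges := D.edges.erase e
  isBlock b hb := D.isBlock b (Finset.mem_of_mem_erase hb)
  compatible b hb b' hb' :=
    D.compatible b (Finset.mem_of_mem_erase hb) b' (Finset.mem_of_mem_erase hb')

theorem Corolla.two_le_arity (c : Corolla) : 2 ≤ c.arity := by
  cases c <;> simp only [Corolla.arity] <;> omega

theorem Corolla.IsBlock.subset {c : Corolla} {b : Block} (h : c.IsBlock b) :
    b ⊆ Finset.range c.arity := by
  intro z hz
  cases c with
  | T n hn =>
    obtain ⟨x, y, h1, h2, h3, rfl⟩ := h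
    simp only [Finset.mem_Ico, Finset.mem_range, Corolla.arity] at *
    omega
  | M j k hjk =>
    obtain ⟨x, y, h1, h2, h3, rfl⟩ := h
    simp only [Finset.mem_Ico, Finset.mem_range, Corolla.arity] at *
    omega
  | I j k =>
    rcases h with ⟨x, y, h1, h2, h3, rfl⟩ | ⟨x, y, h1, h2, h3, h4, h5, rfl⟩ <;>
    simp only [Finset.mem_Ico, Finset.mem_range, Finset.mem_union, Corolla.arity] at * <;>
    omega

theorem Corolla.IsBlock.exists_ne {c : Corolla} {b : Block} (h : c.IsBlock b) :
    ∃ x ∈ b, ∃ y ∈ b, x ≠ y := by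
  cases c with
  | T n hn =>
    obtain ⟨x, y, h1, h2, h3, rfl⟩ := h
    exact ⟨x, by simp; omega, x + 1, by simp; omega, by omega⟩
  | M j k hjk =>
    obtain ⟨x, y, h1, h2, h3, rfl⟩ := h
    exact ⟨x, by simp; omega, x + 1, by simp; omega, by omega⟩
  | I j k =>
    rcases h with ⟨x, y, h1, h2, h3, rfl⟩ | ⟨x, y, h1, h2, h3, h4, h5, rfl⟩
    · exact ⟨x, by simp; omega, x + 1, by simp; omega, by omega⟩
    · by_cases hy : 2 ≤ y
      · exact ⟨0, by simp; omega, 1, by simp; omega, by omega⟩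
      · exact ⟨0, by simp; omega, x, by simp; omega, by omega⟩

/-- There are only finitely many diagrams with a given number of leaves of given colors. -/
instance (c : Corolla) : Fintype (Diagram c) :=
  Fintype.ofInjective
    (fun D : Diagram c =>
      (⟨D.edges, Finset.mem_powerset.2 fun b hb =>
        Finset.mem_powerset.2 (D.isBlock b hb).subset⟩ :
        {s // s ∈ (Finset.range c.arity).powerset.powerset}))
    (fun _ _ h => Diagram.ext (congrArg Subtype.val h))

/-- The degree `#leaves - #edges - 2` of a diagram. -/
def Diagram.degree {c : Corolla} (D : Diagram c) : ℤ := (c.arity : ℤ) - D.edges.card - 2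

/-! ## Orientations -/

/-- The exterior algebra over `ℤ` on all edges; orientations are elements of it. -/
abbrev Ext : Type := ExteriorAlgebra ℤ (Block →₀ ℤ)

/-- An edge as an element of the exterior algebra. -/
def edgeVec (e : Block) : Ext := ExteriorAlgebra.ι ℤ (Finsupp.single e (1 : ℤ))

/-- `e₁ ∧ ⋯ ∧ eₖ` -/
def wedge (l : List Block) : Ext := (l.map edgeVec).prod

/-- `ω` is `e₁ ∧ ⋯ ∧ eₖ` or `-(e₁ ∧ ⋯ ∧ eₖ)`, where `e₁, …, eₖ` are the distinct elements
of `S`; for empty `S` this means `ω = 1` or `ω = -1`. -/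
def IsOrientation (S : Finset Block) (ω : Ext) : Prop :=
  ∃ l : List Block, l.Nodup ∧ l.toFinset = S ∧ (ω = wedge l ∨ ω = - wedge l)

/-- The orientations on a finite set of edges. -/
def Orientation (S : Finset Block) : Type := {ω : Ext // IsOrientation S ω}

/-- Rename the edges. -/
def relabel (φ : Block → Block) : Ext →ₐ[ℤ] Ext :=
  ExteriorAlgebra.map (Finsupp.lmapDomain ℤ ℤ φ)

/-- The contraction by `e`, an antiderivation with `e ↦ 1` and `e' ↦ 0` for `e' ≠ e`. It sends
`e₁ ∧ ⋯ ∧ eₖ` to `(-1)^(j-1) e₁ ∧ ⋯ ∧ êⱼ ∧ ⋯ ∧ eₖ` when `e = eⱼ`. -/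
def remove (e : Block) : Ext →ₗ[ℤ] Ext :=
  CliffordAlgebra.contractLeft (Q := (0 : QuadraticForm ℤ (Block →₀ ℤ)))
    (Finsupp.lapply e : (Block →₀ ℤ) →ₗ[ℤ] ℤ)

theorem wedge_cons (e : Block) (l : List Block) : wedge (e :: l) = edgeVec e * wedge l := by
  simp [wedge]

theorem wedge_append (l l' : List Block) : wedge (l ++ l') = wedge l * wedge l' := by
  simp [wedge]

theorem relabel_wedge (φ : Block → Block) (l : List Block) :
    relabel φ (wedge l) = wedge (l.map φ) := by
  induction l with
  | nil => simp [wedge]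
  | cons e l ih =>
    rw [wedge_cons, List.map_cons, wedge_cons, map_mul, ih]
    congr 1
    simp [relabel, edgeVec, Finsupp.mapDomain_single]

theorem remove_edgeVec_mul (e e' : Block) (x : Ext) :
    remove e (edgeVec e' * x) = (if e' = e then x else 0) - edgeVec e' * remove e x := by
  have h := CliffordAlgebra.contractLeft_ι_mul (Q := (0 : QuadraticForm ℤ (Block →₀ ℤ)))
    (d := (Finsupp.lapply e : (Block →₀ ℤ) →ₗ[ℤ] ℤ)) (Finsupp.single e' (1 : ℤ)) x
  refine h.trans ?_
  rw [Finsupp.lapply_apply, Finsupp.single_apply]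
  split_ifs
  · rw [one_smul]; rfl
  · rw [zero_smul]; rfl

theorem remove_wedge_of_notMem {e : Block} {l : List Block} (h : e ∉ l) :
    remove e (wedge l) = 0 := by
  induction l with
  | nil => exact CliffordAlgebra.contractLeft_one _ _
  | cons a l ih =>
    rw [List.mem_cons, not_or] at h
    rw [wedge_cons, remove_edgeVec_mul, if_neg (Ne.symm h.1), ih h.2, mul_zero, sub_zero]

/-- The explicit form of the contraction (positions counted from `0`). -/
theorem remove_wedge {l : List Block} (hl : l.Nodup) (j : ℕ) (hj : j < l.length) :
    remove l[j] (wedge l) = (-1 : ℤ) ^ j • wedge (l.eraseIdx j) := by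
  induction l generalizing j with
  | nil => simp at hj
  | cons a l ih =>
    rw [List.nodup_cons] at hl
    cases j with
    | zero =>
      rw [wedge_cons, remove_edgeVec_mul]
      simp [remove_wedge_of_notMem hl.1]
    | succ j =>
      have hj' : j < l.length := by simpa using hj
      have hne : a ≠ l[j] := fun h => hl.1 (h ▸ List.getElem_mem hj')
      rw [wedge_cons, remove_edgeVec_mul]
      simp only [List.getElem_cons_succ, List.eraseIdx_cons_succ]
      rw [if_neg hne, ih hl.2 j hj', wedge_cons, mul_smul_comm, pow_succ]
      simp

theorem IsOrientation.neg {S : Finset Block} {ω : Ext} (h : IsOrientation S ω) :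
    IsOrientation S (-ω) := by
  obtain ⟨l, h1, h2, rfl | rfl⟩ := h
  · exact ⟨l, h1, h2, Or.inr rfl⟩
  · exact ⟨l, h1, h2, Or.inl (neg_neg _)⟩

theorem IsOrientation.mul {S S' : Finset Block} {ω ω' : Ext} (h : IsOrientation S ω)
    (h' : IsOrientation S' ω') (hd : Disjoint S S') : IsOrientation (S ∪ S') (ω * ω') := by
  obtain ⟨l, h1, h2, h3⟩ := h
  obtain ⟨l', h1', h2', h3'⟩ := h'
  refine ⟨l ++ l', ?_, by rw [List.toFinset_append, h2, h2'], ?_⟩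
  · refine h1.append h1' ?_
    intro a ha ha'
    exact Finset.disjoint_left.1 hd (h2 ▸ List.mem_toFinset.2 ha) (h2' ▸ List.mem_toFinset.2 ha')
  · rw [wedge_append]
    rcases h3 with rfl | rfl <;> rcases h3' with rfl | rfl <;> simp

theorem IsOrientation.relabel {S : Finset Block} {ω : Ext} (h : IsOrientation S ω)
    {φ : Block → Block} (hφ : Set.InjOn φ S) : IsOrientation (S.image φ) (relabel φ ω) := by
  obtain ⟨l, h1, h2, h3⟩ := h
  refine ⟨l.map φ, ?_, ?_, ?_⟩
  · refine h1.map_on ?_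
    intro x hx y hy hxy
    exact hφ (by simpa [← h2] using hx) (by simpa [← h2] using hy) hxy
  · ext x; simp [← h2]
  · rw [← relabel_wedge]
    rcases h3 with rfl | rfl <;> simp

theorem isOrientation_empty_one : IsOrientation ∅ 1 :=
  ⟨[], by simp, by simp, Or.inl (by simp [wedge])⟩

theorem isOrientation_edgeVec (e : Block) : IsOrientation {e} (edgeVec e) :=
  ⟨[e], by simp, by simp, Or.inl (by simp [wedge])⟩

theorem IsOrientation.remove {S : Finset Block} {ω : Ext} (h : IsOrientation S ω)
    {e : Block} (he : e ∈ S) : IsOrientation (S.erase e) (remove e ω) := by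
  obtain ⟨l, h1, h2, h3⟩ := h
  have hel : e ∈ l := by simpa [← h2] using he
  obtain ⟨j, hj, rfl⟩ := List.getElem_of_mem hel
  have hn : (l.eraseIdx j).Nodup := h1.sublist (List.eraseIdx_sublist _ _)
  refine ⟨l.eraseIdx j, hn, ?_, ?_⟩
  · rw [← h1.erase_getElem j hj, ← h2]
    ext x
    simp [h1.mem_erase_iff]
  · have key := remove_wedge h1 j hj
    rcases neg_one_pow_eq_or ℤ j with h | h <;> rw [h] at key <;> rcases h3 with rfl | rfl <;>
      simp [key]

/-- The opposite orientation. -/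
instance (S : Finset Block) : Neg (Orientation S) := ⟨fun ω => ⟨-ω.1, ω.2.neg⟩⟩

/-! ## Modules generated by oriented objects -/

section OrMod

variable (R : Type*) [CommRing R] {X : Type} (S : X → Finset Block)

/-- The relations `(x, -ω) = -(x, ω)`. -/
def orRel : Submodule R ((Σ x, Orientation (S x)) →₀ R) :=
  Submodule.span R (Set.range fun g : Σ x, Orientation (S x) =>
    Finsupp.single (⟨g.1, -g.2⟩ : Σ x, Orientation (S x)) (1 : R) + Finsupp.single g 1)

/-- The `R`-module generated by the pairs `(x, ω)`, where `ω` is an orientation on the finite set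
of edges `S x`, modulo `(x, -ω) = -(x, ω)`. -/
abbrev OrMod : Type _ := ((Σ x, Orientation (S x)) →₀ R) ⧸ orRel R S

variable {S}

/-- The generator `(x, ω)`. -/
def OrMod.mk (x : X) (ω : Orientation (S x)) : OrMod R S :=
  Submodule.Quotient.mk (Finsupp.single ⟨x, ω⟩ 1)

variable {R} {N : Type*} [AddCommGroup N] [Module R N]

/-- The linear map with prescribed values on generators. -/
def OrMod.lift (φ : ∀ x, Orientation (S x) → N) (hφ : ∀ x ω, φ x (-ω) = - φ x ω) :
    OrMod R S →ₗ[R] N :=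
  (orRel R S).liftQ (Finsupp.lift N R _ fun g => φ g.1 g.2) (by
    rw [orRel, Submodule.span_le]
    rintro _ ⟨g, rfl⟩
    rw [SetLike.mem_coe, LinearMap.mem_ker, map_add]
    simp [hφ])

theorem OrMod.lift_mk (φ : ∀ x, Orientation (S x) → N) (hφ : ∀ x ω, φ x (-ω) = - φ x ω)
    (x : X) (ω : Orientation (S x)) :
    OrMod.lift φ hφ (OrMod.mk R x ω) = φ x ω := by
  simp [OrMod.lift, OrMod.mk]

theorem OrMod.mk_neg (x : X) (ω : Orientation (S x)) :
    OrMod.mk R x (-ω) = - OrMod.mk R x ω := by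
  rw [eq_neg_iff_add_eq_zero, OrMod.mk, OrMod.mk, ← Submodule.Quotient.mk_add,
    Submodule.Quotient.mk_eq_zero]
  exact Submodule.subset_span ⟨⟨x, ω⟩, rfl⟩

end OrMod

/-! ## Grafting -/

/-- Leaf number `p` of diagrams over `c` has the color of the root of diagrams over `d`, so that
the root can be attached to the leaf. -/
def CanGraft (c d : Corolla) (p : ℕ) : Prop := p < c.arity ∧ c.leafColor p = d.root

/-- The corolla to which the diagram contracts that is obtained by attaching the root of `d` to
leaf number `p` of `c`.  (The value is only used when `CanGraft c d p`.) -/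
def graftCorolla : Corolla → Corolla → ℕ → Corolla
  | .T n hn, .T m hm, _ => .T (n + m - 1) (by omega)
  | .M j k h, .T m hm, p =>
      if p < j then .M (j + m - 1) k (by omega) else .M j (k + m - 1) (by omega)
  | .M j k h, .M j' k' _, _ => .M (j + j') (k + k') (by omega)
  | .I j k, .T m _, p => if p ≤ j then .I (j + m - 1) k else .I j (k + m - 1)
  | .I j k, .M j' k' _, p => if p = 0 then .I (j + k') (k + j') else .I (j + j') (k + k')
  | c, _, _ => c

/-- When a module tree is attached to the left thick leaf of an inner product diagram, then the
canonical numbering of the result starts with the thick leaf of the module tree, hence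
the leaves to the left of that one come last. This is the number of those leaves, and `0` in all
other cases. -/
def graftShift : Corolla → Corolla → ℕ → ℕ
  | .I _ _, .M j' _ _, p => if p = 0 then j' else 0
  | _, _, _ => 0

section Graft

variable (c d : Corolla) (p : ℕ)

/-- The number of leaves after grafting. -/
abbrev graftArity : ℕ := c.arity + d.arity - 1

/-- From the canonical number of a leaf after grafting to its position in the sequence in which
leaf `p` of `c` is replaced by the sequence of all leaves of `d`. -/
def seqPos (x : ℕ) : ℕ :=
  if x + graftShift c d p < graftArity c d then x + graftShift c d p
  else x + graftShift c d p - graftArity c d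

/-- The inverse of `seqPos`. -/
def canonPos (u : ℕ) : ℕ :=
  if graftShift c d p ≤ u then u - graftShift c d p
  else u + graftArity c d - graftShift c d p

/-- The new canonical number of leaf number `y ≠ p` of `c`. -/
def hostLeaf (y : ℕ) : ℕ := canonPos c d p (if y < p then y else y + d.arity - 1)

/-- The new canonical number of leaf number `y` of `d`. -/
def guestLeaf (y : ℕ) : ℕ := canonPos c d p (p + y)

/-- The leaf of `c` below the leaf `x` of the grafted diagram: the leaf itself if it comes from
`c`, and `p` if it comes from `d`. -/
def leafBelow (x : ℕ) : ℕ :=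
  if seqPos c d p x < p then seqPos c d p x
  else if seqPos c d p x < p + d.arity then p else seqPos c d p x + 1 - d.arity

/-- The leaves outward from an edge of the host, after grafting. -/
def hostBlock (b : Block) : Block :=
  (Finset.range (graftArity c d)).filter fun x => leafBelow c d p x ∈ b

/-- The leaves outward from an edge of the attached diagram, after grafting. -/
def guestBlock (b : Block) : Block :=
  (Finset.range (graftArity c d)).filter fun x => p ≤ seqPos c d p x ∧ seqPos c d p x - p ∈ b

/-- The new edge. -/
def newEdge : Block := guestBlock c d p (Finset.range d.arity)

variable {c d p}

theorem graftShift_lt : graftShift c d p < d.arity := by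
  have := d.two_le_arity
  unfold graftShift
  split
  · split_ifs
    · simp only [Corolla.arity]; omega
    · omega
  · omega

theorem CanGraft.root_ne_zero (h : CanGraft c d p) : d.root ≠ 0 := by
  rw [← h.2]
  cases c <;> simp only [Corolla.leafColor] <;> (try split_ifs) <;> decide

theorem CanGraft.tree_or (h : CanGraft c d p) :
    ((∃ n hn, d = .T n hn) ∧ c.leafColor p = 1) ∨
    ((∃ j k hjk, d = .M j k hjk) ∧ c.leafColor p = 2) := by
  have h1 := h.root_ne_zero
  have h2 := h.2
  cases d with
  | T n hn => exact Or.inl ⟨⟨n, hn, rfl⟩, h2⟩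
  | M j k hjk => exact Or.inr ⟨⟨j, k, hjk, rfl⟩, h2⟩
  | I j k => exact absurd rfl h1

theorem CanGraft.arity_graftCorolla (h : CanGraft c d p) :
    (graftCorolla c d p).arity = graftArity c d := by
  have h1 := h.1
  rcases h.tree_or with ⟨⟨n, hn, rfl⟩, h2⟩ | ⟨⟨j', k', hjk', rfl⟩, h2⟩
  · cases c <;>
    simp only [graftCorolla, graftArity] at h1 ⊢ <;>
    (try split_ifs) <;> (try simp only [Corolla.arity]) <;> omega
  · cases c
    · exact absurd h2 (by simp [Corolla.leafColor])
    all_goals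
      simp only [graftCorolla, graftArity] at h1 ⊢
      (try split_ifs) <;> (try simp only [Corolla.arity]) <;> omega

theorem seqPos_lt {x : ℕ} (hx : x < graftArity c d) : seqPos c d p x < graftArity c d := by
  have := @graftShift_lt c d p
  have := c.two_le_arity
  unfold seqPos graftArity at *
  split_ifs <;> omega

theorem canonPos_lt {u : ℕ} (hu : u < graftArity c d) : canonPos c d p u < graftArity c d := by
  have := @graftShift_lt c d p
  have := c.two_le_arity
  unfold canonPos graftArity at *
  split_ifs <;> omega

theorem seqPos_canonPos {u : ℕ} (hu : u < graftArity c d) :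
    seqPos c d p (canonPos c d p u) = u := by
  have := @graftShift_lt c d p
  have := c.two_le_arity
  unfold seqPos canonPos graftArity at *
  split_ifs <;> omega

theorem canonPos_inj {u v : ℕ} (hu : u < graftArity c d) (hv : v < graftArity c d)
    (h : canonPos c d p u = canonPos c d p v) : u = v := by
  rw [← seqPos_canonPos (p := p) hu, h, seqPos_canonPos hv]

theorem CanGraft.exists_leafBelow (h : CanGraft c d p) {y : ℕ} (hy : y < c.arity) :
    ∃ x < graftArity c d, leafBelow c d p x = y := by
  have h1 := h.1
  have := d.two_le_arity
  by_cases hlt : y ≤ p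
  · have hu : y < graftArity c d := by unfold graftArity; omega
    refine ⟨canonPos c d p y, canonPos_lt hu, ?_⟩
    unfold leafBelow
    rw [seqPos_canonPos hu]
    split_ifs <;> omega
  · have hu : y + d.arity - 1 < graftArity c d := by unfold graftArity; omega
    refine ⟨canonPos c d p (y + d.arity - 1), canonPos_lt hu, ?_⟩
    unfold leafBelow
    rw [seqPos_canonPos hu]
    split_ifs <;> omega

theorem leafBelow_lt {x : ℕ} (hp : p < c.arity) (hx : x < graftArity c d) :
    leafBelow c d p x < c.arity := by
  have := seqPos_lt (p := p) hx
  have := d.two_le_arity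
  unfold leafBelow graftArity at *
  split_ifs <;> omega

theorem mem_newEdge {x : ℕ} :
    x ∈ newEdge c d p ↔ x < graftArity c d ∧ leafBelow c d p x = p := by
  have := d.two_le_arity
  simp only [newEdge, guestBlock, Finset.mem_filter, Finset.mem_range, leafBelow]
  split_ifs <;> omega

theorem mem_hostBlock {x : ℕ} {b : Block} :
    x ∈ hostBlock c d p b ↔ x < graftArity c d ∧ leafBelow c d p x ∈ b := by
  simp [hostBlock]

theorem mem_guestBlock {x : ℕ} {b : Block} : x ∈ guestBlock c d p b ↔
    x < graftArity c d ∧ p ≤ seqPos c d p x ∧ seqPos c d p x - p ∈ b := by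
  simp [guestBlock]

theorem seqPos_of_shift (hs : graftShift c d p = 0) {x : ℕ} (hx : x < graftArity c d) :
    seqPos c d p x = x := by
  simp [seqPos, hs, hx]

theorem mem_hostBlock_of_shift (hs : graftShift c d p = 0) {x : ℕ} {b : Block} :
    x ∈ hostBlock c d p b ↔ x < graftArity c d ∧
      ((x < p ∧ x ∈ b) ∨ (p ≤ x ∧ x < p + d.arity ∧ p ∈ b) ∨
        (p + d.arity ≤ x ∧ x + 1 - d.arity ∈ b)) := by
  have := d.two_le_arity
  rw [mem_hostBlock]
  refine and_congr_right fun hx => ?_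
  rw [leafBelow, seqPos_of_shift hs hx]
  split_ifs with h1 h2
  · exact ⟨fun h => Or.inl ⟨h1, h⟩, by
      rintro (h | h | h)
      · exact h.2
      · omega
      · omega⟩
  · exact ⟨fun h => Or.inr (Or.inl ⟨by omega, h2, h⟩), by
      rintro (h | h | h)
      · omega
      · exact h.2.2
      · omega⟩
  · exact ⟨fun h => Or.inr (Or.inr ⟨by omega, h⟩), by
      rintro (h | h | h)
      · omega
      · omega
      · exact h.2⟩

theorem mem_guestBlock_of_shift (hs : graftShift c d p = 0) {x : ℕ} {b : Block} :
    x ∈ guestBlock c d p b ↔ x < graftArity c d ∧ p ≤ x ∧ x - p ∈ b := by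
  rw [mem_guestBlock]
  refine and_congr_right fun hx => ?_
  rw [seqPos_of_shift hs hx]

theorem guestBlock_subset {b : Block} (hb : b ⊆ Finset.range d.arity) :
    guestBlock c d p b ⊆ newEdge c d p := by
  intro x hx
  rw [newEdge, mem_guestBlock]
  rw [mem_guestBlock] at hx
  exact ⟨hx.1, hx.2.1, hb hx.2.2⟩

theorem CanGraft.hostBlock_injOn (h : CanGraft c d p) {b b' : Block}
    (hb : b ⊆ Finset.range c.arity) (hb' : b' ⊆ Finset.range c.arity)
    (he : hostBlock c d p b = hostBlock c d p b') : b = b' := by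
  ext y
  by_cases hy : y < c.arity
  · obtain ⟨x, hx, rfl⟩ := h.exists_leafBelow hy
    have := Finset.ext_iff.1 he x
    rw [mem_hostBlock, mem_hostBlock] at this
    tauto
  · constructor
    · intro h; exact absurd (Finset.mem_range.1 (hb h)) hy
    · intro h; exact absurd (Finset.mem_range.1 (hb' h)) hy

theorem CanGraft.exists_guest (h : CanGraft c d p) {y : ℕ} (hy : y < d.arity) :
    ∃ x < graftArity c d, seqPos c d p x = p + y := by
  have h1 := h.1
  have hu : p + y < graftArity c d := by unfold graftArity; omega
  exact ⟨canonPos c d p (p + y), canonPos_lt hu, seqPos_canonPos hu⟩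

theorem CanGraft.guestBlock_injOn (h : CanGraft c d p) {b b' : Block}
    (hb : b ⊆ Finset.range d.arity) (hb' : b' ⊆ Finset.range d.arity)
    (he : guestBlock c d p b = guestBlock c d p b') : b = b' := by
  ext y
  by_cases hy : y < d.arity
  · obtain ⟨x, hx, hxy⟩ := h.exists_guest hy
    have := Finset.ext_iff.1 he x
    rw [mem_guestBlock, mem_guestBlock, hxy] at this
    simp only [hx, true_and, Nat.le_add_right, Nat.add_sub_cancel_left] at this
    exact this
  · constructor
    · intro h; exact absurd (Finset.mem_range.1 (hb h)) hy
    · intro h; exact absurd (Finset.mem_range.1 (hb' h)) hy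

/-- A diagram which can be attached is a tree, hence its edges cut off proper subsets. -/
theorem CanGraft.isBlock_guest (h : CanGraft c d p) {b : Block} (hb : d.IsBlock b) :
    IsProperInterval d.arity b := by
  cases d with
  | T n hn => exact hb
  | M j k hjk => exact hb
  | I j k =>
    exact absurd rfl h.root_ne_zero

theorem CanGraft.ne_range (h : CanGraft c d p) {b : Block} (hb : d.IsBlock b) :
    b ≠ Finset.range d.arity := by
  obtain ⟨x, y, h1, h2, h3, rfl⟩ := h.isBlock_guest hb
  intro he
  have e0 := Finset.ext_iff.1 he 0
  have e1 := Finset.ext_iff.1 he (d.arity - 1)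
  have := d.two_le_arity
  simp only [Finset.mem_Ico, Finset.mem_range] at e0 e1
  omega

theorem CanGraft.isBlock_hostBlock (h : CanGraft c d p) {b : Block} (hb : c.IsBlock b) :
    (graftCorolla c d p).IsBlock (hostBlock c d p b) := by
  have h1 := h.1
  have hl := d.two_le_arity
  rcases h.tree_or with ⟨⟨n, hn, rfl⟩, h2⟩ | ⟨⟨j', k', hjk', rfl⟩, h2⟩
  · cases c with
    | T m hm =>
      obtain ⟨x, y, hx, hy, hxy, rfl⟩ := hb
      simp only [Corolla.arity] at h1
      refine ⟨if x ≤ p then x else x + n - 1, if y ≤ p then y else y + n - 1, ?_, ?_, ?_, ?_⟩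
      · split_ifs <;> omega
      · split_ifs <;> omega
      · split_ifs <;> omega
      · ext z
        rw [mem_hostBlock_of_shift (by simp [graftShift])]
        simp only [graftArity, Corolla.arity, Finset.mem_Ico]
        (try split_ifs) <;> omega
    | M j k hjk =>
      obtain ⟨x, y, hx, hy, hxy, rfl⟩ := hb
      simp only [Corolla.arity, Corolla.leafColor] at h1 h2
      have hp : p ≠ j := by rintro rfl; simp at h2
      have hN : IsProperInterval (j + k + n)
          (hostBlock (.M j k hjk) (.T n hn) p (Finset.Ico x y)) := by
        refine ⟨if x ≤ p then x else x + n - 1, if y ≤ p then y else y + n - 1, ?_, ?_, ?_, ?_⟩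
        · split_ifs <;> omega
        · split_ifs <;> omega
        · split_ifs <;> omega
        · ext z
          rw [mem_hostBlock_of_shift (by simp [graftShift])]
          simp only [graftArity, Corolla.arity, Finset.mem_Ico]
          (try split_ifs) <;> omega
      simp only [graftCorolla]
      split_ifs
      · have : j + n - 1 + k + 1 = j + k + n := by omega
        rw [Corolla.IsBlock, this]; exact hN
      · have : j + (k + n - 1) + 1 = j + k + n := by omega
        rw [Corolla.IsBlock, this]; exact hN
    | I j k =>
      simp only [Corolla.arity, Corolla.leafColor] at h1 h2
      have hp : p ≠ 0 ∧ p ≠ j + 1 := by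
        constructor
        · rintro rfl; simp at h2
        · rintro rfl; simp at h2
      rcases hb with ⟨x, y, hx, hxy, hy, rfl⟩ | ⟨x, y, hy1, hy2, hx1, hx2, hxy, rfl⟩
      · simp only [graftCorolla]
        split_ifs
        all_goals
          refine Or.inl ⟨if x ≤ p then x else x + n - 1, if y ≤ p then y else y + n - 1,
            ?_, ?_, ?_, ?_⟩
          · split_ifs <;> omega
          · split_ifs <;> omega
          · split_ifs <;> omega
          · ext z
            rw [mem_hostBlock_of_shift (by simp [graftShift])]
            simp only [graftArity, Corolla.arity, Finset.mem_Ico]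
            (try split_ifs) <;> omega
      · simp only [graftCorolla]
        split_ifs
        all_goals
          refine Or.inr ⟨if x ≤ p then x else x + n - 1, if y ≤ p then y else y + n - 1,
            ?_, ?_, ?_, ?_, ?_, ?_⟩
          · split_ifs <;> omega
          · split_ifs <;> omega
          · split_ifs <;> omega
          · split_ifs <;> omega
          · split_ifs <;> omega
          · ext z
            rw [mem_hostBlock_of_shift (by simp [graftShift])]
            simp only [graftArity, Corolla.arity, Finset.mem_Ico, Finset.mem_union]
            (try split_ifs) <;> omega
  · cases c with
    | T m hm => exact absurd h2 (by simp [Corolla.leafColor])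
    | M j k hjk =>
      obtain ⟨x, y, hx, hy, hxy, rfl⟩ := hb
      simp only [Corolla.arity] at h1
      have hp : p = j := by
        by_contra hne
        simp [Corolla.leafColor, hne] at h2
      refine ⟨if x ≤ p then x else x + (j' + k'), if y ≤ p then y else y + (j' + k'),
        ?_, ?_, ?_, ?_⟩
      · split_ifs <;> omega
      · split_ifs <;> omega
      · split_ifs <;> omega
      · ext z
        rw [mem_hostBlock_of_shift (by simp [graftShift])]
        simp only [graftArity, Corolla.arity, Finset.mem_Ico]
        (try split_ifs) <;> omega
    | I j k =>
      simp only [Corolla.arity] at h1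
      have hp : p = 0 ∨ p = j + 1 := by
        by_contra hne
        simp [Corolla.leafColor, hne] at h2
      simp only [graftCorolla]
      rcases hp with rfl | rfl
      · rw [if_pos rfl]
        rcases hb with ⟨x, y, hx, hxy, hy, rfl⟩ | ⟨x, y, hy1, hy2, hx1, hx2, hxy, rfl⟩
        · refine Or.inl ⟨x + k', y + k', ?_, ?_, ?_, ?_⟩
          · omega
          · omega
          · omega
          · ext z
            simp only [mem_hostBlock, leafBelow, seqPos, graftShift, graftArity, Corolla.arity,
              Finset.mem_Ico, if_true]
            split_ifs <;> omega
        · refine Or.inr ⟨x + k', y + k', ?_, ?_, ?_, ?_, ?_, ?_⟩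
          · omega
          · omega
          · omega
          · omega
          · omega
          · ext z
            simp only [mem_hostBlock, leafBelow, seqPos, graftShift, graftArity, Corolla.arity,
              Finset.mem_Ico, Finset.mem_union, if_true]
            split_ifs <;> omega
      · rw [if_neg (by omega)]
        rcases hb with ⟨x, y, hx, hxy, hy, rfl⟩ | ⟨x, y, hy1, hy2, hx1, hx2, hxy, rfl⟩
        · refine Or.inl ⟨if x ≤ j + 1 then x else x + (j' + k'),
            if y ≤ j + 1 then y else y + (j' + k'), ?_, ?_, ?_, ?_⟩
          · split_ifs <;> omega
          · split_ifs <;> omega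
          · split_ifs <;> omega
          · ext z
            rw [mem_hostBlock_of_shift (by simp [graftShift])]
            simp only [graftArity, Corolla.arity, Finset.mem_Ico]
            (try split_ifs) <;> omega
        · refine Or.inr ⟨x + (j' + k'), y, ?_, ?_, ?_, ?_, ?_, ?_⟩
          · omega
          · omega
          · omega
          · omega
          · omega
          · ext z
            rw [mem_hostBlock_of_shift (by simp [graftShift])]
            simp only [graftArity, Corolla.arity, Finset.mem_Ico, Finset.mem_union]
            omega

theorem CanGraft.isBlock_guest_Ico (h : CanGraft c d p) {x y : ℕ} (hxy : x + 2 ≤ y)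
    (hy : y ≤ d.arity) : (graftCorolla c d p).IsBlock (guestBlock c d p (Finset.Ico x y)) := by
  have h1 := h.1
  have hc := c.two_le_arity
  rcases h.tree_or with ⟨⟨n, hn, rfl⟩, h2⟩ | ⟨⟨j', k', hjk', rfl⟩, h2⟩
  · cases c with
    | T m hm =>
      simp only [Corolla.arity] at h1 hy hc
      refine ⟨p + x, p + y, ?_, ?_, ?_, ?_⟩
      · omega
      · omega
      · omega
      · ext z
        rw [mem_guestBlock_of_shift (by simp [graftShift])]
        simp only [graftArity, Corolla.arity, Finset.mem_Ico]
        omega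
    | M j k hjk =>
      simp only [Corolla.arity] at h1 hy hc
      have hN : IsProperInterval (j + k + n)
          (guestBlock (.M j k hjk) (.T n hn) p (Finset.Ico x y)) := by
        refine ⟨p + x, p + y, ?_, ?_, ?_, ?_⟩
        · omega
        · omega
        · omega
        · ext z
          rw [mem_guestBlock_of_shift (by simp [graftShift])]
          simp only [graftArity, Corolla.arity, Finset.mem_Ico]
          omega
      simp only [graftCorolla]
      split_ifs
      · have : j + n - 1 + k + 1 = j + k + n := by omega
        rw [Corolla.IsBlock, this]; exact hN
      · have : j + (k + n - 1) + 1 = j + k + n := by omega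
        rw [Corolla.IsBlock, this]; exact hN
    | I j k =>
      simp only [Corolla.arity, Corolla.leafColor] at h1 h2 hy
      have hp : p ≠ 0 := by rintro rfl; simp at h2
      simp only [graftCorolla]
      split_ifs
      all_goals
        refine Or.inl ⟨p + x, p + y, ?_, ?_, ?_, ?_⟩
        · omega
        · omega
        · omega
        · ext z
          rw [mem_guestBlock_of_shift (by simp [graftShift])]
          simp only [graftArity, Corolla.arity, Finset.mem_Ico]
          omega
  · cases c with
    | T m hm => exact absurd h2 (by simp [Corolla.leafColor])
    | M j k hjk =>
      simp only [Corolla.arity] at h1 hy hc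
      have hp : p = j := by
        by_contra hne
        simp [Corolla.leafColor, hne] at h2
      refine ⟨p + x, p + y, ?_, ?_, ?_, ?_⟩
      · omega
      · omega
      · omega
      · ext z
        rw [mem_guestBlock_of_shift (by simp [graftShift])]
        simp only [graftArity, Corolla.arity, Finset.mem_Ico]
        omega
    | I j k =>
      simp only [Corolla.arity] at h1 hy
      have hp : p = 0 ∨ p = j + 1 := by
        by_contra hne
        simp [Corolla.leafColor, hne] at h2
      simp only [graftCorolla]
      rcases hp with rfl | rfl
      · rw [if_pos rfl]
        by_cases hx : j' < x
        · refine Or.inl ⟨x - j', y - j', ?_, ?_, ?_, ?_⟩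
          · omega
          · omega
          · omega
          · ext z
            simp only [mem_guestBlock, seqPos, graftShift, graftArity, Corolla.arity,
              Finset.mem_Ico, if_true]
            split_ifs <;> omega
        · by_cases hy' : y ≤ j'
          · refine Or.inl ⟨x + (j + k + 2 + k'), y + (j + k + 2 + k'), ?_, ?_, ?_, ?_⟩
            · omega
            · omega
            · omega
            · ext z
              simp only [mem_guestBlock, seqPos, graftShift, graftArity, Corolla.arity,
                Finset.mem_Ico, if_true]
              split_ifs <;> omega
          · refine Or.inr ⟨x + (j + k + 2 + k'), y - j', ?_, ?_, ?_, ?_, ?_, ?_⟩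
            · omega
            · omega
            · omega
            · omega
            · omega
            · ext z
              simp only [mem_guestBlock, seqPos, graftShift, graftArity, Corolla.arity,
                Finset.mem_Ico, Finset.mem_union, if_true]
              split_ifs <;> omega
      · rw [if_neg (by omega)]
        refine Or.inl ⟨j + 1 + x, j + 1 + y, ?_, ?_, ?_, ?_⟩
        · omega
        · omega
        · omega
        · ext z
          rw [mem_guestBlock_of_shift (by simp [graftShift])]
          simp only [graftArity, Corolla.arity, Finset.mem_Ico]
          omega

theorem CanGraft.isBlock_guestBlock (h : CanGraft c d p) {b : Block} (hb : d.IsBlock b) :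
    (graftCorolla c d p).IsBlock (guestBlock c d p b) := by
  obtain ⟨x, y, h1, h2, -, rfl⟩ := h.isBlock_guest hb
  exact h.isBlock_guest_Ico h1 h2

theorem CanGraft.isBlock_newEdge (h : CanGraft c d p) :
    (graftCorolla c d p).IsBlock (newEdge c d p) := by
  have := h.isBlock_guest_Ico (x := 0) (y := d.arity) d.two_le_arity le_rfl
  rwa [newEdge, Finset.range_eq_Ico]

theorem compatible_symm {b b' : Block} (h : Compatible b b') : Compatible b' b := by
  rcases h with h | h | h
  · exact Or.inr (Or.inl h)
  · exact Or.inl h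
  · exact Or.inr (Or.inr h.symm)

theorem compatible_hostBlock {b b' : Block} (h : Compatible b b') :
    Compatible (hostBlock c d p b) (hostBlock c d p b') := by
  rcases h with h | h | h
  · exact Or.inl fun x hx => by
      rw [mem_hostBlock] at *; exact ⟨hx.1, h hx.2⟩
  · exact Or.inr (Or.inl fun x hx => by
      rw [mem_hostBlock] at *; exact ⟨hx.1, h hx.2⟩)
  · refine Or.inr (Or.inr (Finset.disjoint_left.2 fun x hx hx' => ?_))
    rw [mem_hostBlock] at *
    exact Finset.disjoint_left.1 h hx.2 hx'.2

theorem compatible_guestBlock {b b' : Block} (h : Compatible b b') :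
    Compatible (guestBlock c d p b) (guestBlock c d p b') := by
  rcases h with h | h | h
  · exact Or.inl fun x hx => by
      rw [mem_guestBlock] at *; exact ⟨hx.1, hx.2.1, h hx.2.2⟩
  · exact Or.inr (Or.inl fun x hx => by
      rw [mem_guestBlock] at *; exact ⟨hx.1, hx.2.1, h hx.2.2⟩)
  · refine Or.inr (Or.inr (Finset.disjoint_left.2 fun x hx hx' => ?_))
    rw [mem_guestBlock] at *
    exact Finset.disjoint_left.1 h hx.2.2 hx'.2.2

theorem newEdge_subset_or_disjoint (b : Block) :
    newEdge c d p ⊆ hostBlock c d p b ∨ Disjoint (newEdge c d p) (hostBlock c d p b) := by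
  by_cases hp : p ∈ b
  · refine Or.inl fun x hx => ?_
    rw [mem_newEdge] at hx
    rw [mem_hostBlock, hx.2]
    exact ⟨hx.1, hp⟩
  · refine Or.inr (Finset.disjoint_left.2 fun x hx hx' => hp ?_)
    rw [mem_newEdge] at hx
    rw [mem_hostBlock, hx.2] at hx'
    exact hx'.2

theorem compatible_guest_host {b b' : Block} (hb : b ⊆ newEdge c d p) :
    Compatible b (hostBlock c d p b') := by
  rcases newEdge_subset_or_disjoint (c := c) (d := d) (p := p) b' with h | h
  · exact Or.inl (hb.trans h)
  · exact Or.inr (Or.inr (Finset.disjoint_of_subset_left hb h))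

/-- `D ∘_p E`: attach the root of `E` to leaf number `p` of `D`.  Its edges are those of `D`,
those of `E`, and the new edge. -/
def graft (h : CanGraft c d p) (D : Diagram c) (E : Diagram d) :
    Diagram (graftCorolla c d p) where
  edges := D.edges.image (hostBlock c d p) ∪ E.edges.image (guestBlock c d p) ∪ {newEdge c d p}
  isBlock b hb := by
    simp only [Finset.mem_union, Finset.mem_image, Finset.mem_singleton] at hb
    rcases hb with (⟨a, ha, rfl⟩ | ⟨a, ha, rfl⟩) | rfl
    · exact h.isBlock_hostBlock (D.isBlock a ha)
    · exact h.isBlock_guestBlock (E.isBlock a ha)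
    · exact h.isBlock_newEdge
  compatible b hb b' hb' := by
    simp only [Finset.mem_union, Finset.mem_image, Finset.mem_singleton] at hb hb'
    have hs : ∀ a ∈ E.edges, guestBlock c d p a ⊆ newEdge c d p := fun a ha =>
      guestBlock_subset (E.isBlock a ha).subset
    rcases hb with (⟨a, ha, rfl⟩ | ⟨a, ha, rfl⟩) | rfl <;>
      rcases hb' with (⟨a', ha', rfl⟩ | ⟨a', ha', rfl⟩) | rfl
    · exact compatible_hostBlock (D.compatible a ha a' ha')
    · exact compatible_symm (compatible_guest_host (hs a' ha'))
    · exact compatible_symm (compatible_guest_host subset_rfl)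
    · exact compatible_guest_host (hs a ha)
    · exact compatible_guestBlock (E.compatible a ha a' ha')
    · exact Or.inl (hs a ha)
    · exact compatible_guest_host subset_rfl
    · exact Or.inr (Or.inl (hs a' ha'))
    · exact Or.inl subset_rfl

theorem CanGraft.injOn_host (h : CanGraft c d p) (D : Diagram c) :
    Set.InjOn (hostBlock c d p) D.edges := fun _ hb _ hb' he =>
  h.hostBlock_injOn (D.isBlock _ hb).subset (D.isBlock _ hb').subset he

theorem CanGraft.injOn_guest (h : CanGraft c d p) (E : Diagram d) :
    Set.InjOn (guestBlock c d p) E.edges := fun _ hb _ hb' he =>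
  h.guestBlock_injOn (E.isBlock _ hb).subset (E.isBlock _ hb').subset he

theorem CanGraft.hostBlock_not_subset (h : CanGraft c d p) {b : Block} (hb : c.IsBlock b) :
    ¬ hostBlock c d p b ⊆ newEdge c d p := by
  intro hs
  have key : ∀ y ∈ b, y = p := by
    intro y hy
    obtain ⟨x, hx, hxy⟩ := h.exists_leafBelow (Finset.mem_range.1 (hb.subset hy))
    have := hs (mem_hostBlock.2 ⟨hx, hxy ▸ hy⟩)
    rw [mem_newEdge] at this
    rw [← hxy, this.2]
  obtain ⟨x, hx, y, hy, hne⟩ := hb.exists_ne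
  exact hne ((key x hx).trans (key y hy).symm)

theorem CanGraft.disjoint_host_guest (h : CanGraft c d p) (D : Diagram c) (E : Diagram d) :
    Disjoint (D.edges.image (hostBlock c d p)) (E.edges.image (guestBlock c d p)) := by
  rw [Finset.disjoint_left]
  intro b hb hb'
  simp only [Finset.mem_image] at hb hb'
  obtain ⟨a, ha, rfl⟩ := hb
  obtain ⟨a', ha', he⟩ := hb'
  exact h.hostBlock_not_subset (D.isBlock a ha)
    (he ▸ guestBlock_subset (E.isBlock a' ha').subset)

theorem CanGraft.disjoint_newEdge (h : CanGraft c d p) (D : Diagram c) (E : Diagram d) :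
    Disjoint (D.edges.image (hostBlock c d p) ∪ E.edges.image (guestBlock c d p))
      {newEdge c d p} := by
  rw [Finset.disjoint_singleton_right]
  intro hb
  simp only [Finset.mem_union, Finset.mem_image] at hb
  rcases hb with ⟨a, ha, he⟩ | ⟨a, ha, he⟩
  · exact h.hostBlock_not_subset (D.isBlock a ha) (he ▸ subset_rfl)
  · exact h.ne_range (E.isBlock a ha)
      (h.guestBlock_injOn (E.isBlock a ha).subset subset_rfl he)

theorem CanGraft.hostLeaf_lt (h : CanGraft c d p) {y : ℕ} (hy : y < c.arity) :
    hostLeaf c d p y < graftArity c d := by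
  have := h.1
  have := d.two_le_arity
  refine canonPos_lt ?_
  unfold graftArity
  split_ifs <;> omega

theorem CanGraft.guestLeaf_lt (h : CanGraft c d p) {y : ℕ} (hy : y < d.arity) :
    guestLeaf c d p y < graftArity c d := by
  have := h.1
  refine canonPos_lt ?_
  unfold graftArity
  omega

theorem CanGraft.hostLeaf_inj (h : CanGraft c d p) {y y' : ℕ} (hy : y < c.arity)
    (hy' : y' < c.arity) (_ : y ≠ p) (_ : y' ≠ p)
    (he : hostLeaf c d p y = hostLeaf c d p y') : y = y' := by
  have := h.1
  have := d.two_le_arity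
  have := canonPos_inj (by unfold graftArity; split_ifs <;> omega)
    (by unfold graftArity; split_ifs <;> omega) he
  split_ifs at this <;> omega

theorem CanGraft.guestLeaf_inj (h : CanGraft c d p) {y y' : ℕ} (hy : y < d.arity)
    (hy' : y' < d.arity) (he : guestLeaf c d p y = guestLeaf c d p y') : y = y' := by
  have := h.1
  have := canonPos_inj (by unfold graftArity; omega) (by unfold graftArity; omega) he
  omega

theorem CanGraft.hostLeaf_ne_guestLeaf (h : CanGraft c d p) {y y' : ℕ} (hy : y < c.arity)
    (hp : y ≠ p) (hy' : y' < d.arity) : hostLeaf c d p y ≠ guestLeaf c d p y' := by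
  intro he
  have := h.1
  have := d.two_le_arity
  have := canonPos_inj (by unfold graftArity; split_ifs <;> omega)
    (by unfold graftArity; omega) he
  split_ifs at this <;> omega

end Graft

/-! ## Labelings -/

section Label

variable {c d : Corolla}

/-- The labeling `f_{D ∘ E}` of the leaves after grafting at the `i`-th leaf (labels and positions
are counted from `0` here): the labels before `i` are those of the host, the next
`d.arity` labels are those of the attached diagram, and the remaining ones are again
those of the host. -/
def graftLabelFun (f : Equiv.Perm (Fin c.arity)) (g : Equiv.Perm (Fin d.arity))
    (i : Fin c.arity) (j : Fin (graftArity c d)) : ℕ :=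
  if h : (j : ℕ) < i then hostLeaf c d (f i) (f ⟨j, h.trans i.2⟩)
  else if h' : (j : ℕ) < i + d.arity then guestLeaf c d (f i) (g ⟨j - i, by omega⟩)
  else hostLeaf c d (f i) (f ⟨j + 1 - d.arity, by
    have := j.2
    have := c.two_le_arity
    have := d.two_le_arity
    unfold graftArity at *
    omega⟩)

theorem graftLabelFun_lt (f : Equiv.Perm (Fin c.arity)) (g : Equiv.Perm (Fin d.arity))
    (i : Fin c.arity) (h : CanGraft c d (f i)) (j : Fin (graftArity c d)) :
    graftLabelFun f g i j < graftArity c d := by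
  unfold graftLabelFun
  split_ifs
  · exact h.hostLeaf_lt (Fin.isLt _)
  · exact h.guestLeaf_lt (Fin.isLt _)
  · exact h.hostLeaf_lt (Fin.isLt _)

theorem graftLabelFun_injective (f : Equiv.Perm (Fin c.arity)) (g : Equiv.Perm (Fin d.arity))
    (i : Fin c.arity) (h : CanGraft c d (f i)) : Function.Injective (graftLabelFun f g i) := by
  have hd := d.two_le_arity
  have hne : ∀ a : Fin c.arity, (a : ℕ) ≠ i → ((f a : Fin _) : ℕ) ≠ f i := by
    intro a ha he
    exact ha (congrArg Fin.val (f.injective (Fin.ext he)))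
  have key : ∀ a b : Fin c.arity, (a : ℕ) ≠ i → (b : ℕ) ≠ i →
      hostLeaf c d (f i) (f a) = hostLeaf c d (f i) (f b) → (a : ℕ) = b := by
    intro a b ha hb he
    have := h.hostLeaf_inj (f a).2 (f b).2 (hne a ha) (hne b hb) he
    exact congrArg Fin.val (f.injective (Fin.ext this))
  have key' : ∀ a b : Fin d.arity,
      guestLeaf c d (f i) (g a) = guestLeaf c d (f i) (g b) → (a : ℕ) = b := by
    intro a b he
    have := h.guestLeaf_inj (g a).2 (g b).2 he
    exact congrArg Fin.val (g.injective (Fin.ext this))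
  intro j j' he
  unfold graftLabelFun at he
  apply Fin.ext
  split_ifs at he
  · have := key _ _ (by simp; omega) (by simp; omega) he
    simpa using this
  · exact absurd he (h.hostLeaf_ne_guestLeaf (Fin.isLt _) (hne _ (by simp; omega)) (Fin.isLt _))
  · have := key _ _ (by simp; omega) (by simp; omega) he
    simp at this
    omega
  · exact absurd he.symm
      (h.hostLeaf_ne_guestLeaf (Fin.isLt _) (hne _ (by simp; omega)) (Fin.isLt _))
  · have := key' _ _ he
    simp at this
    omega
  · exact absurd he.symm
      (h.hostLeaf_ne_guestLeaf (Fin.isLt _) (hne _ (by simp; omega)) (Fin.isLt _))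
  · have := key _ _ (by simp; omega) (by simp; omega) he
    simp at this
    omega
  · exact absurd he (h.hostLeaf_ne_guestLeaf (Fin.isLt _) (hne _ (by simp; omega)) (Fin.isLt _))
  · have := key _ _ (by simp; omega) (by simp; omega) he
    simp at this
    omega

/-- The labeling `f_{D ∘ E}` as a bijection onto the leaves. -/
def graftLabel (f : Equiv.Perm (Fin c.arity)) (g : Equiv.Perm (Fin d.arity))
    (i : Fin c.arity) (h : CanGraft c d (f i)) :
    Equiv.Perm (Fin (graftCorolla c d (f i)).arity) :=
  (finCongr h.arity_graftCorolla).symm.permCongr (Equiv.ofBijective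
    (fun j => (⟨graftLabelFun f g i j, graftLabelFun_lt f g i h j⟩ : Fin (graftArity c d)))
    (Finite.injective_iff_bijective.1 fun _ _ he =>
      graftLabelFun_injective f g i h (congrArg Fin.val he)))

end Label

/-! ## The operad `C_* Â` -/

variable (R : Type*) [CommRing R]

/-- The units (one for each color), and the diagrams `D` with a labeling `f` of the leaves. The
labels `1, …, n` are represented by the elements `0, …, n - 1` of `Fin n`. -/
inductive CIndex : Type
  | unit (a : Color) : CIndex
  | diag (c : Corolla) (D : Diagram c) (f : Equiv.Perm (Fin c.arity)) : CIndex

/-- The edges to be oriented: all edges. -/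
def CIndex.edges : CIndex → Finset Block
  | .unit _ => ∅
  | .diag _ D _ => D.edges

/-- The color of the root. -/
def CIndex.root : CIndex → Color
  | .unit a => a
  | .diag c _ _ => c.root

/-- The coloring `x × y`: the colors of the leaves in the order of their labels, and the color of
the root. -/
def CIndex.coloring : CIndex → List Color × Color
  | .unit a => ([a], a)
  | .diag c _ f => (List.ofFn fun i => c.leafColor (f i), c.root)

/-- The degree `#leaves - #edges - 2`; units have degree `0`. -/
def CIndex.degree : CIndex → ℤ
  | .unit _ => 0
  | .diag _ D _ => D.degree

/-- The underlying module of `C_* Â`: generated by the `(D, f, ω)`, where `ω` is an orientation on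
the set of edges of `D`, modulo `(D, f, -ω) = -(D, f, ω)`, and by the units. -/
abbrev C : Type _ := OrMod R CIndex.edges

/-- The generator `(D, f, ω)`. -/
def C.gen {c : Corolla} (D : Diagram c) (f : Equiv.Perm (Fin c.arity))
    (ω : Orientation D.edges) : C R :=
  OrMod.mk R (CIndex.diag c D f) ω

/-- The unit of color `a`. -/
def C.unit (a : Color) : C R := OrMod.mk R (CIndex.unit a) ⟨1, isOrientation_empty_one⟩

/-- The part of `C_* Â` of degree `n` and coloring `x × y`. -/
def C.part (n : ℤ) (x : List Color) (y : Color) : Submodule R (C R) :=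
  Submodule.span R {z | ∃ (s : CIndex) (ω : Orientation s.edges),
    s.degree = n ∧ s.coloring = (x, y) ∧ z = OrMod.mk R s ω}

variable {R}

theorem OrMod.mk_eq_neg {X : Type} {S : X → Finset Block} {x : X} {ω ω' : Orientation (S x)}
    (h : ω.1 = - ω'.1) : OrMod.mk R x ω = - OrMod.mk R x ω' := by
  rw [← OrMod.mk_neg]
  congr 1
  exact Subtype.ext h

variable (R)

theorem isOrientation_insert {c : Corolla} {D D' : Diagram c} {e : Block} (he : e ∈ D'.edges)
    (h : D'.contract e = D) {ω : Ext} (hω : IsOrientation D.edges ω) :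
    IsOrientation D'.edges (edgeVec e * ω) := by
  have hD : D.edges = D'.edges.erase e := by rw [← h]; rfl
  have := (isOrientation_edgeVec e).mul hω (by simp [hD])
  rwa [hD, ← Finset.insert_eq, Finset.insert_erase he] at this

open Classical in
/-- The boundary of a generator: `0` for units, and for `(D, f, ω)` the sum of `(D', f, e' ∧ ω)`
over all diagrams `D'` and all edges `e'` of `D'` such that `D' / e' = D`. -/
def C.boundaryGen : (s : CIndex) → Orientation s.edges → C R
  | .unit _, _ => 0
  | .diag c D f, ω => ∑ D' : Diagram c, ∑ e' : {e // e ∈ D'.edges},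
      if h : D'.contract e'.1 = D then
        C.gen R D' f ⟨edgeVec e'.1 * ω.1, isOrientation_insert e'.2 h ω.2⟩
      else 0

theorem C.boundaryGen_neg (s : CIndex) (ω : Orientation s.edges) :
    C.boundaryGen R s (-ω) = - C.boundaryGen R s ω := by
  cases s with
  | unit a => simp [C.boundaryGen]
  | diag c D f =>
    simp only [C.boundaryGen, ← Finset.sum_neg_distrib]
    refine Finset.sum_congr rfl fun D' _ => Finset.sum_congr rfl fun e' _ => ?_
    split_ifs with h
    · exact OrMod.mk_eq_neg (mul_neg _ _)
    · exact neg_zero.symm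

/-- The boundary `∂_C`. -/
def C.boundary : C R →ₗ[R] C R := OrMod.lift (C.boundaryGen R) (C.boundaryGen_neg R)

/-- The action of permutations on generators,
`σ · (D, f, ω) = sgn(σ) (D, f ∘ σ, ω)`.  Here `σ` is a family consisting of one permutation
for each number of leaves. -/
def C.actGen (σ : ∀ n, Equiv.Perm (Fin n)) : (s : CIndex) → Orientation s.edges → C R
  | .unit a, ω => OrMod.mk R (.unit a) ω
  | .diag c D f, ω => Equiv.Perm.sign (σ c.arity) • C.gen R D (f * σ c.arity) ω

theorem C.actGen_neg (σ : ∀ n, Equiv.Perm (Fin n)) (s : CIndex) (ω : Orientation s.edges) :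
    C.actGen R σ s (-ω) = - C.actGen R σ s ω := by
  cases s with
  | unit a => exact OrMod.mk_neg _ _
  | diag c D f =>
    simp only [C.actGen]
    rw [← smul_neg]
    congr 1
    exact OrMod.mk_neg _ _

/-- The actions of the symmetric groups: the component `σ n` of the family `σ` acts on the
part with `n` inputs. -/
def C.act (σ : ∀ n, Equiv.Perm (Fin n)) : C R →ₗ[R] C R :=
  OrMod.lift (C.actGen R σ) (C.actGen_neg R σ)

/-- Position `i ∈ {1, …, n}` as an element of `Fin n`. -/
def pos {n i : ℕ} (h : 1 ≤ i ∧ i ≤ n) : Fin n := ⟨i - 1, by omega⟩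

theorem isOrientation_unit_mul {S : Finset Block} {ω ω' : Ext} (h : IsOrientation ∅ ω)
    (h' : IsOrientation S ω') : IsOrientation S (ω * ω') := by
  simpa using h.mul h' (by simp)

theorem isOrientation_mul_unit {S : Finset Block} {ω ω' : Ext} (h : IsOrientation S ω)
    (h' : IsOrientation ∅ ω') : IsOrientation S (ω * ω') := by
  simpa using h.mul h' (by simp)

/-- `ω_D ∧ ω_E ∧ e` is an orientation of the grafted diagram. -/
theorem isOrientation_graft {c d : Corolla} {p : ℕ} (h : CanGraft c d p) (D : Diagram c)
    (E : Diagram d) {ω ω' : Ext} (hω : IsOrientation D.edges ω) (hω' : IsOrientation E.edges ω') :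
    IsOrientation (graft h D E).edges
      (relabel (hostBlock c d p) ω * relabel (guestBlock c d p) ω' * edgeVec (newEdge c d p)) :=
  ((hω.relabel (h.injOn_host D)).mul (hω'.relabel (h.injOn_guest E))
    (h.disjoint_host_guest D E)).mul (isOrientation_edgeVec _) (h.disjoint_newEdge D E)

open Classical in
/-- The `i`-th operadic composition of generators.  It is `0` unless there is an `i`-th input
and it has the color of the root of the second generator.  Otherwise
`(D, f, ω) ∘_i (E, f', ω')` is `(-1)^ε (D ∘_{f(i)} E, f_{D ∘ E}, ω ∧ ω' ∧ e)` with
`ε = i (l + 1) + k n`, where `k`, `l` are the numbers of leaves of `D`, `E` and `n` is the degree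
of `E`. -/
def C.compGen (i : ℕ) : (s : CIndex) → Orientation s.edges → (t : CIndex) →
    Orientation t.edges → C R
  | .unit a, ω, t, ω' =>
      if i = 1 ∧ t.root = a then OrMod.mk R t ⟨ω.1 * ω'.1, isOrientation_unit_mul ω.2 ω'.2⟩
      else 0
  | .diag c D f, ω, .unit a, ω' =>
      if h : 1 ≤ i ∧ i ≤ c.arity then
        if c.leafColor (f (pos h)) = a then
          C.gen R D f ⟨ω.1 * ω'.1, isOrientation_mul_unit ω.2 ω'.2⟩
        else 0
      else 0
  | .diag c D f, ω, .diag d E g, ω' =>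
      if h : 1 ≤ i ∧ i ≤ c.arity then
        if h' : CanGraft c d (f (pos h)) then
          Int.negOnePow (i * (d.arity + 1) + c.arity * E.degree) •
            C.gen R (graft h' D E) (graftLabel f g (pos h) h')
              ⟨relabel (hostBlock c d (f (pos h))) ω.1 *
                relabel (guestBlock c d (f (pos h))) ω'.1 * edgeVec (newEdge c d (f (pos h))),
                isOrientation_graft h' D E ω.2 ω'.2⟩
        else 0
      else 0

theorem C.compGen_neg_right (i : ℕ) (s : CIndex) (ω : Orientation s.edges) (t : CIndex)
    (ω' : Orientation t.edges) :
    C.compGen R i s ω t (-ω') = - C.compGen R i s ω t ω' := by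
  cases s with
  | unit a =>
    simp only [C.compGen]
    split_ifs
    · exact OrMod.mk_eq_neg (mul_neg _ _)
    · exact neg_zero.symm
  | diag c D f =>
    cases t with
    | unit a =>
      simp only [C.compGen]
      split_ifs
      · exact OrMod.mk_eq_neg (mul_neg _ _)
      · exact neg_zero.symm
      · exact neg_zero.symm
    | diag d E g =>
      simp only [C.compGen]
      split_ifs
      · rw [← smul_neg]
        congr 1
        refine OrMod.mk_eq_neg ?_
        change _ * relabel _ (-ω'.1) * _ = - (_ * relabel _ ω'.1 * _)
        rw [map_neg, mul_neg, neg_mul]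
      · exact neg_zero.symm
      · exact neg_zero.symm

theorem C.compGen_neg_left (i : ℕ) (s : CIndex) (ω : Orientation s.edges) (t : CIndex)
    (ω' : Orientation t.edges) :
    C.compGen R i s (-ω) t ω' = - C.compGen R i s ω t ω' := by
  cases s with
  | unit a =>
    simp only [C.compGen]
    split_ifs
    · exact OrMod.mk_eq_neg (neg_mul _ _)
    · exact neg_zero.symm
  | diag c D f =>
    cases t with
    | unit a =>
      simp only [C.compGen]
      split_ifs
      · exact OrMod.mk_eq_neg (neg_mul _ _)
      · exact neg_zero.symm
      · exact neg_zero.symm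
    | diag d E g =>
      simp only [C.compGen]
      split_ifs
      · rw [← smul_neg]
        congr 1
        refine OrMod.mk_eq_neg ?_
        change relabel _ (-ω.1) * _ * _ = - (relabel _ ω.1 * _ * _)
        rw [map_neg, neg_mul, neg_mul]
      · exact neg_zero.symm
      · exact neg_zero.symm

theorem OrMod.hom_ext {X : Type} {S : X → Finset Block} {N : Type*} [AddCommGroup N] [Module R N]
    {φ ψ : OrMod R S →ₗ[R] N} (h : ∀ x ω, φ (OrMod.mk R x ω) = ψ (OrMod.mk R x ω)) : φ = ψ := by
  refine Submodule.linearMap_qext _ (Finsupp.lhom_ext' fun g => LinearMap.ext_ring ?_)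
  exact h g.1 g.2

/-- The `i`-th operadic composition `∘_i` of `C_* Â`. -/
def C.comp (i : ℕ) : C R →ₗ[R] C R →ₗ[R] C R :=
  OrMod.lift
    (fun s ω => OrMod.lift (C.compGen R i s ω) (C.compGen_neg_right R i s ω))
    (fun s ω => OrMod.hom_ext R fun t ω' => by
      rw [LinearMap.neg_apply, OrMod.lift_mk, OrMod.lift_mk]
      exact C.compGen_neg_left R i s ω t ω')

/-! ## The operad `Q_* Â` -/

/-- The units, and the diagrams `D` with a labeling `f` of the leaves and with a labeling of
the edges as metric or non-metric, the latter being given by the set `m` of metric edges. -/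
inductive QIndex : Type
  | unit (a : Color) : QIndex
  | diag (c : Corolla) (D : Diagram c) (f : Equiv.Perm (Fin c.arity)) (m : Finset Block)
      (hm : m ⊆ D.edges) : QIndex

/-- The edges to be oriented: the metric edges. -/
def QIndex.metric : QIndex → Finset Block
  | .unit _ => ∅
  | .diag _ _ _ m _ => m

/-- The color of the root. -/
def QIndex.root : QIndex → Color
  | .unit a => a
  | .diag c _ _ _ _ => c.root

/-- The coloring `x × y`. -/
def QIndex.coloring : QIndex → List Color × Color
  | .unit a => ([a], a)
  | .diag c _ f _ _ => (List.ofFn fun i => c.leafColor (f i), c.root)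

/-- The degree is the number of metric edges; units have degree `0`. -/
def QIndex.degree : QIndex → ℤ
  | .unit _ => 0
  | .diag _ _ _ m _ => m.card

/-- The underlying module of `Q_* Â`: generated by the `(D, f, g, ω)`, where `ω` is an orientation
on the set of metric edges, modulo `(D, f, g, -ω) = -(D, f, g, ω)`, and by the units. -/
abbrev Q : Type _ := OrMod R QIndex.metric

/-- The generator `(D, f, g, ω)`, where `g` is given by its set `m` of metric edges. -/
def Q.gen {c : Corolla} (D : Diagram c) (f : Equiv.Perm (Fin c.arity)) (m : Finset Block)
    (hm : m ⊆ D.edges) (ω : Orientation m) : Q R :=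
  OrMod.mk R (QIndex.diag c D f m hm) ω

/-- The unit of color `a`. -/
def Q.unit (a : Color) : Q R := OrMod.mk R (QIndex.unit a) ⟨1, isOrientation_empty_one⟩

/-- The part of `Q_* Â` of degree `n` and coloring `x × y`. -/
def Q.part (n : ℤ) (x : List Color) (y : Color) : Submodule R (Q R) :=
  Submodule.span R {z | ∃ (s : QIndex) (ω : Orientation s.metric),
    s.degree = n ∧ s.coloring = (x, y) ∧ z = OrMod.mk R s ω}

/-- The boundary of a generator: `0` for units, and for `(D, f, g, e₁ ∧ ⋯ ∧ eₗ)` it is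
`∑ⱼ (-1)^j [(D / eⱼ, f, g / eⱼ, e₁ ∧ ⋯ ∧ êⱼ ∧ ⋯ ∧ eₗ) - (D, f, g_{eⱼ}, e₁ ∧ ⋯ ∧ êⱼ ∧ ⋯ ∧ eₗ)]`,
where `g_{eⱼ}` makes `eⱼ` non-metric.  Note that the orientation
`(-1)^j e₁ ∧ ⋯ ∧ êⱼ ∧ ⋯ ∧ eₗ` is minus the contraction of `e₁ ∧ ⋯ ∧ eₗ` by `eⱼ`. -/
def Q.boundaryGen : (s : QIndex) → Orientation s.metric → Q R
  | .unit _, _ => 0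
  | .diag _ D f m hm, ω => ∑ e : {e // e ∈ m},
      -(Q.gen R (D.contract e.1) f (m.erase e.1) (Finset.erase_subset_erase _ hm)
          ⟨remove e.1 ω.1, ω.2.remove e.2⟩ -
        Q.gen R D f (m.erase e.1) ((Finset.erase_subset _ _).trans hm)
          ⟨remove e.1 ω.1, ω.2.remove e.2⟩)

theorem Q.boundaryGen_neg (s : QIndex) (ω : Orientation s.metric) :
    Q.boundaryGen R s (-ω) = - Q.boundaryGen R s ω := by
  cases s with
  | unit a => simp [Q.boundaryGen]
  | diag c D f m hm =>
    simp only [Q.boundaryGen, ← Finset.sum_neg_distrib]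
    refine Finset.sum_congr rfl fun e _ => ?_
    have h : remove e.1 (-ω).1 = - remove e.1 ω.1 := map_neg _ _
    have h1 : Q.gen R (D.contract e.1) f (m.erase e.1) (Finset.erase_subset_erase _ hm)
        ⟨remove e.1 (-ω).1, (-ω).2.remove e.2⟩ =
        - Q.gen R (D.contract e.1) f (m.erase e.1) (Finset.erase_subset_erase _ hm)
        ⟨remove e.1 ω.1, ω.2.remove e.2⟩ := OrMod.mk_eq_neg h
    have h2 : Q.gen R D f (m.erase e.1) ((Finset.erase_subset _ _).trans hm)
        ⟨remove e.1 (-ω).1, (-ω).2.remove e.2⟩ =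
        - Q.gen R D f (m.erase e.1) ((Finset.erase_subset _ _).trans hm)
        ⟨remove e.1 ω.1, ω.2.remove e.2⟩ := OrMod.mk_eq_neg h
    rw [h1, h2]
    abel

/-- The boundary `∂_Q`. -/
def Q.boundary : Q R →ₗ[R] Q R := OrMod.lift (Q.boundaryGen R) (Q.boundaryGen_neg R)

/-- The action of permutations on generators, `σ · (D, f, g, ω) = (D, f ∘ σ, g, ω)`. -/
def Q.actGen (σ : ∀ n, Equiv.Perm (Fin n)) : (s : QIndex) → Orientation s.metric → Q R
  | .unit a, ω => OrMod.mk R (.unit a) ω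
  | .diag c D f m hm, ω => Q.gen R D (f * σ c.arity) m hm ω

theorem Q.actGen_neg (σ : ∀ n, Equiv.Perm (Fin n)) (s : QIndex) (ω : Orientation s.metric) :
    Q.actGen R σ s (-ω) = - Q.actGen R σ s ω := by
  cases s with
  | unit a => exact OrMod.mk_neg _ _
  | diag c D f m hm => exact OrMod.mk_neg _ _

/-- The actions of the symmetric groups: the component `σ n` of the family `σ` acts on the
part with `n` inputs. -/
def Q.act (σ : ∀ n, Equiv.Perm (Fin n)) : Q R →ₗ[R] Q R :=
  OrMod.lift (Q.actGen R σ) (Q.actGen_neg R σ)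

/-- The metric edges after grafting; the new edge is non-metric. -/
def graftMetric (c d : Corolla) (p : ℕ) (m m' : Finset Block) : Finset Block :=
  m.image (hostBlock c d p) ∪ m'.image (guestBlock c d p)

theorem graftMetric_subset {c d : Corolla} {p : ℕ} (h : CanGraft c d p) (D : Diagram c)
    (E : Diagram d) {m m' : Finset Block} (hm : m ⊆ D.edges) (hm' : m' ⊆ E.edges) :
    graftMetric c d p m m' ⊆ (graft h D E).edges :=
  (Finset.union_subset_union (Finset.image_subset_image hm) (Finset.image_subset_image hm')).trans
    Finset.subset_union_left

theorem isOrientation_graftMetric {c d : Corolla} {p : ℕ} (h : CanGraft c d p) (D : Diagram c)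
    (E : Diagram d) {m m' : Finset Block} (hm : m ⊆ D.edges) (hm' : m' ⊆ E.edges) {ω ω' : Ext}
    (hω : IsOrientation m ω) (hω' : IsOrientation m' ω') :
    IsOrientation (graftMetric c d p m m')
      (relabel (hostBlock c d p) ω * relabel (guestBlock c d p) ω') :=
  (hω.relabel ((h.injOn_host D).mono (Finset.coe_subset.2 hm))).mul
    (hω'.relabel ((h.injOn_guest E).mono (Finset.coe_subset.2 hm')))
    (Finset.disjoint_of_subset_left (Finset.image_subset_image hm)
      (Finset.disjoint_of_subset_right (Finset.image_subset_image hm')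
        (h.disjoint_host_guest D E)))

open Classical in
/-- The `i`-th operadic composition of generators.  It is `0` unless there is an `i`-th input
and it has the color of the root of the second generator.  Otherwise
`(D, f, g, ω) ∘_i (E, f', g', ω')` is `(D ∘_{f(i)} E, f_{D ∘ E}, g_{D ∘ E}, ω ∧ ω')`. -/
def Q.compGen (i : ℕ) : (s : QIndex) → Orientation s.metric → (t : QIndex) →
    Orientation t.metric → Q R
  | .unit a, ω, t, ω' =>
      if i = 1 ∧ t.root = a then OrMod.mk R t ⟨ω.1 * ω'.1, isOrientation_unit_mul ω.2 ω'.2⟩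
      else 0
  | .diag c D f m hm, ω, .unit a, ω' =>
      if h : 1 ≤ i ∧ i ≤ c.arity then
        if c.leafColor (f (pos h)) = a then
          Q.gen R D f m hm ⟨ω.1 * ω'.1, isOrientation_mul_unit ω.2 ω'.2⟩
        else 0
      else 0
  | .diag c D f m hm, ω, .diag d E g m' hm', ω' =>
      if h : 1 ≤ i ∧ i ≤ c.arity then
        if h' : CanGraft c d (f (pos h)) then
          Q.gen R (graft h' D E) (graftLabel f g (pos h) h')
            (graftMetric c d (f (pos h)) m m') (graftMetric_subset h' D E hm hm')
            ⟨relabel (hostBlock c d (f (pos h))) ω.1 * relabel (guestBlock c d (f (pos h))) ω'.1,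
              isOrientation_graftMetric h' D E hm hm' ω.2 ω'.2⟩
        else 0
      else 0

theorem Q.compGen_neg_right (i : ℕ) (s : QIndex) (ω : Orientation s.metric) (t : QIndex)
    (ω' : Orientation t.metric) :
    Q.compGen R i s ω t (-ω') = - Q.compGen R i s ω t ω' := by
  cases s with
  | unit a =>
    simp only [Q.compGen]
    split_ifs
    · exact OrMod.mk_eq_neg (mul_neg _ _)
    · exact neg_zero.symm
  | diag c D f m hm =>
    cases t with
    | unit a =>
      simp only [Q.compGen]
      split_ifs
      · exact OrMod.mk_eq_neg (mul_neg _ _)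
      · exact neg_zero.symm
      · exact neg_zero.symm
    | diag d E g m' hm' =>
      simp only [Q.compGen]
      split_ifs
      · refine OrMod.mk_eq_neg ?_
        change _ * relabel _ (-ω'.1) = - (_ * relabel _ ω'.1)
        rw [map_neg, mul_neg]
      · exact neg_zero.symm
      · exact neg_zero.symm

theorem Q.compGen_neg_left (i : ℕ) (s : QIndex) (ω : Orientation s.metric) (t : QIndex)
    (ω' : Orientation t.metric) :
    Q.compGen R i s (-ω) t ω' = - Q.compGen R i s ω t ω' := by
  cases s with
  | unit a =>
    simp only [Q.compGen]
    split_ifs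
    · exact OrMod.mk_eq_neg (neg_mul _ _)
    · exact neg_zero.symm
  | diag c D f m hm =>
    cases t with
    | unit a =>
      simp only [Q.compGen]
      split_ifs
      · exact OrMod.mk_eq_neg (neg_mul _ _)
      · exact neg_zero.symm
      · exact neg_zero.symm
    | diag d E g m' hm' =>
      simp only [Q.compGen]
      split_ifs
      · refine OrMod.mk_eq_neg ?_
        change relabel _ (-ω.1) * _ = - (relabel _ ω.1 * _)
        rw [map_neg, neg_mul]
      · exact neg_zero.symm
      · exact neg_zero.symm

/-- The `i`-th operadic composition `∘_i` of `Q_* Â`. -/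
def Q.comp (i : ℕ) : Q R →ₗ[R] Q R →ₗ[R] Q R :=
  OrMod.lift
    (fun s ω => OrMod.lift (Q.compGen R i s ω) (Q.compGen_neg_right R i s ω))
    (fun s ω => OrMod.hom_ext R fun t ω' => by
      rw [LinearMap.neg_apply, OrMod.lift_mk, OrMod.lift_mk]
      exact Q.compGen_neg_left R i s ω t ω')

/-! ## Standard orientations of binary diagrams, and the map `q` -/

/-- The binary diagrams which contract to the corolla `c`: those of degree `0`.  With the canonical
labeling they are exactly the diagrams of degree `0` with the same coloring as `c`. -/
def BinaryDiagram (c : Corolla) : Type := {B : Diagram c // B.degree = 0}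

instance (c : Corolla) : Finite (BinaryDiagram c) :=
  inferInstanceAs (Finite {B : Diagram c // B.degree = 0})

instance (c : Corolla) : Fintype (BinaryDiagram c) := Fintype.ofFinite _

/-- The edges `e₁, …, eₖ` of the right comb: `e₁` is attached to the root vertex together with
leaf `0`, and `eₜ₊₁` is attached to the vertex of `eₜ` together with leaf `t`. -/
def combWord (c : Corolla) : List Block :=
  (List.range (c.arity - 2)).map fun t => Finset.Ico (t + 1) c.arity

/-- A local move from `B` to `B'`: contracting the edge `e` of `B` and contracting the edge `e'` of
`B'` gives the same diagram (which has exactly one vertex that is not binary, and that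
vertex has exactly two resolutions).  All other edges of `B` and `B'` are identified. -/
def IsLocalMove {c : Corolla} (B B' : BinaryDiagram c) (e e' : Block) : Prop :=
  B ≠ B' ∧ e ∈ B.1.edges ∧ e' ∈ B'.1.edges ∧ B.1.contract e = B'.1.contract e'

/-- A choice of one orientation on each binary diagram is standard if it is `e₁ ∧ ⋯ ∧ eₖ`
on the right comb of each corolla, and if under each local move, with `e` replaced by `e'`, it is
transferred with a minus sign. -/
structure IsStandard (std : ∀ (c : Corolla) (B : BinaryDiagram c), Orientation B.1.edges) :
    Prop where
  comb : ∀ (c : Corolla) (B : BinaryDiagram c), B.1.edges = (combWord c).toFinset →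
    (std c B).1 = wedge (combWord c)
  move : ∀ (c : Corolla) (B B' : BinaryDiagram c) (e e' : Block), IsLocalMove B B' e e' →
    (std c B').1 = - relabel (Function.update id e e') (std c B).1

/-- The defining properties of `q`: it preserves units, it maps a corolla `(c, f_↻, +1)` to the
sum of all fully metric binary diagrams `(B, f_↻, m, ω_B^std)` with the coloring of `c`, and it is
equivariant and multiplicative. -/
structure IsSubdivisionMap
    (std : ∀ (c : Corolla) (B : BinaryDiagram c), Orientation B.1.edges)
    (q : C R →ₗ[R] Q R) : Prop where
  unit : ∀ a, q (C.unit R a) = Q.unit R a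
  corolla : ∀ c : Corolla,
    q (C.gen R (Diagram.ofCorolla c) 1 ⟨1, isOrientation_empty_one⟩) =
      ∑ B : BinaryDiagram c, Q.gen R B.1 1 B.1.edges subset_rfl (std c B)
  act : ∀ (σ : ∀ n, Equiv.Perm (Fin n)) (z : C R), q (C.act R σ z) = Q.act R σ (q z)
  comp : ∀ (i : ℕ) (z z' : C R), q (C.comp R i z z') = Q.comp R i (q z) (q z')

end

end Pairahedra

namespace Pairahedra
noncomputable section

/-! ## Edges as arcs on a circle -/

/-! The leaves sit on a circle and every edge cuts off an arc, so a diagram with `N` leaves has `N`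
gaps between neighbouring leaves. Label each gap by the vertex at which it lies: the smallest edge
covering it, or the root. The root vertex is counted twice, with one tag for the gaps between the
leaf `0` and a second marked leaf and another tag for the remaining gaps. Both tags occur because no
edge cuts off both marked leaves, and every edge occurs as well (`Diagram.image_label`). Hence a
diagram has at most `N - 2` edges, and for a binary diagram the labelling is a bijection from gaps
to vertices.

This bijection is the source of the signs. The wedge of all labels in the order of the gaps, with
the two tags struck out, is the standard orientation (`stdOrientation`). For a right comb the list
of labels is the two tags followed by the edges of the comb. In a diagram with one edge less than a
binary one, exactly two gaps share a label; from this it follows that it has exactly two resolutions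
(`Resolves.exists_other`, `Resolves.eq_of_ne`) and that passing from one to the other transposes the
labels of these two gaps, whence the minus sign (`IsLocalMove.wedge_labelList`). The orientation is
unique because local moves can lower a defect until the right comb is reached
(`BinaryDiagram.eq_comb_or`).

The map `q` has a closed formula: `(D, f, ω)` goes to `sgn f` times the sum of all binary diagrams
`B` containing the edges of `D`, where the edges not in `D` are metric and are oriented by
contracting the standard orientation of `B` by `ω` (`contr`). It respects compositions because the
binary diagrams containing the new edge are exactly the grafts of binary diagrams
(`sum_binary_graft`), and because the sign relating their standard orientations
(`stdOrientation_graft`), the sign of the composed labeling (`sign_graftLabel`) and the sign in the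
definition of the composition cancel (`sign_comp`).

For the chain map property, the faces of `∂_Q` that make an edge non-metric match the terms of
`∂_C`, since contracting by `e ∧ ω` is contracting by `ω` and then removing `e`
(`sum_subdivisionTerm_insert`). The faces that contract an edge cancel in pairs related by a local
move (`sum_contract_eq_zero`). Finally `q` is unique because every diagram with an edge is, up to
sign and labeling, a composition of diagrams with fewer edges. -/

/-- The predecessor of a leaf on the circle of the leaves `0, …, N - 1`. -/
def cpred (N g : ℕ) : ℕ := if g = 0 then N - 1 else g - 1

/-- The gap between the leaves `cpred N g` and `g` lies inside of `b`. -/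
def Covers (N : ℕ) (b : Block) (g : ℕ) : Prop := g ∈ b ∧ cpred N g ∈ b

/-- The second marked leaf; no edge cuts off both the leaf `0` and this leaf. -/
def Corolla.mark : Corolla → ℕ
  | .T n _ => n - 1
  | .M j k _ => j + k
  | .I j _ => j + 1

theorem Corolla.one_le_mark (c : Corolla) : 1 ≤ c.mark := by
  cases c <;> simp only [Corolla.mark] <;> omega

theorem Corolla.mark_lt (c : Corolla) : c.mark < c.arity := by
  cases c <;> simp only [Corolla.mark, Corolla.arity] <;> omega

/-- A description common to the three kinds of corollas, so that later arguments need no case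
distinction. For `T` and `M` the mark is the last leaf, which forces the final piece of a wrapping
arc to be empty; only for `I` can an arc really pass through the gap `0`. -/
theorem Corolla.isBlock_iff_arc {c : Corolla} {b : Block} : c.IsBlock b ↔
    (∃ x y, 1 ≤ x ∧ x + 2 ≤ y ∧ y ≤ c.arity ∧ b = Finset.Ico x y) ∨
    (∃ x y, 1 ≤ y ∧ y ≤ c.mark ∧ c.mark < x ∧ x ≤ c.arity ∧ 2 ≤ y + (c.arity - x) ∧
      b = Finset.Ico 0 y ∪ Finset.Ico x c.arity) := by
  have key : ∀ N, 2 ≤ N → (IsProperInterval N b ↔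
      (∃ x y, 1 ≤ x ∧ x + 2 ≤ y ∧ y ≤ N ∧ b = Finset.Ico x y) ∨
      (∃ x y, 1 ≤ y ∧ y ≤ N - 1 ∧ N - 1 < x ∧ x ≤ N ∧ 2 ≤ y + (N - x) ∧
        b = Finset.Ico 0 y ∪ Finset.Ico x N)) := by
    intro N hN
    constructor
    · rintro ⟨x, y, h1, h2, h3, rfl⟩
      by_cases hx : 1 ≤ x
      · exact Or.inl ⟨x, y, hx, h1, h2, rfl⟩
      · obtain rfl : x = 0 := by omega
        -- An interval that begins at `0` is an arc of the second kind whose final piece `Ico N N`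
        -- is empty.
        exact Or.inr ⟨N, y, by omega, by omega, by omega, by omega, by omega, by simp⟩
    · rintro (⟨x, y, h1, h2, h3, rfl⟩ | ⟨x, y, h1, h2, h3, h4, h5, rfl⟩)
      · exact ⟨x, y, h2, h3, by omega, rfl⟩
      · obtain rfl : x = N := by omega
        exact ⟨0, y, by omega, by omega, by omega, by simp⟩
  cases c with
  | T n hn => exact key n hn
  | M j k hjk => exact key (j + k + 1) (by omega)
  | I j k => exact Iff.rfl

/-- A discrete intermediate value principle: a predicate that never changes between neighbours is
constant on the whole range. `min` and `max` allow both orders of `a` and `b`. -/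
theorem exists_step {P : ℕ → Prop} {a b : ℕ} (ha : P a) (hb : ¬ P b) :
    ∃ z, min a b ≤ z ∧ z < max a b ∧ ¬ (P (z + 1) ↔ P z) := by
  by_contra! h
  have key : ∀ n, min a b + n ≤ max a b → (P (min a b + n) ↔ P (min a b)) := by
    intro n
    induction n with
    | zero => simp
    | succ n ih =>
      intro hn
      rw [← ih (by omega), ← add_assoc]
      exact h _ (by omega) (by omega)
  have := key (max a b - min a b) (by omega)
  rw [Nat.add_sub_cancel' (by omega)] at this
  rcases le_total a b with hab | hab <;> simp_all

/-- Every edge cuts off an arc of the circle of leaves. -/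
theorem Corolla.IsBlock.exists_arc {c : Corolla} {b : Block} (h : c.IsBlock b) :
    ∃ x s, x < c.arity ∧ s < c.arity ∧
      ∀ z, z ∈ b ↔ ∃ i < s, z = if x + i < c.arity then x + i else x + i - c.arity := by
  have hm := c.mark_lt
  rcases Corolla.isBlock_iff_arc.1 h with ⟨x, y, h1, h2, h3, rfl⟩ | ⟨x, y, h1, h2, h3, h4, h5, rfl⟩
  · refine ⟨x, y - x, by omega, by omega, fun z => ?_⟩
    rw [Finset.mem_Ico]
    constructor
    · intro hz
      exact ⟨z - x, by omega, by rw [if_pos] <;> omega⟩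
    · rintro ⟨i, hi, rfl⟩
      split_ifs <;> omega
  -- With an empty final piece the arc has to start at `0`, since the starting point must be a leaf.
  · rcases h4.lt_or_eq with h4 | rfl
    · refine ⟨x, y + (c.arity - x), by omega, by omega, fun z => ?_⟩
      rw [Finset.mem_union, Finset.mem_Ico, Finset.mem_Ico]
      constructor
      · rintro (hz | hz)
        · exact ⟨z + (c.arity - x), by omega, by rw [if_neg] <;> omega⟩
        · exact ⟨z - x, by omega, by rw [if_pos] <;> omega⟩
      · rintro ⟨i, hi, rfl⟩
        split_ifs <;> omega
    · refine ⟨0, y, by omega, by omega, fun z => ?_⟩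
      rw [Finset.mem_union, Finset.mem_Ico, Finset.mem_Ico]
      constructor
      · intro hz
        exact ⟨z, by omega, by rw [if_pos] <;> omega⟩
      · rintro ⟨i, hi, rfl⟩
        split_ifs <;> omega

/-! ### Edges as connected sets of leaves -/

/-- A set of leaves is connected if it cannot be separated into two parts without cutting it at
one of the gaps inside of it. -/
def IsConn (N : ℕ) (b : Block) : Prop :=
  ∀ (m : ℕ → Prop) (x y : ℕ), x ∈ b → y ∈ b → m x → ¬ m y →
    ∃ g < N, Covers N b g ∧ ¬ (m g ↔ m (cpred N g))

/-- Along the parametrization of the arc by consecutive leaves, a predicate that takes both values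
changes at some step, and that step crosses a covered gap. -/
theorem Corolla.IsBlock.conn {c : Corolla} {b : Block} (h : c.IsBlock b) : IsConn c.arity b := by
  intro m x y hx hy hmx hmy
  obtain ⟨a, s, ha, hs, hb⟩ := h.exists_arc
  obtain ⟨i, hi, rfl⟩ := (hb x).1 hx
  obtain ⟨j, hj, rfl⟩ := (hb y).1 hy
  obtain ⟨z, hz1, hz2, hz⟩ := exists_step
    (P := fun i => m (if a + i < c.arity then a + i else a + i - c.arity)) hmx hmy
  have hp : cpred c.arity (if a + (z + 1) < c.arity then a + (z + 1) else a + (z + 1) - c.arity) =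
      if a + z < c.arity then a + z else a + z - c.arity := by
    unfold cpred
    by_cases h1 : a + (z + 1) < c.arity
    · have h2 : a + z < c.arity := by omega
      have h3 : ¬ a + (z + 1) = 0 := by omega
      simp only [if_pos h1, if_pos h2, if_neg h3]
      omega
    · simp only [if_neg h1]
      split_ifs <;> omega
  refine ⟨if a + (z + 1) < c.arity then a + (z + 1) else a + (z + 1) - c.arity, ?_, ⟨?_, ?_⟩, ?_⟩
  · split_ifs <;> omega
  · exact (hb _).2 ⟨z + 1, by omega, rfl⟩
  · rw [hp]
    exact (hb _).2 ⟨z, by omega, rfl⟩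
  · rw [hp]
    exact hz

theorem isConn_singleton (N a : ℕ) : IsConn N {a} := by
  intro m x y hx hy h h'
  rw [Finset.mem_singleton] at hx hy
  subst hx hy
  exact absurd h h'

/-- If the predicate changed at no covered gap, it would be constant on each of the two sets, and
the gap `g` between them would transfer its value from one to the other. -/
theorem IsConn.union {N : ℕ} {b b' : Block} (h : IsConn N b) (h' : IsConn N b') {g : ℕ}
    (hg : g < N) (h1 : (g ∈ b ∧ cpred N g ∈ b') ∨ (cpred N g ∈ b ∧ g ∈ b')) :
    IsConn N (b ∪ b') := by
  have hc : Covers N (b ∪ b') g := by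
    unfold Covers; simp only [Finset.mem_union]; tauto
  have hl : ∀ g, Covers N b g → Covers N (b ∪ b') g := fun g hg =>
    ⟨Finset.mem_union_left _ hg.1, Finset.mem_union_left _ hg.2⟩
  have hr : ∀ g, Covers N b' g → Covers N (b ∪ b') g := fun g hg =>
    ⟨Finset.mem_union_right _ hg.1, Finset.mem_union_right _ hg.2⟩
  intro m x y hx hy hmx hmy
  by_contra! hcon
  have cb : ∀ u ∈ b, ∀ v ∈ b, m u → m v := by
    intro u hu v hv hmu
    by_contra hmv
    obtain ⟨g, hg, hg1, hg2⟩ := h m u v hu hv hmu hmv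
    exact hg2 (hcon g hg (hl g hg1))
  have cb' : ∀ u ∈ b', ∀ v ∈ b', m u → m v := by
    intro u hu v hv hmu
    by_contra hmv
    obtain ⟨g, hg, hg1, hg2⟩ := h' m u v hu hv hmu hmv
    exact hg2 (hcon g hg (hr g hg1))
  have hgg := hcon g hg hc
  rw [Finset.mem_union] at hx hy
  rcases h1 with ⟨h1, h2⟩ | ⟨h1, h2⟩ <;> rcases hx with hx | hx <;> rcases hy with hy | hy
  · exact hmy (cb _ hx _ hy hmx)
  · exact hmy (cb' _ h2 _ hy (hgg.1 (cb _ hx _ h1 hmx)))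
  · exact hmy (cb _ h1 _ hy (hgg.2 (cb' _ hx _ h2 hmx)))
  · exact hmy (cb' _ hx _ hy hmx)
  · exact hmy (cb _ hx _ hy hmx)
  · exact hmy (cb' _ h2 _ hy (hgg.2 (cb _ hx _ h1 hmx)))
  · exact hmy (cb _ h1 _ hy (hgg.1 (cb' _ hx _ h2 hmx)))
  · exact hmy (cb' _ hx _ hy hmx)

theorem Corolla.IsBlock.not_marks {c : Corolla} {b : Block} (h : c.IsBlock b) :
    ¬ (0 ∈ b ∧ c.mark ∈ b) := by
  have hm := c.mark_lt
  rcases Corolla.isBlock_iff_arc.1 h with ⟨x, y, h1, h2, h3, rfl⟩ | ⟨x, y, h1, h2, h3, h4, h5, rfl⟩ <;>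
  simp only [Finset.mem_Ico, Finset.mem_union] <;> omega

/-- A gap on the boundary of an interval `a, …, b - 1` of leaves is one of its two ends. -/
theorem eq_or_eq_of_boundary {N a b g : ℕ} (hb : b ≤ N)
    (h : ¬ ((a ≤ g ∧ g < b) ↔ (a ≤ cpred N g ∧ cpred N g < b))) :
    g = a ∨ g = b ∨ (g = 0 ∧ b = N) := by
  unfold cpred at h
  split_ifs at h <;> omega

/-- On the circle one can pass from one side of the leaf `y` to the other only through `y` or
through `0`; a connected set that avoids both has no hole at `y`. -/
theorem IsConn.Ico_subset {N : ℕ} {b : Block} (h : IsConn N b) {x z y : ℕ} (hx : x ∈ b)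
    (hz : z ∈ b) (hxy : x < y) (hyz : y < z) (hy : y ∉ b) (h0 : 0 ∉ b) (hzN : z < N) : False := by
  obtain ⟨g, hg, hgb, hgm⟩ := h (fun u => 0 ≤ u ∧ u < y) x z hx hz ⟨by omega, hxy⟩ (by omega)
  rcases eq_or_eq_of_boundary (by omega) hgm with rfl | rfl | ⟨rfl, -⟩
  · exact h0 hgb.1
  · exact hy hgb.1
  · exact h0 hgb.1

/-- Edges are the connected sets of at least two leaves that do not contain both marks. -/
theorem Corolla.isBlock_of_conn {c : Corolla} {b : Block} (hs : b ⊆ Finset.range c.arity)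
    (hne : ∃ x ∈ b, ∃ y ∈ b, x ≠ y) (hm : ¬ (0 ∈ b ∧ c.mark ∈ b)) (hc : IsConn c.arity b) :
    c.IsBlock b := by
  have hml := c.mark_lt
  have hm1 := c.one_le_mark
  obtain ⟨u, hu, v, hv, huv⟩ := hne
  rw [Corolla.isBlock_iff_arc]
  by_cases h0 : 0 ∈ b
  · have hmb : c.mark ∉ b := fun h => hm ⟨h0, h⟩
    right
    classical
    -- The first missing leaf counted from the front and from the back. Both searches end at the
    -- mark at the latest, which puts the two pieces on the correct sides of it.
    have ex : ∃ y, y ∉ b := ⟨c.mark, hmb⟩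
    have ex' : ∃ t, c.arity - 1 - t ∉ b ∧ t < c.arity := ⟨c.arity - 1 - c.mark, by
      rwa [show c.arity - 1 - (c.arity - 1 - c.mark) = c.mark by omega], by omega⟩
    have hyb := Nat.find_spec ex
    have hyl : ∀ z < Nat.find ex, z ∈ b := fun z hz => not_not.1 (Nat.find_min ex hz)
    have hymark : Nat.find ex ≤ c.mark := Nat.find_min' ex hmb
    have htb := (Nat.find_spec ex').1
    have htl : ∀ z < Nat.find ex', c.arity - 1 - z ∈ b := fun z hz => by
      have h1 := Nat.find_min ex' hz
      have h2 := (Nat.find_spec ex').2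
      by_contra h3
      exact h1 ⟨h3, by omega⟩
    have htmark : Nat.find ex' ≤ c.arity - 1 - c.mark := Nat.find_min' ex' ⟨by
      rwa [show c.arity - 1 - (c.arity - 1 - c.mark) = c.mark by omega], by omega⟩
    set y := Nat.find ex
    set t := Nat.find ex'
    have hy0 : y ≠ 0 := fun h => hyb (h ▸ h0)
    have heq : b = Finset.Ico 0 y ∪ Finset.Ico (c.arity - t) c.arity := by
      ext z
      rw [Finset.mem_union, Finset.mem_Ico, Finset.mem_Ico]
      constructor
      · intro hz
        have hzN := Finset.mem_range.1 (hs hz)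
        by_contra hcon
        -- A leaf of `b` in the middle range would be connected with `0` across one of the two ends
        -- of this range, but at either end a leaf is missing from `b`.
        obtain ⟨g, hg, hgb, hgm⟩ := hc (fun u => y ≤ u ∧ u < c.arity - t) z 0 hz h0 (by omega)
          (by omega)
        rcases eq_or_eq_of_boundary (by omega) hgm with rfl | rfl | ⟨rfl, h⟩
        · exact hyb hgb.1
        · apply htb
          have := hgb.2
          unfold cpred at this
          rw [if_neg (by omega)] at this
          rwa [show c.arity - 1 - t = c.arity - t - 1 by omega]
        · apply htb
          have := hgb.2
          unfold cpred at this
          rw [if_pos rfl] at this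
          rwa [show c.arity - 1 - t = c.arity - 1 by omega]
      · rintro (hz | hz)
        · exact hyl z hz.2
        · have := htl (c.arity - 1 - z) (by omega)
          rwa [show c.arity - 1 - (c.arity - 1 - z) = z by omega] at this
    refine ⟨c.arity - t, y, by omega, hymark, by omega, by omega, ?_, heq⟩
    rw [heq, Finset.mem_union, Finset.mem_Ico, Finset.mem_Ico] at hu hv
    omega
  · left
    have hbn : b.Nonempty := ⟨u, hu⟩
    have heq : b = Finset.Ico (b.min' hbn) (b.max' hbn + 1) := by
      ext z
      rw [Finset.mem_Ico]
      constructor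
      · intro hz
        exact ⟨b.min'_le z hz, Nat.lt_succ_of_le (b.le_max' z hz)⟩
      · rintro ⟨h1, h2⟩
        by_contra hz
        have hx := b.min'_mem hbn
        have hy := b.max'_mem hbn
        have e1 : b.min' hbn ≠ z := fun h => hz (h ▸ hx)
        have e2 : b.max' hbn ≠ z := fun h => hz (h ▸ hy)
        exact hc.Ico_subset hx hy (by omega) (by omega) hz h0
          (Finset.mem_range.1 (hs hy))
    refine ⟨_, _, ?_, ?_, ?_, heq⟩
    · have hx := b.min'_mem hbn
      exact Nat.one_le_iff_ne_zero.2 fun h => h0 (h ▸ hx)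
    · have := b.min'_le u hu
      have := b.min'_le v hv
      have := b.le_max' u hu
      have := b.le_max' v hv
      omega
    · exact Finset.mem_range.1 (hs (b.max'_mem hbn))

theorem cpred_lt {N g : ℕ} (hg : g < N) : cpred N g < N := by
  unfold cpred; split_ifs <;> omega

theorem cpred_ne {N g : ℕ} (hN : 2 ≤ N) : cpred N g ≠ g := by
  unfold cpred; split_ifs <;> omega

theorem Corolla.IsBlock.isBlock_union {c : Corolla} {b b' : Block} {g : ℕ} (hg : g < c.arity)
    (hb : b ⊆ Finset.range c.arity) (hb' : b' ⊆ Finset.range c.arity)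
    (h : IsConn c.arity b) (h' : IsConn c.arity b') (hgb : cpred c.arity g ∈ b) (hgb' : g ∈ b')
    (hm : ¬ (0 ∈ b ∪ b' ∧ c.mark ∈ b ∪ b')) : c.IsBlock (b ∪ b') :=
  Corolla.isBlock_of_conn (Finset.union_subset hb hb')
    ⟨_, Finset.mem_union_left _ hgb, _, Finset.mem_union_right _ hgb', cpred_ne c.two_le_arity⟩ hm
    (h.union h' hg (Or.inr ⟨hgb, hgb'⟩))

end
end Pairahedra

namespace Pairahedra
noncomputable section

/-! ## The vertex at a gap -/

/-- The two tags for the root vertex; neither is an edge.  The gaps in the upper half-plane have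
the first one. -/
def Corolla.rootTag (c : Corolla) (g : ℕ) : Block := if 1 ≤ g ∧ g ≤ c.mark then ∅ else {0}

theorem Corolla.IsBlock.ne_empty {c : Corolla} {b : Block} (h : c.IsBlock b) : b ≠ ∅ := by
  rintro rfl
  obtain ⟨x, hx, -⟩ := h.exists_ne
  simp at hx

theorem Corolla.IsBlock.ne_singleton {c : Corolla} {b : Block} (h : c.IsBlock b) (a : ℕ) :
    b ≠ {a} := by
  rintro rfl
  obtain ⟨x, hx, y, hy, hxy⟩ := h.exists_ne
  simp at hx hy
  exact hxy (hx.trans hy.symm)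

theorem Corolla.rootTag_eq (c : Corolla) (g : ℕ) : c.rootTag g = ∅ ∨ c.rootTag g = {0} := by
  unfold Corolla.rootTag; split_ifs <;> simp

theorem Corolla.rootTag_notMem {c : Corolla} (D : Diagram c) (g : ℕ) : c.rootTag g ∉ D.edges := by
  intro h
  rcases c.rootTag_eq g with h' | h' <;> rw [h'] at h
  · exact (D.isBlock _ h).ne_empty rfl
  · exact (D.isBlock _ h).ne_singleton 0 rfl

theorem Diagram.nested {c : Corolla} (D : Diagram c) {b b' : Block} (hb : b ∈ D.edges)
    (hb' : b' ∈ D.edges) {x : ℕ} (hx : x ∈ b) (hx' : x ∈ b') : b ⊆ b' ∨ b' ⊆ b := by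
  rcases D.compatible b hb b' hb' with h | h | h
  · exact Or.inl h
  · exact Or.inr h
  · exact absurd hx' (Finset.disjoint_left.1 h hx)

variable {c : Corolla}

open Classical in
/-- The vertex of a diagram at a gap between consecutive leaves: the smallest edge outward from
which both leaves lie, or a tag for the root vertex. -/
def Diagram.label (D : Diagram c) (g : ℕ) : Block :=
  if ∃ b ∈ D.edges, Covers c.arity b g then
    (Finset.range c.arity).filter fun x => ∀ b ∈ D.edges, Covers c.arity b g → x ∈ b
  else c.rootTag g

theorem Diagram.label_eq {D : Diagram c} {b : Block} {g : ℕ} (hb : b ∈ D.edges)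
    (hg : Covers c.arity b g) (h : ∀ b' ∈ D.edges, Covers c.arity b' g → b ⊆ b') :
    D.label g = b := by
  rw [Diagram.label, if_pos ⟨b, hb, hg⟩]
  ext x
  simp only [Finset.mem_filter]
  exact ⟨fun hx => hx.2 b hb hg, fun hx =>
    ⟨(D.isBlock b hb).subset hx, fun b' hb' hg' => h b' hb' hg' hx⟩⟩

theorem Diagram.label_root {D : Diagram c} {g : ℕ} (h : ∀ b ∈ D.edges, ¬ Covers c.arity b g) :
    D.label g = c.rootTag g := by
  rw [Diagram.label, if_neg]
  rintro ⟨b, hb, hg⟩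
  exact h b hb hg

/-- The smallest edge at a gap. -/
theorem Diagram.label_spec {D : Diagram c} {b : Block} {g : ℕ} (hb : b ∈ D.edges)
    (hg : Covers c.arity b g) : D.label g ∈ D.edges ∧ Covers c.arity (D.label g) g ∧
      ∀ b' ∈ D.edges, Covers c.arity b' g → D.label g ⊆ b' := by
  classical
  -- Edges covering the same gap share a leaf and hence are nested, so one of least cardinality lies
  -- in all others.
  obtain ⟨a, ha, hmin⟩ := (D.edges.filter fun b => Covers c.arity b g).exists_min_image
    Finset.card ⟨b, Finset.mem_filter.2 ⟨hb, hg⟩⟩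
  rw [Finset.mem_filter] at ha
  have key : ∀ b' ∈ D.edges, Covers c.arity b' g → a ⊆ b' := by
    intro b' hb' hg'
    rcases D.nested ha.1 hb' ha.2.1 hg'.1 with h | h
    · exact h
    · rw [Finset.eq_of_subset_of_card_le h (hmin b' (Finset.mem_filter.2 ⟨hb', hg'⟩))]
  rw [Diagram.label_eq ha.1 ha.2 key]
  exact ⟨ha.1, ha.2, key⟩

theorem Diagram.label_cases (D : Diagram c) (g : ℕ) :
    (D.label g ∈ D.edges ∧ Covers c.arity (D.label g) g ∧
      ∀ b' ∈ D.edges, Covers c.arity b' g → D.label g ⊆ b') ∨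
    ((∀ b ∈ D.edges, ¬ Covers c.arity b g) ∧ D.label g = c.rootTag g) := by
  by_cases h : ∃ b ∈ D.edges, Covers c.arity b g
  · obtain ⟨b, hb, hg⟩ := h
    exact Or.inl (Diagram.label_spec hb hg)
  · push Not at h
    exact Or.inr ⟨h, Diagram.label_root h⟩

theorem Diagram.label_of_mem {D : Diagram c} {g : ℕ} (h : D.label g ∈ D.edges) :
    Covers c.arity (D.label g) g ∧ ∀ b' ∈ D.edges, Covers c.arity b' g → D.label g ⊆ b' := by
  rcases D.label_cases g with h' | h'
  · exact h'.2
  · exact absurd (h'.2 ▸ h) (Corolla.rootTag_notMem D g)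

theorem Diagram.not_covers_of_label {D : Diagram c} {g : ℕ} (h : D.label g ∉ D.edges) :
    ∀ b ∈ D.edges, ¬ Covers c.arity b g := by
  rcases D.label_cases g with h' | h'
  · exact absurd h'.1 h
  · exact h'.1

/-- Every vertex except for the root vertex has a gap. -/
theorem Diagram.exists_label_eq (D : Diagram c) {b : Block} (hb : b ∈ D.edges) :
    ∃ g < c.arity, D.label g = b := by
  classical
  obtain ⟨x, hx, y, hy, hxy⟩ := (D.isBlock b hb).exists_ne
  have hxb : {x} ⊂ b := by
    rw [Finset.ssubset_iff_subset_ne]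
    exact ⟨by simpa using hx, ((D.isBlock b hb).ne_singleton x).symm⟩
  -- Let `m` be a largest edge inside of `b`, where the singleton `{x}` is admitted so that the
  -- family is not empty. Some gap covered by `b` lies on the boundary of `m`. An edge that covers
  -- this gap and lies strictly inside `b` would contain `m` properly, so `b` is the smallest edge
  -- there.
  obtain ⟨m, hm, hmax⟩ := (((insert {x} D.edges).filter fun a => a ⊂ b ∧ a.Nonempty)).exists_max_image
    Finset.card ⟨{x}, by simp [hxb]⟩
  simp only [Finset.mem_filter, Finset.mem_insert] at hm hmax
  obtain ⟨hmD, hmb, u, hu⟩ := hm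
  obtain ⟨v, hv, hvm⟩ := Finset.exists_of_ssubset hmb
  obtain ⟨g, hg, hgb, hgm⟩ := (D.isBlock b hb).conn (· ∈ m) u v (hmb.1 hu) hv hu hvm
  refine ⟨g, hg, Diagram.label_eq hb hgb fun b' hb' hgb' => ?_⟩
  rcases D.nested hb hb' hgb.1 hgb'.1 with h | h
  · exact h
  · by_cases hne : b' = b
    · rw [hne]
    · have hss : b' ⊂ b := Finset.ssubset_iff_subset_ne.2 ⟨h, hne⟩
      have hle := hmax b' ⟨Or.inr hb', hss, ⟨g, hgb'.1⟩⟩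
      have hmb' : m ⊆ b' ∨ b' ⊆ m := by
        have : ∃ z, z ∈ m ∧ z ∈ b' := by
          by_cases hgm' : g ∈ m
          · exact ⟨g, hgm', hgb'.1⟩
          · exact ⟨_, by tauto, hgb'.2⟩
        obtain ⟨z, hz, hz'⟩ := this
        rcases hmD with rfl | hmD
        · rw [Finset.mem_singleton] at hz
          exact Or.inl (by simpa [← hz] using hz')
        · exact D.nested hmD hb' hz hz'
      rcases hmb' with h' | h'
      · have := Finset.eq_of_subset_of_card_le h' hle
        subst this
        exact absurd (iff_of_true hgb'.1 hgb'.2) hgm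
      · exact absurd (iff_of_true (h' hgb'.1) (h' hgb'.2)) hgm

/-- The leaf `0` together with all edges outward from which it lies. -/
theorem Diagram.exists_root_set (D : Diagram c) : ∃ m : ℕ → Prop, m 0 ∧ ¬ m c.mark ∧
    ∀ b ∈ D.edges, ∀ x ∈ b, m x → ∀ y ∈ b, m y := by
  -- Edges with a common leaf are nested, so an edge that meets this set lies in it. The set avoids
  -- the mark because no edge contains both marked leaves.
  refine ⟨fun x => x = 0 ∨ ∃ b ∈ D.edges, 0 ∈ b ∧ x ∈ b, Or.inl rfl, ?_, ?_⟩
  · rintro (h | ⟨b, hb, h0, hm⟩)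
    · have := c.one_le_mark
      omega
    · exact (D.isBlock b hb).not_marks ⟨h0, hm⟩
  · rintro b hb x hx (rfl | ⟨b', hb', h0, hx'⟩) y hy
    · exact Or.inr ⟨b, hb, hx, hy⟩
    · rcases D.nested hb hb' hx hx' with h | h
      · exact Or.inr ⟨b', hb', h0, h hy⟩
      · exact Or.inr ⟨b, hb, h h0, hy⟩

/-- Between `0` and the mark one leaves the set of `Diagram.exists_root_set`. No edge can cover the
gap at which this happens, so the gap belongs to the root vertex. -/
theorem Diagram.exists_label_upper (D : Diagram c) : ∃ g < c.arity, D.label g = ∅ := by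
  obtain ⟨m, h0, hm, hD⟩ := D.exists_root_set
  have h1 := c.mark_lt
  obtain ⟨z, hz1, hz2, hz⟩ := exists_step h0 hm
  rw [Nat.zero_max] at hz2
  refine ⟨z + 1, by omega, ?_⟩
  rw [Diagram.label_root, Corolla.rootTag, if_pos (by omega)]
  rintro b hb ⟨hb1, hb2⟩
  rw [cpred, if_neg (by omega), Nat.add_sub_cancel] at hb2
  exact hz ⟨fun h => hD b hb _ hb1 h _ hb2, fun h => hD b hb _ hb2 h _ hb1⟩

theorem Diagram.exists_label_lower (D : Diagram c) : ∃ g < c.arity, D.label g = {0} := by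
  obtain ⟨m, h0, hm, hD⟩ := D.exists_root_set
  have h1 := c.mark_lt
  -- The walk on the other side of the circle, from the mark upwards; the index `c.arity` stands for
  -- the leaf `0`.
  obtain ⟨z, hz1, hz2, hz⟩ := exists_step (P := fun i => m (if i = c.arity then 0 else i))
    (a := c.arity) (b := c.mark) (by simpa using h0) (by simpa [h1.ne] using hm)
  rw [min_eq_right h1.le] at hz1
  rw [max_eq_left h1.le] at hz2
  rw [if_neg (show ¬ z = c.arity by omega)] at hz
  refine ⟨if z + 1 = c.arity then 0 else z + 1, by split_ifs <;> omega, ?_⟩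
  have hp : cpred c.arity (if z + 1 = c.arity then 0 else z + 1) = z := by
    unfold cpred
    by_cases h : z + 1 = c.arity
    · simp only [if_pos h, if_true]; omega
    · simp only [if_neg h, Nat.add_one_ne_zero, if_false, Nat.add_sub_cancel]
  have hn : ¬ (1 ≤ (if z + 1 = c.arity then 0 else z + 1) ∧
      (if z + 1 = c.arity then 0 else z + 1) ≤ c.mark) := by
    by_cases h : z + 1 = c.arity
    · rw [if_pos h]; omega
    · rw [if_neg h]; omega
  rw [Diagram.label_root, Corolla.rootTag, if_neg hn]
  rintro b hb ⟨hb1, hb2⟩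
  rw [hp] at hb2
  exact hz ⟨fun h => hD b hb _ hb1 h _ hb2, fun h => hD b hb _ hb2 h _ hb1⟩

/-- All vertices, including both tags of the root vertex. -/
def Diagram.tags (D : Diagram c) : Finset Block := insert ∅ (insert {0} D.edges)

theorem Diagram.card_tags (D : Diagram c) : D.tags.card = D.edges.card + 2 := by
  rw [Diagram.tags, Finset.card_insert_of_notMem, Finset.card_insert_of_notMem]
  · exact fun h => (D.isBlock _ h).ne_singleton 0 rfl
  · rw [Finset.mem_insert, not_or]
    exact ⟨(Finset.singleton_ne_empty 0).symm, fun h => (D.isBlock _ h).ne_empty rfl⟩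

theorem Diagram.image_label (D : Diagram c) : (Finset.range c.arity).image D.label = D.tags := by
  ext b
  simp only [Finset.mem_image, Finset.mem_range, Diagram.tags, Finset.mem_insert]
  constructor
  · rintro ⟨g, -, rfl⟩
    rcases D.label_cases g with h | h
    · exact Or.inr (Or.inr h.1)
    · rw [h.2]
      rcases c.rootTag_eq g with h' | h'
      · exact Or.inl h'
      · exact Or.inr (Or.inl h')
  · rintro (rfl | rfl | h)
    · exact D.exists_label_upper
    · exact D.exists_label_lower
    · exact D.exists_label_eq h

/-- A diagram has at most two edges less than leaves. -/
theorem Diagram.card_edges_le (D : Diagram c) : D.edges.card + 2 ≤ c.arity := by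
  rw [← D.card_tags, ← D.image_label]
  exact Finset.card_image_le.trans (Finset.card_range _).le

theorem Diagram.degree_eq_zero_iff (D : Diagram c) :
    D.degree = 0 ↔ D.edges.card + 2 = c.arity := by
  unfold Diagram.degree
  omega

/-- In a binary diagram, every vertex has exactly one gap. -/
theorem Diagram.label_injOn (D : Diagram c) (h : D.edges.card + 2 = c.arity) :
    Set.InjOn D.label (Finset.range c.arity) := by
  refine Finset.injOn_of_card_image_eq ?_
  rw [D.image_label, D.card_tags, h, Finset.card_range]

end
end Pairahedra

namespace Pairahedra
noncomputable section

/-! ## Local moves -/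

variable {c : Corolla}

/-- `B` is obtained from `D` by adding the edge `e`. -/
def Resolves (D B : Diagram c) (e : Block) : Prop := e ∉ D.edges ∧ B.edges = insert e D.edges

/-- Add an edge. -/
def Diagram.insertEdge (D : Diagram c) (e : Block) (he : c.IsBlock e)
    (hc : ∀ b ∈ D.edges, Compatible e b) : Diagram c where
  edges := insert e D.edges
  isBlock b hb := by
    rcases Finset.mem_insert.1 hb with rfl | hb
    · exact he
    · exact D.isBlock b hb
  compatible b hb b' hb' := by
    rcases Finset.mem_insert.1 hb with h | h <;> rcases Finset.mem_insert.1 hb' with h' | h'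
    · exact Or.inl (h.trans h'.symm).subset
    · exact h ▸ hc _ h'
    · exact h' ▸ compatible_symm (hc _ h)
    · exact D.compatible _ h _ h'

theorem resolves_contract {B : Diagram c} {e : Block} (he : e ∈ B.edges) :
    Resolves (B.contract e) B e :=
  ⟨Finset.notMem_erase _ _, (Finset.insert_erase he).symm⟩

theorem Resolves.contract {D B : Diagram c} {e : Block} (h : Resolves D B e) :
    B.contract e = D := by
  ext1
  change B.edges.erase e = _
  rw [h.2, Finset.erase_insert h.1]

/-! ### Diagrams with one edge less than binary ones, and their resolutions -/

section Resolves

variable {D B B' : Diagram c} {e e' : Block}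

theorem Resolves.mem (h : Resolves D B e) : e ∈ B.edges := h.2 ▸ Finset.mem_insert_self _ _

theorem Resolves.subset (h : Resolves D B e) : D.edges ⊆ B.edges :=
  h.2 ▸ Finset.subset_insert _ _

theorem Resolves.mem_iff (h : Resolves D B e) {b : Block} :
    b ∈ B.edges ↔ b = e ∨ b ∈ D.edges := by rw [h.2, Finset.mem_insert]

theorem Resolves.card (h : Resolves D B e) : B.edges.card = D.edges.card + 1 := by
  rw [h.2, Finset.card_insert_of_notMem h.1]

/-- Adding an edge affects only the gaps at which the added edge becomes the smallest covering edge.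
-/
theorem Resolves.label_eq (h : Resolves D B e) {x : ℕ} (hx : B.label x ≠ e) :
    B.label x = D.label x := by
  rcases B.label_cases x with ⟨h1, h2, h3⟩ | ⟨h1, h2⟩
  · exact (Diagram.label_eq ((h.mem_iff.1 h1).resolve_left hx) h2
      fun b hb hbx => h3 b (h.subset hb) hbx).symm
  · rw [h2, Diagram.label_root fun b hb => h1 b (h.subset hb)]

variable (hN : D.edges.card + 3 = c.arity)
include hN

theorem Resolves.label_injOn (h : Resolves D B e) : Set.InjOn B.label (Finset.range c.arity) :=
  B.label_injOn (by rw [h.card]; omega)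

theorem Resolves.label_eq_of_ne (h : Resolves D B e) {g x : ℕ} (hg : g < c.arity)
    (hge : B.label g = e) (hx : x < c.arity) (hne : x ≠ g) : B.label x = D.label x :=
  h.label_eq fun hxe => hne (h.label_injOn hN (by simpa using hx) (by simpa using hg)
    (hxe.trans hge.symm))

/-- Away from the gap of the added edge the labels of `D` are those of the binary diagram `B`, which
are distinct. Any coincidence of labels in `D` therefore involves `g`. -/
theorem Resolves.eq_of_label_eq (h : Resolves D B e) {g x y : ℕ} (hg : g < c.arity)
    (hge : B.label g = e) (hx : x < c.arity) (hxg : x ≠ g) (hy : y < c.arity) (hyg : y ≠ g)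
    (hxy : D.label x = D.label y) : x = y := by
  rw [← h.label_eq_of_ne hN hg hge hx hxg, ← h.label_eq_of_ne hN hg hge hy hyg] at hxy
  exact h.label_injOn hN (by simpa using hx) (by simpa using hy) hxy

/-- Pigeonhole: by `hN` there are `c.arity` gaps but only `c.arity - 1` tags. -/
theorem exists_label_collision : ∃ x < c.arity, ∃ y < c.arity, x ≠ y ∧ D.label x = D.label y := by
  obtain ⟨x, hx, y, hy, hxy, h⟩ := Finset.exists_ne_map_eq_of_card_lt_of_maps_to
    (s := Finset.range c.arity) (t := D.tags) (f := D.label)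
    (by rw [D.card_tags, Finset.card_range]; omega)
    (fun x hx => by rw [← D.image_label]; exact Finset.mem_image_of_mem _ hx)
  exact ⟨x, by simpa using hx, y, by simpa using hy, hxy, h⟩

theorem Resolves.exists_other_gap (h : Resolves D B e) {g : ℕ} (hg : g < c.arity)
    (hge : B.label g = e) : ∃ x < c.arity, x ≠ g ∧ D.label x = D.label g := by
  obtain ⟨x, hx, y, hy, hxy, hl⟩ := exists_label_collision hN
  by_cases hxg : x = g
  · subst hxg
    exact ⟨y, hy, hxy.symm, hl.symm⟩
  · by_cases hyg : y = g
    · subst hyg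
      exact ⟨x, hx, hxg, hl⟩
    · exact absurd (h.eq_of_label_eq hN hg hge hx hxg hy hyg hl) hxy

omit hN in
theorem Resolves.subset_of_covers (h : Resolves D B e) {g : ℕ} (hge : B.label g = e) {b : Block}
    (hb : b ∈ D.edges) (hbg : Covers c.arity b g) : e ⊆ b := by
  have := Diagram.label_of_mem (hge ▸ h.mem : B.label g ∈ B.edges)
  rw [hge] at this
  exact this.2 b (h.subset hb) hbg

omit hN in
theorem Resolves.covers (h : Resolves D B e) {g : ℕ} (hge : B.label g = e) :
    Covers c.arity e g := by
  have := Diagram.label_of_mem (hge ▸ h.mem : B.label g ∈ B.edges)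
  rw [hge] at this
  exact this.1

/-- If `e` is not inside `e'`, then `e` covers a gap `x` on the boundary of `e'`. An edge of `D`
covering `x` must contain `e'`, so it covers the common gap `g` and thus contains `e`. Hence `x` is
a second gap labelled `e` in the binary diagram `B`, which is impossible. -/
theorem Resolves.gap_ne_aux (h : Resolves D B e) (h' : Resolves D B' e') {g : ℕ}
    (hg : g < c.arity) (hge : B.label g = e) (hge' : B'.label g = e') : e ⊆ e' := by
  by_contra hs
  obtain ⟨y, hy, hy'⟩ := Finset.not_subset.1 hs
  have hgc := h.covers hge
  have hgc' := h'.covers hge'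
  obtain ⟨x, hx, hxe, hxm⟩ := (B.isBlock e h.mem).conn (· ∈ e') g y hgc.1 hy hgc'.1 hy'
  have hxl : B.label x = e := by
    refine Diagram.label_eq h.mem hxe fun b hb hbx => ?_
    rcases h.mem_iff.1 hb with rfl | hbD
    · exact subset_rfl
    · have : ∃ z, z ∈ b ∧ z ∈ e' := by
        by_cases hxe' : x ∈ e'
        · exact ⟨x, hbx.1, hxe'⟩
        · exact ⟨_, hbx.2, by tauto⟩
      obtain ⟨z, hz, hz'⟩ := this
      rcases B'.nested (h'.subset hbD) h'.mem hz hz' with hs | hs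
      · exact absurd (iff_of_true (hs hbx.1) (hs hbx.2)) hxm
      · exact h.subset_of_covers hge hbD ⟨hs hgc'.1, hs hgc'.2⟩
  have hxg : x ≠ g := by
    rintro rfl
    exact hxm (iff_of_true hgc'.1 hgc'.2)
  exact hxg (h.label_injOn hN (by simpa using hx) (by simpa using hg) (hxl.trans hge.symm))

theorem Resolves.gap_ne (h : Resolves D B e) (h' : Resolves D B' e') (hne : e ≠ e') {g g' : ℕ}
    (hg : g < c.arity) (hge : B.label g = e) (hge' : B'.label g' = e') : g ≠ g' := by
  rintro rfl
  exact hne ((h.gap_ne_aux hN h' hg hge hge').antisymm (h'.gap_ne_aux hN h hg hge' hge))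

/-- The gaps of the edges that are exchanged in a local move belong to the same vertex. -/
theorem Resolves.label_gap_eq (h : Resolves D B e) (h' : Resolves D B' e') (hne : e ≠ e')
    {g g' : ℕ} (hg : g < c.arity) (hg' : g' < c.arity) (hge : B.label g = e)
    (hge' : B'.label g' = e') : D.label g = D.label g' := by
  have hgg := h.gap_ne hN h' hne hg hge hge'
  obtain ⟨x, hx, hxg, hl⟩ := h.exists_other_gap hN hg hge
  by_cases hxg' : x = g'
  · rw [← hl, hxg']
  · exact absurd (h'.eq_of_label_eq hN hg' hge' hx hxg' hg hgg hl) hxg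

/-- Otherwise `e'` could be added to `B`, which already has the maximal number of edges. -/
theorem Resolves.not_compatible (h : Resolves D B e) (h' : Resolves D B' e') (hne : e ≠ e') :
    ¬ Compatible e e' := by
  intro hc
  have := (B.insertEdge e' (B'.isBlock e' h'.mem) (fun b hb => by
    rcases h.mem_iff.1 hb with rfl | hb
    · exact compatible_symm hc
    · exact B'.compatible _ h'.mem _ (h'.subset hb))).card_edges_le
  change (insert e' B.edges).card + 2 ≤ _ at this
  rw [Finset.card_insert_of_notMem, h.card] at this
  · omega
  · intro he'
    rcases h.mem_iff.1 he' with he' | he'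
    · exact hne he'.symm
    · exact h'.1 he'

/-- An edge of `D` is compatible with both `e` and `e'`. If it contained one of them and were inside
of or disjoint from the other, then `e` and `e'` would be compatible. -/
theorem Resolves.subset_or (h : Resolves D B e) (h' : Resolves D B' e') (hne : e ≠ e') {d : Block}
    (hd : d ∈ D.edges) {x : ℕ} (hx : x ∈ d) (hxe : x ∈ e ∪ e') : d ⊆ e ∨ d ⊆ e' ∨ e ∪ e' ⊆ d := by
  have hnc := h.not_compatible hN h' hne
  have key : (d ⊆ e ∨ e ⊆ d) ∨ (d ⊆ e' ∨ e' ⊆ d) := by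
    rcases Finset.mem_union.1 hxe with hxe | hxe
    · exact Or.inl (B.nested (h.subset hd) h.mem hx hxe)
    · exact Or.inr (B'.nested (h'.subset hd) h'.mem hx hxe)
  have h1 : e ⊆ d → d ⊆ e' ∨ e' ⊆ d := fun hs => by
    rcases B'.compatible d (h'.subset hd) e' h'.mem with h1 | h1 | h1
    · exact Or.inl h1
    · exact Or.inr h1
    · exact absurd (Or.inr (Or.inr (Finset.disjoint_of_subset_left hs h1))) hnc
  have h2 : e' ⊆ d → d ⊆ e ∨ e ⊆ d := fun hs => by
    rcases B.compatible d (h.subset hd) e h.mem with h1 | h1 | h1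
    · exact Or.inl h1
    · exact Or.inr h1
    · exact absurd (Or.inr (Or.inr (Finset.disjoint_of_subset_left hs h1).symm)) hnc
  have h3 : ¬ e ⊆ e' := fun hs => hnc (Or.inl hs)
  have h4 : ¬ e' ⊆ e := fun hs => hnc (Or.inr (Or.inl hs))
  rcases key with (hs | hs) | (hs | hs)
  · exact Or.inl hs
  · rcases h1 hs with ht | ht
    · exact absurd (hs.trans ht) h3
    · exact Or.inr (Or.inr (Finset.union_subset hs ht))
  · exact Or.inr (Or.inl hs)
  · rcases h2 hs with ht | ht
    · exact absurd (hs.trans ht) h4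
    · exact Or.inr (Or.inr (Finset.union_subset ht hs))

/-- By `Resolves.subset_or` an edge of `D` that crosses the boundary of `e ∪ e'` contains this
union, in particular both leaves at the gap of `e`. -/
theorem Resolves.label_of_boundary (h : Resolves D B e) (h' : Resolves D B' e') (hne : e ≠ e')
    {g y : ℕ} (hge : B.label g = e) (hy : ¬ (y ∈ e ∪ e' ↔ cpred c.arity y ∈ e ∪ e')) {d : Block}
    (hd : d ∈ D.edges) (hdy : Covers c.arity d y) : Covers c.arity d g := by
  have : ∃ z, z ∈ d ∧ z ∈ e ∪ e' := by
    by_cases hye : y ∈ e ∪ e'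
    · exact ⟨y, hdy.1, hye⟩
    · exact ⟨_, hdy.2, by tauto⟩
  obtain ⟨z, hz, hz'⟩ := this
  rcases h.subset_or hN h' hne hd hz hz' with hs | hs | hs
  · exact absurd (iff_of_true (Finset.mem_union_left _ (hs hdy.1))
      (Finset.mem_union_left _ (hs hdy.2))) hy
  · exact absurd (iff_of_true (Finset.mem_union_right _ (hs hdy.1))
      (Finset.mem_union_right _ (hs hdy.2))) hy
  · have hgc := h.covers hge
    exact ⟨hs (Finset.mem_union_left _ hgc.1), hs (Finset.mem_union_left _ hgc.2)⟩

/-- The union of the two edges exchanged in a local move consists of all leaves outward from the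
vertex at which it takes place. -/
theorem Resolves.union_mem (h : Resolves D B e) (h' : Resolves D B' e') (hne : e ≠ e') :
    e ∪ e' ∈ D.edges ∨ e ∪ e' = Finset.range c.arity := by
  obtain ⟨g, hg, hge⟩ := B.exists_label_eq h.mem
  obtain ⟨g', hg', hge'⟩ := B'.exists_label_eq h'.mem
  have hgg := h.gap_ne hN h' hne hg hge hge'
  have hl := h.label_gap_eq hN h' hne hg hg' hge hge'
  have hgc := h.covers hge
  have hgc' := h'.covers hge'
  have bne : ∀ y, ¬ (y ∈ e ∪ e' ↔ cpred c.arity y ∈ e ∪ e') → y ≠ g ∧ y ≠ g' := by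
    intro y hy
    constructor
    · rintro rfl
      exact hy (iff_of_true (Finset.mem_union_left _ hgc.1) (Finset.mem_union_left _ hgc.2))
    · rintro rfl
      exact hy (iff_of_true (Finset.mem_union_right _ hgc'.1) (Finset.mem_union_right _ hgc'.2))
  rcases D.label_cases g with ⟨h1, h2, h3⟩ | ⟨h1, h2⟩
  · left
    have hMP : e ∪ e' ⊆ D.label g := by
      rcases h.subset_or hN h' hne h1 h2.1 (Finset.mem_union_left _ hgc.1) with hs | hs | hs
      · have := h.subset_of_covers hge h1 h2
        exact absurd (this.antisymm hs ▸ h1) h.1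
      · have h4 := Diagram.label_of_mem (hl ▸ h1 : D.label g' ∈ D.edges)
        rw [← hl] at h4
        have := h'.subset_of_covers hge' h1 h4.1
        exact absurd (this.antisymm hs ▸ h1) h'.1
      · exact hs
    -- If the union were smaller than the vertex `D.label g`, a gap on its boundary would also have
    -- this label. Together with `g` and `g'` that makes three gaps with one label, but only two can
    -- coincide.
    by_cases hPM : D.label g ⊆ e ∪ e'
    · rw [hMP.antisymm hPM]
      exact h1
    · exfalso
      obtain ⟨z, hz, hzM⟩ := Finset.not_subset.1 hPM
      obtain ⟨y, hy, hyc, hyb⟩ := (D.isBlock _ h1).conn (· ∈ e ∪ e') g z h2.1 hz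
        (Finset.mem_union_left _ hgc.1) hzM
      have hyl : D.label y = D.label g := Diagram.label_eq h1 hyc fun b hb hby =>
        h3 b hb (h.label_of_boundary hN h' hne hge hyb hb hby)
      exact (bne y hyb).2 (h.eq_of_label_eq hN hg hge hy (bne y hyb).1 hg' hgg.symm
        (hyl.trans hl))
  · right
    by_contra hM
    have hsub : e ∪ e' ⊆ Finset.range c.arity :=
      Finset.union_subset (B.isBlock e h.mem).subset (B'.isBlock e' h'.mem).subset
    have hroot : ∀ y, ¬ (y ∈ e ∪ e' ↔ cpred c.arity y ∈ e ∪ e') → D.label y = c.rootTag y := by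
      intro y hy
      exact Diagram.label_root fun b hb hby =>
        h1 b hb (h.label_of_boundary hN h' hne hge hy hb hby)
    have hroot' : D.label g' = c.rootTag g' := by
      refine Diagram.label_root ?_
      refine Diagram.not_covers_of_label ?_
      rw [← hl, h2]
      exact Corolla.rootTag_notMem _ _
    obtain ⟨z, hz, hzM⟩ := Finset.not_subset.1 fun hs => hM (hsub.antisymm hs)
    rw [Finset.mem_range] at hz
    -- the boundary of `e ∪ e'` consists of at least two gaps
    have two : ∃ y1 < c.arity, ∃ y2 < c.arity, y1 ≠ y2 ∧
        ¬ (y1 ∈ e ∪ e' ↔ cpred c.arity y1 ∈ e ∪ e') ∧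
        ¬ (y2 ∈ e ∪ e' ↔ cpred c.arity y2 ∈ e ∪ e') := by
      have hgM : g ∈ e ∪ e' := Finset.mem_union_left _ hgc.1
      obtain ⟨u, hu1, hu2, hu⟩ := exists_step (P := (· ∈ e ∪ e')) hgM hzM
      have hp : cpred c.arity (u + 1) = u := by simp [cpred]
      have hu3 : u + 1 < c.arity := by
        rcases le_total g z with hh | hh <;> simp [hh] at hu2 <;> omega
      -- The second boundary gap is found on the complementary arc from `g` to `z`; indices from
      -- `c.arity` on are reduced by `c.arity`.
      obtain ⟨v, hv1, hv2, hv⟩ := exists_step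
        (P := fun i => (if i < c.arity then i else i - c.arity) ∈ e ∪ e')
        (a := if g < z then g + c.arity else g) (b := if g < z then z else z + c.arity)
        (by
          by_cases hgz : g < z
          · simpa only [if_pos hgz, if_neg (show ¬ g + c.arity < c.arity by omega),
              Nat.add_sub_cancel]
          · simpa only [if_neg hgz, if_pos hg])
        (by
          by_cases hgz : g < z
          · simpa only [if_pos hgz, if_pos hz]
          · simpa only [if_neg hgz, if_neg (show ¬ z + c.arity < c.arity by omega),
              Nat.add_sub_cancel])
      have hgz' : g ≠ z := fun hh => hzM (hh ▸ hgM)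
      have hvr : max g z ≤ v ∧ v < min g z + c.arity := by
        by_cases hgz : g < z
        · simp only [if_pos hgz] at hv1 hv2
          rw [max_eq_right hgz.le, min_eq_left hgz.le]
          omega
        · simp only [if_neg hgz] at hv1 hv2
          rw [max_eq_left (by omega), min_eq_right (by omega)]
          omega
      have hpv : cpred c.arity (if v + 1 < c.arity then v + 1 else v + 1 - c.arity) =
          if v < c.arity then v else v - c.arity := by
        unfold cpred
        by_cases hv' : v + 1 < c.arity
        · have hv'' : v < c.arity := by omega
          simp only [if_pos hv', if_pos hv'', Nat.add_one_ne_zero, if_false, Nat.add_sub_cancel]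
        · simp only [if_neg hv']
          split_ifs <;> omega
      refine ⟨u + 1, hu3, if v + 1 < c.arity then v + 1 else v + 1 - c.arity, ?_, ?_, ?_, ?_⟩
      · split_ifs <;> omega
      · split_ifs <;> omega
      · rw [hp]; exact hu
      · rw [hpv]; exact hv
    -- The gaps `y1`, `y2` and `g'` all lie at the root vertex and have pairwise distinct labels,
    -- but the root vertex has only two tags.
    obtain ⟨y1, hy1, y2, hy2, hyy, hb1, hb2⟩ := two
    have i1 := bne y1 hb1
    have i2 := bne y2 hb2
    have r1 := hroot y1 hb1
    have r2 := hroot y2 hb2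
    have n12 : D.label y1 ≠ D.label y2 := fun hh =>
      hyy (h.eq_of_label_eq hN hg hge hy1 i1.1 hy2 i2.1 hh)
    have n1 : D.label y1 ≠ D.label g' := fun hh =>
      i1.2 (h.eq_of_label_eq hN hg hge hy1 i1.1 hg' hgg.symm hh)
    have n2 : D.label y2 ≠ D.label g' := fun hh =>
      i2.2 (h.eq_of_label_eq hN hg hge hy2 i2.1 hg' hgg.symm hh)
    rw [r1, r2] at n12
    rw [r1, hroot'] at n1
    rw [r2, hroot'] at n2
    rcases c.rootTag_eq y1 with q1 | q1 <;> rcases c.rootTag_eq y2 with q2 | q2 <;>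
      rcases c.rootTag_eq g' with q3 | q3 <;> simp_all

end Resolves

end
end Pairahedra

namespace Pairahedra
noncomputable section

variable {c : Corolla}

/-! ### Existence of the other resolution -/

/-- The gaps `a` and `b` cut the circle into two arcs, and a connected set that covers neither gap
stays in one of them. -/
theorem IsConn.mem_Ico_iff {N : ℕ} {S : Block} (hS : IsConn N S) {a b : ℕ} (hb : b < N)
    (h1 : ¬ Covers N S a) (h2 : ¬ Covers N S b) {x y : ℕ} (hx : x ∈ S) (hy : y ∈ S) :
    (a ≤ x ∧ x < b) ↔ (a ≤ y ∧ y < b) := by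
  have key : ∀ x ∈ S, ∀ y ∈ S, (a ≤ x ∧ x < b) → (a ≤ y ∧ y < b) := by
    intro x hx y hy h
    by_contra h'
    obtain ⟨g, hg, hgc, hgm⟩ := hS (fun u => a ≤ u ∧ u < b) x y hx hy h h'
    rcases eq_or_eq_of_boundary hb.le hgm with rfl | rfl | ⟨rfl, rfl⟩
    · exact h1 hgc
    · exact h2 hgc
    · exact absurd hb (lt_irrefl _)
  exact ⟨key x hx y hy, key y hy x hx⟩

/-- Two connected sets which meet at two gaps cover the circle. -/
theorem mem_of_two_gaps {N lo hi z : ℕ} {S S' : Block} (hS : IsConn N S) (hS' : IsConn N S')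
    (hlh : lo < hi) (hhi : hi < N) (hz : z < N) (hin : ∀ x ∈ S, lo ≤ x ∧ x < hi)
    (hout : ∀ x ∈ S', ¬ (lo ≤ x ∧ x < hi)) (h1 : lo ∈ S) (h2 : hi - 1 ∈ S) (h3 : hi ∈ S')
    (h4 : cpred N lo ∈ S') : z ∈ S ∨ z ∈ S' := by
  by_contra! hcon
  have bd : ∀ T : Block, ∀ a b, b < N → IsConn N T → ¬ Covers N T a → ¬ Covers N T b →
      ∀ x ∈ T, ∀ y ∈ T, (a ≤ x ∧ x < b) → (a ≤ y ∧ y < b) :=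
    fun T a b hb hT e1 e2 x hx y hy => (hT.mem_Ico_iff hb e1 e2 hx hy).1
  have hne : ∀ x, x ∈ S ∨ x ∈ S' → x ≠ z := by
    rintro x hx rfl
    tauto
  have n1 := hne lo (Or.inl h1)
  have n2 := hne _ (Or.inl h2)
  have n3 := hne _ (Or.inr h3)
  have n4 := hne _ (Or.inr h4)
  unfold cpred at n4 h4
  -- In each position of `z`, one of the sets is known to have leaves on both sides of `z`, while it
  -- covers neither a gap next to `z` nor one of the gaps `lo`, `hi`. This contradicts its
  -- connectedness.
  by_cases hzI : lo ≤ z ∧ z < hi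
  · have := bd S lo z hz hS (fun hc => ?_) (fun hc => hcon.1 hc.1) lo h1 _ h2 (by omega)
    · omega
    · have := hin _ hc.2
      unfold cpred at this
      split_ifs at this <;> omega
  · by_cases hzh : hi ≤ z
    · have := bd S' hi z hz hS' (fun hc => ?_) (fun hc => hcon.2 hc.1) hi h3 _ h4 (by omega)
      · split_ifs at this n4 <;> omega
      · have := hout _ hc.2
        unfold cpred at this
        split_ifs at this <;> omega
    · rw [if_neg (by omega)] at h4 n4
      have := bd S' (z + 1) lo (by omega) hS' (fun hc => ?_) (fun hc => ?_) _ h4 hi h3 (by omega)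
      · omega
      · exact hcon.2 (by simpa [cpred] using hc.2)
      · exact hout _ hc.1 (by omega)

/-- The part of a vertex on one side of a gap. -/
theorem Diagram.exists_side (D : Diagram c) (h a : ℕ) :
    ∃ S : Block, a ∈ S ∧ (S = {a} ∨ S ∈ D.edges) ∧ ¬ Covers c.arity S h ∧
      ∀ d ∈ D.edges, a ∈ d → ¬ Covers c.arity d h → d ⊆ S := by
  classical
  obtain ⟨S, hS, hmax⟩ := ((insert {a} D.edges).filter fun d =>
    a ∈ d ∧ ¬ Covers c.arity d h).exists_max_image Finset.card ⟨{a}, by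
      simp only [Finset.mem_filter, Finset.mem_insert, true_or, Finset.mem_singleton, true_and]
      rintro ⟨h1, h2⟩
      rw [Finset.mem_singleton] at h1 h2
      exact cpred_ne c.two_le_arity (h2.trans h1.symm)⟩
  simp only [Finset.mem_filter, Finset.mem_insert] at hS hmax
  refine ⟨S, hS.2.1, hS.1, hS.2.2, fun d hd had hdh => ?_⟩
  rcases hS.1 with h1 | h1
  · have := hmax d ⟨Or.inr hd, had, hdh⟩
    rw [← Finset.eq_of_subset_of_card_le (show S ⊆ d by rw [h1]; simpa using had) this]
  · rcases D.nested hd h1 had hS.2.1 with hs | hs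
    · exact hs
    · rw [← Finset.eq_of_subset_of_card_le hs (hmax d ⟨Or.inr hd, had, hdh⟩)]

/-- Every edge of a binary diagram can be exchanged. -/
theorem Resolves.exists_other {D B : Diagram c} {e : Block} (hN : D.edges.card + 3 = c.arity)
    (hB : Resolves D B e) : ∃ (B' : Diagram c) (e' : Block), Resolves D B' e' ∧ e ≠ e' := by
  obtain ⟨g, hg, hge⟩ := B.exists_label_eq hB.mem
  obtain ⟨h, hh, hhg, hl⟩ := hB.exists_other_gap hN hg hge
  have hml := c.mark_lt
  have hm1 := c.one_le_mark
  have hpN := cpred_lt hh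
  -- The gap `h` is the other one with the label of `g` in `D`. The two largest branches that meet
  -- at `h` without covering it are joined by the new edge `S ∪ S'`.
  obtain ⟨S, haS, hS, hSh, hSmax⟩ := D.exists_side h (cpred c.arity h)
  obtain ⟨S', haS', hS', hSh', hSmax'⟩ := D.exists_side h h
  have conn : ∀ {T a}, (T = {a} ∨ T ∈ D.edges) → IsConn c.arity T := by
    rintro T a (rfl | hT)
    · exact isConn_singleton _ _
    · exact (D.isBlock T hT).conn
  have sub : ∀ {T a}, a < c.arity → (T = {a} ∨ T ∈ D.edges) → T ⊆ Finset.range c.arity := by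
    rintro T a ha (rfl | hT)
    · simpa using ha
    · exact (D.isBlock T hT).subset
  have marks : ∀ {T a}, (T = {a} ∨ T ∈ D.edges) → ¬ (0 ∈ T ∧ c.mark ∈ T) := by
    rintro T a (rfl | hT)
    · rw [Finset.mem_singleton, Finset.mem_singleton]; omega
    · exact (D.isBlock T hT).not_marks
  -- Since `g` and `h` have the same label, an edge that covers `g` also covers `h`.
  have notg : ∀ {T a}, (T = {a} ∨ T ∈ D.edges) → ¬ Covers c.arity T h → ¬ Covers c.arity T g := by
    rintro T a hT hTh hTg
    rcases hT with rfl | hT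
    · have h1 := hTg.1
      have h2 := hTg.2
      rw [Finset.mem_singleton] at h1 h2
      exact cpred_ne c.two_le_arity (h2.trans h1.symm)
    · have h1 := Diagram.label_spec hT hTg
      have h2 := Diagram.label_of_mem (hl.symm ▸ h1.1 : D.label h ∈ D.edges)
      rw [hl] at h2
      have h3 := h1.2.2 T hT hTg
      exact hTh ⟨h3 h2.1.1, h3 h2.1.2⟩
  have inside : ∀ d ∈ D.edges, Covers c.arity d h → S ∪ S' ⊆ d := by
    intro d hd hdh
    refine Finset.union_subset ?_ ?_
    · rcases hS with rfl | hS
      · simpa using hdh.2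
      · rcases D.nested hd hS hdh.2 haS with hs | hs
        · exact absurd ⟨hs hdh.1, hs hdh.2⟩ hSh
        · exact hs
    · rcases hS' with rfl | hS'
      · simpa using hdh.1
      · rcases D.nested hd hS' hdh.1 haS' with hs | hs
        · exact absurd ⟨hs hdh.1, hs hdh.2⟩ hSh'
        · exact hs
  have compat : ∀ d ∈ D.edges, Compatible (S ∪ S') d := by
    intro d hd
    by_cases hdh : Covers c.arity d h
    · exact Or.inl (inside d hd hdh)
    have side : ∀ T a, a ∈ T → (T = {a} ∨ T ∈ D.edges) →
        (∀ d ∈ D.edges, a ∈ d → ¬ Covers c.arity d h → d ⊆ T) →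
        ∀ z ∈ d, z ∈ T → d ⊆ T := by
      intro T a haT hT hmax z hz hzT
      rcases hT with rfl | hT
      · rw [Finset.mem_singleton] at hzT
        subst hzT
        exact hmax d hd hz hdh
      · rcases D.nested hd hT hz hzT with hs | hs
        · exact hs
        · exact hmax d hd (hs haT) hdh
    by_cases hdis : Disjoint (S ∪ S') d
    · exact Or.inr (Or.inr hdis)
    · obtain ⟨z, hz, hzd⟩ := Finset.not_disjoint_iff.1 hdis
      rcases Finset.mem_union.1 hz with hz | hz
      · exact Or.inr (Or.inl ((side S _ haS hS hSmax z hzd hz).trans Finset.subset_union_left))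
      · exact Or.inr (Or.inl ((side S' _ haS' hS' hSmax' z hzd hz).trans
          Finset.subset_union_right))
  have cov : Covers c.arity (S ∪ S') h :=
    ⟨Finset.mem_union_right _ haS', Finset.mem_union_left _ haS⟩
  -- the two sides are separated by the two gaps
  have sep : ∃ lo hi, lo < hi ∧ hi < c.arity ∧ ((lo = g ∧ hi = h) ∨ (lo = h ∧ hi = g)) := by
    rcases lt_or_gt_of_ne hhg with hlt | hlt
    · exact ⟨h, g, hlt, hg, Or.inr ⟨rfl, rfl⟩⟩
    · exact ⟨g, h, hlt, hh, Or.inl ⟨rfl, rfl⟩⟩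
  obtain ⟨lo, hi, hlh, hhi, hgh⟩ := sep
  have dich : ∀ {T a}, (T = {a} ∨ T ∈ D.edges) → ¬ Covers c.arity T h → ∀ {x y}, x ∈ T → y ∈ T →
      ((lo ≤ x ∧ x < hi) ↔ (lo ≤ y ∧ y < hi)) := by
    intro T a hT hTh x y hx hy
    rcases hgh with ⟨rfl, rfl⟩ | ⟨rfl, rfl⟩
    · exact (conn hT).mem_Ico_iff hhi (notg hT hTh) hTh hx hy
    · exact (conn hT).mem_Ico_iff hhi hTh (notg hT hTh) hx hy
  have hsep : ¬ ((lo ≤ h ∧ h < hi) ↔ (lo ≤ cpred c.arity h ∧ cpred c.arity h < hi)) := by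
    unfold cpred
    split_ifs <;> omega
  -- If both marks were in the union, no edge could cover `h`, so `g` and `h` would be root gaps
  -- with the same tag. Then these gaps do not separate the two marks from each other. Yet one mark
  -- would be in `S` and the other in `S'`, which lie on different sides of the two gaps.
  have hmark : ¬ (0 ∈ S ∪ S' ∧ c.mark ∈ S ∪ S') := by
    rintro ⟨h0, hm⟩
    have hroot : ∀ d ∈ D.edges, ¬ Covers c.arity d h := fun d hd hdh =>
      (D.isBlock d hd).not_marks ⟨inside d hd hdh h0, inside d hd hdh hm⟩
    have hk : c.rootTag h = c.rootTag g := by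
      rcases D.label_cases g with h1 | h1
      · rw [← hl, Diagram.label_root hroot] at h1
        exact absurd h1.1 (Corolla.rootTag_notMem D h)
      · rw [← Diagram.label_root hroot, hl, h1.2]
    have hk' : (1 ≤ h ∧ h ≤ c.mark) ↔ (1 ≤ g ∧ g ≤ c.mark) := by
      unfold Corolla.rootTag at hk
      split_ifs at hk with h1 h2 h2
      · exact iff_of_true h1 h2
      · exact absurd hk (Finset.singleton_ne_empty 0).symm
      · exact absurd hk (Finset.singleton_ne_empty 0)
      · exact iff_of_false h1 h2
    have hI : (lo ≤ 0 ∧ 0 < hi) ↔ (lo ≤ c.mark ∧ c.mark < hi) := by omega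
    have m1 := marks hS
    have m2 := marks hS'
    rw [Finset.mem_union] at h0 hm
    rcases h0 with h0 | h0 <;> rcases hm with hm | hm
    · exact m1 ⟨h0, hm⟩
    · have e1 := dich hS hSh haS h0
      have e2 := dich hS' hSh' haS' hm
      exact hsep (e2.trans (hI.symm.trans e1.symm))
    · have e1 := dich hS hSh haS hm
      have e2 := dich hS' hSh' haS' h0
      exact hsep (e2.trans (hI.trans e1.symm))
    · exact m2 ⟨h0, hm⟩
  -- If the union were already an edge, it would be the label of `h` and hence of `g`. Then `S` and
  -- `S'` would meet at both gaps and cover the whole circle, including the two marks.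
  have hnot : S ∪ S' ∉ D.edges := by
    intro hmem
    have h1 := Diagram.label_spec hmem cov
    have hP : D.label h = S ∪ S' := (h1.2.2 _ hmem cov).antisymm (inside _ h1.1 h1.2.1)
    have hgP : Covers c.arity (S ∪ S') g := by
      have h2 := Diagram.label_of_mem (hl ▸ h1.1 : D.label g ∈ D.edges)
      rw [← hl, hP] at h2
      exact h2.1
    have hlo : Covers c.arity (S ∪ S') lo ∧ Covers c.arity (S ∪ S') hi := by
      rcases hgh with ⟨rfl, rfl⟩ | ⟨rfl, rfl⟩
      · exact ⟨hgP, cov⟩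
      · exact ⟨cov, hgP⟩
    obtain ⟨z, hzN, hz⟩ : ∃ z < c.arity, z ∉ S ∪ S' := by
      by_contra! hall
      exact hmark ⟨hall 0 (by omega), hall _ hml⟩
    have final : ∀ T T' : Block, ∀ a a', (T = {a} ∨ T ∈ D.edges) → (T' = {a'} ∨ T' ∈ D.edges) →
        ¬ Covers c.arity T h → ¬ Covers c.arity T' h → a ∈ T → a' ∈ T' → S ∪ S' = T ∪ T' →
        (lo ≤ a ∧ a < hi) → ¬ (lo ≤ a' ∧ a' < hi) → False := by
      intro T T' a a' hT hT' hTh hTh' ha ha' hTT hin hout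
      have hin' : ∀ x ∈ T, lo ≤ x ∧ x < hi := fun x hx => (dich hT hTh ha hx).1 hin
      have hout' : ∀ x ∈ T', ¬ (lo ≤ x ∧ x < hi) := fun x hx h' =>
        hout ((dich hT' hTh' ha' hx).2 h')
      rw [hTT] at hz hlo
      have r : ∀ x ∈ T ∪ T', (lo ≤ x ∧ x < hi) → x ∈ T := fun x hx h' =>
        (Finset.mem_union.1 hx).resolve_right fun hx' => hout' x hx' h'
      have r' : ∀ x ∈ T ∪ T', ¬ (lo ≤ x ∧ x < hi) → x ∈ T' := fun x hx h' =>
        (Finset.mem_union.1 hx).resolve_left fun hx' => h' (hin' x hx')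
      have hph : cpred c.arity hi = hi - 1 := by unfold cpred; rw [if_neg (by omega)]
      have := mem_of_two_gaps (conn hT) (conn hT') hlh hhi hzN hin' hout'
        (r _ hlo.1.1 (by omega)) (r _ (hph ▸ hlo.2.2) (by omega)) (r' _ hlo.2.1 (by omega))
        (r' _ hlo.1.2 (by unfold cpred; split_ifs <;> omega))
      exact hz (Finset.mem_union.2 this)
    by_cases hin : lo ≤ h ∧ h < hi
    · exact final S' S _ _ hS' hS hSh' hSh haS' haS (Finset.union_comm _ _) hin
        fun h' => hsep (iff_of_true hin h')
    · exact final S S' _ _ hS hS' hSh hSh' haS haS' rfl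
        (by_contra fun h' => hsep (iff_of_false hin h')) hin
  have hblock : c.IsBlock (S ∪ S') := Corolla.IsBlock.isBlock_union hh (sub hpN hS) (sub hh hS')
    (conn hS) (conn hS') haS haS' hmark
  refine ⟨D.insertEdge (S ∪ S') hblock compat, S ∪ S', ⟨hnot, rfl⟩, ?_⟩
  -- If the new edge were `e`, both `h` and `g` would have the label `e` in the binary diagram `B`.
  rintro rfl
  have hlB : B.label h = S ∪ S' := by
    refine Diagram.label_eq hB.mem cov fun b hb hbh => ?_
    rcases hB.mem_iff.1 hb with rfl | hb
    · exact subset_rfl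
    · exact inside b hb hbh
  exact hhg (hB.label_injOn hN (by simpa using hh) (by simpa using hg) (hlB.trans hge.symm))

/-- There are at most two resolutions. -/
theorem Resolves.eq_of_ne {D B B' B'' : Diagram c} {e e' e'' : Block}
    (hN : D.edges.card + 3 = c.arity) (h : Resolves D B e) (h' : Resolves D B' e')
    (h'' : Resolves D B'' e'') (hne : e ≠ e') (hne' : e ≠ e'') : e' = e'' := by
  by_contra hne2
  obtain ⟨g, hg, hge⟩ := B.exists_label_eq h.mem
  obtain ⟨g', hg', hge'⟩ := B'.exists_label_eq h'.mem
  obtain ⟨g'', hg'', hge''⟩ := B''.exists_label_eq h''.mem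
  have h1 := h.gap_ne hN h' hne hg hge hge'
  have h2 := h.gap_ne hN h'' hne' hg hge hge''
  have h3 := h'.gap_ne hN h'' hne2 hg' hge' hge''
  have l1 := h.label_gap_eq hN h' hne hg hg' hge hge'
  have l2 := h.label_gap_eq hN h'' hne' hg hg'' hge hge''
  exact h3 (h.eq_of_label_eq hN hg hge hg' h1.symm hg'' h2.symm (l1.symm.trans l2))

/-! ### All binary diagrams are connected by local moves -/

theorem isLocalMove_iff {B B' : BinaryDiagram c} {e e' : Block} : IsLocalMove B B' e e' ↔
    e ≠ e' ∧ Resolves (B.1.contract e) B.1 e ∧ Resolves (B.1.contract e) B'.1 e' := by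
  constructor
  · rintro ⟨h1, h2, h3, h4⟩
    have r := resolves_contract h2
    have r' : Resolves (B.1.contract e) B'.1 e' := h4 ▸ resolves_contract h3
    refine ⟨?_, r, r'⟩
    rintro rfl
    exact h1 (Subtype.ext (Diagram.ext (r.2.trans r'.2.symm)))
  · rintro ⟨h1, h2, h3⟩
    refine ⟨?_, h2.mem, h3.mem, h3.contract.symm⟩
    rintro rfl
    rcases h3.mem_iff.1 h2.mem with h | h
    · exact h1 h
    · exact h2.1 h

theorem BinaryDiagram.card (B : BinaryDiagram c) : B.1.edges.card + 2 = c.arity :=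
  B.1.degree_eq_zero_iff.1 B.2

theorem BinaryDiagram.card_contract (B : BinaryDiagram c) {e : Block} (he : e ∈ B.1.edges) :
    (B.1.contract e).edges.card + 3 = c.arity := by
  have := B.card
  rw [(resolves_contract he).card] at this
  omega

theorem BinaryDiagram.exists_localMove (B : BinaryDiagram c) {e : Block} (he : e ∈ B.1.edges) :
    ∃ B' e', IsLocalMove B B' e e' := by
  have hr := resolves_contract he
  obtain ⟨B', e', hB', hne⟩ := hr.exists_other (B.card_contract he)
  have hb : B'.degree = 0 := by
    rw [Diagram.degree_eq_zero_iff, hB'.card, ← B.card, hr.card]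
  exact ⟨⟨B', hb⟩, e', isLocalMove_iff.2 ⟨hne, hr, hB'⟩⟩

open Classical in
/-- A number that vanishes only for the right comb. -/
def BinaryDiagram.defect (B : BinaryDiagram c) : ℕ :=
  ∑ b ∈ B.1.edges, (2 * (if 0 ∈ b then 1 else 0) + if c.arity - 1 ∈ b then 0 else 1)

/-- Only the summand of the exchanged edge changes. The weight `2` makes losing the leaf `0`
outweigh a possible loss of the last leaf. -/
theorem IsLocalMove.defect_lt {B B' : BinaryDiagram c} {e e' : Block} (h : IsLocalMove B B' e e')
    (he : (0 ∈ e ∧ 0 ∉ e') ∨ ((0 ∈ e' → 0 ∈ e) ∧ c.arity - 1 ∉ e ∧ c.arity - 1 ∈ e')) :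
    B'.defect < B.defect := by
  obtain ⟨-, h1, h2⟩ := isLocalMove_iff.1 h
  unfold BinaryDiagram.defect
  rw [h1.2, h2.2, Finset.sum_insert h1.1, Finset.sum_insert h2.1]
  split_ifs <;> simp_all

theorem Diagram.exists_maximal (D : Diagram c) {p : Block → Prop} {b : Block} (hb : b ∈ D.edges)
    (hp : p b) : ∃ e ∈ D.edges, p e ∧ ∀ d ∈ D.edges, e ⊆ d → p d → d = e := by
  classical
  obtain ⟨e, he, hmax⟩ := (D.edges.filter p).exists_max_image Finset.card
    ⟨b, Finset.mem_filter.2 ⟨hb, hp⟩⟩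
  rw [Finset.mem_filter] at he
  exact ⟨e, he.1, he.2, fun d hd hed hpd =>
    (Finset.eq_of_subset_of_card_le hed (hmax d (Finset.mem_filter.2 ⟨hd, hpd⟩))).symm⟩

theorem mem_combWord {b : Block} : b ∈ combWord c ↔
    ∃ t, 1 ≤ t ∧ t + 2 ≤ c.arity ∧ b = Finset.Ico t c.arity := by
  unfold combWord
  simp only [List.mem_map, List.mem_range]
  constructor
  · rintro ⟨t, ht, rfl⟩
    exact ⟨t + 1, by omega, by omega, rfl⟩
  · rintro ⟨t, h1, h2, rfl⟩
    exact ⟨t - 1, by omega, by rw [Nat.sub_add_cancel h1]⟩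

theorem combWord_nodup : (combWord c).Nodup := by
  unfold combWord
  refine List.Nodup.map_on ?_ List.nodup_range
  intro x hx y hy h
  rw [List.mem_range] at hx hy
  have h1 := Finset.ext_iff.1 h (x + 1)
  have h2 := Finset.ext_iff.1 h (y + 1)
  simp only [Finset.mem_Ico] at h1 h2
  omega

theorem combWord_length : (combWord c).length = c.arity - 2 := by simp [combWord]

/-- Exchange an edge that is maximal among those containing `0` or, if there are none, among those
missing the last leaf. The union with the new edge is all leaves or a larger edge
(`Resolves.union_mem`), so maximality determines what the new edge contains. If no edge of either
type exists, all edges are final intervals. -/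
theorem BinaryDiagram.eq_comb_or (B : BinaryDiagram c) : B.1.edges = (combWord c).toFinset ∨
    ∃ B' e e', IsLocalMove B B' e e' ∧ B'.defect < B.defect := by
  have h2 := c.two_le_arity
  by_cases h0 : ∃ b ∈ B.1.edges, 0 ∈ b
  · right
    obtain ⟨b, hb, hb0⟩ := h0
    obtain ⟨e, he, he0, hmax⟩ := B.1.exists_maximal (p := fun b => 0 ∈ b) hb hb0
    obtain ⟨B', e', hm⟩ := B.exists_localMove he
    obtain ⟨hne, hr, hr'⟩ := isLocalMove_iff.1 hm
    refine ⟨B', e, e', hm, hm.defect_lt (Or.inl ⟨he0, ?_⟩)⟩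
    -- A union that is an edge would contradict maximality. If the union consists of all leaves, the
    -- mark must be in `e'`, since `e` contains `0`; thus `0` is not in `e'`.
    rcases hr.union_mem (B.card_contract he) hr' hne with hM | hM
    · have := hmax _ (hr.subset hM) Finset.subset_union_left (Finset.mem_union_left _ he0)
      rw [this] at hM
      exact absurd hM hr.1
    · have hmk := Finset.mem_range.2 c.mark_lt
      rw [← hM, Finset.mem_union] at hmk
      intro h0'
      rcases hmk with hmk | hmk
      · exact (B.1.isBlock e he).not_marks ⟨he0, hmk⟩
      · exact (B'.1.isBlock e' hr'.mem).not_marks ⟨h0', hmk⟩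
  · by_cases hl : ∃ b ∈ B.1.edges, c.arity - 1 ∉ b
    · right
      obtain ⟨b, hb, hbl⟩ := hl
      obtain ⟨e, he, hel, hmax⟩ := B.1.exists_maximal (p := fun b => c.arity - 1 ∉ b) hb hbl
      obtain ⟨B', e', hm⟩ := B.exists_localMove he
      obtain ⟨hne, hr, hr'⟩ := isLocalMove_iff.1 hm
      have hlM : c.arity - 1 ∈ e ∪ e' := by
        rcases hr.union_mem (B.card_contract he) hr' hne with hM | hM
        · by_contra hcon
          have := hmax _ (hr.subset hM) Finset.subset_union_left hcon
          rw [this] at hM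
          exact absurd hM hr.1
        · rw [hM, Finset.mem_range]; omega
      have hle' := (Finset.mem_union.1 hlM).resolve_left hel
      -- This case cannot occur: the gaps `0`, `1` and the right end `y` of `e` would all be root
      -- gaps, against the injectivity of the labels with only two root tags.
      by_cases h0' : 0 ∈ e'
      · exfalso
        have hM : e ∪ e' = Finset.range c.arity := by
          refine (hr.union_mem (B.card_contract he) hr' hne).resolve_left fun hM => ?_
          exact h0 ⟨_, hr.subset hM, Finset.mem_union_right _ h0'⟩
        have he0 : 0 ∉ e := fun h => h0 ⟨e, he, h⟩
        rcases Corolla.isBlock_iff_arc.1 (B.1.isBlock e he) with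
          ⟨x, y, h1, h3, h4, rfl⟩ | ⟨x, y, h1, -, -, -, -, rfl⟩
        · rw [Finset.mem_Ico] at hel
          have hp : cpred c.arity y = y - 1 := by rw [cpred, if_neg (by omega)]
          have hpe : y - 1 ∈ Finset.Ico x y := by rw [Finset.mem_Ico]; omega
          have hye : y ∉ Finset.Ico x y := by rw [Finset.mem_Ico]; omega
          have u0 : B.1.label 0 = {0} := by
            rw [Diagram.label_root fun b hb hbg => h0 ⟨b, hb, hbg.1⟩, Corolla.rootTag,
              if_neg (by omega)]
          have u1 : B.1.label 1 = ∅ := by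
            rw [Diagram.label_root fun b hb hbg => h0 ⟨b, hb, by simpa [cpred] using hbg.2⟩,
              Corolla.rootTag, if_pos ⟨le_rfl, c.one_le_mark⟩]
          have uy : B.1.label y = c.rootTag y := by
            refine Diagram.label_root fun d hd hdy => ?_
            rw [Covers, hp] at hdy
            rcases hr.mem_iff.1 hd with rfl | hdD
            · exact hye hdy.1
            · rcases hr.subset_or (B.card_contract he) hr' hne hdD hdy.2
                (Finset.mem_union_left _ hpe) with hs | hs | hs
              · exact hye (hs hdy.1)
              · rcases B.1.nested hd he hdy.2 hpe with ht | ht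
                · exact hye (ht hdy.1)
                · exact hr.not_compatible (B.card_contract he) hr' hne (Or.inl (ht.trans hs))
              · exact h0 ⟨d, hd, hs (Finset.mem_union_right _ h0')⟩
          have inj := B.1.label_injOn B.card
          rcases c.rootTag_eq y with q | q
          · have := inj (by simp; omega) (by simp; omega) (uy.trans (q.trans u1.symm))
            omega
          · have := inj (by simp; omega) (by simp; omega) (uy.trans (q.trans u0.symm))
            omega
        · exact he0 (Finset.mem_union_left _ (by rw [Finset.mem_Ico]; omega))
      · exact ⟨B', e, e', hm, hm.defect_lt (Or.inr ⟨fun h => absurd h h0', hel, hle'⟩)⟩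
    · left
      push Not at h0 hl
      -- An arc without `0` but with the last leaf is a final interval; a count of edges then gives
      -- equality.
      have hsub : B.1.edges ⊆ (combWord c).toFinset := by
        intro b hb
        have hb0 := h0 b hb
        have hbl := hl b hb
        rw [List.mem_toFinset, mem_combWord]
        rcases Corolla.isBlock_iff_arc.1 (B.1.isBlock b hb) with
          ⟨x, y, h1, h2, h3, rfl⟩ | ⟨x, y, h1, h2, h3, h4, h5, rfl⟩
        · rw [Finset.mem_Ico] at hbl
          obtain rfl : y = c.arity := by omega
          exact ⟨x, h1, h2, rfl⟩
        · simp only [Finset.mem_union, Finset.mem_Ico] at hb0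
          omega
      refine Finset.eq_of_subset_of_card_le hsub ?_
      rw [List.toFinset_card_of_nodup combWord_nodup, combWord_length]
      have := B.card
      omega

end
end Pairahedra

namespace Pairahedra
noncomputable section

/-! ## Signs in the exterior algebra -/

theorem edgeVec_mul_comm (e e' : Block) : edgeVec e * edgeVec e' = - (edgeVec e' * edgeVec e) := by
  rw [eq_neg_iff_add_eq_zero]
  exact ExteriorAlgebra.ι_add_mul_swap _ _

theorem edgeVec_mul_wedge (e : Block) (l : List Block) :
    edgeVec e * wedge l = (-1 : ℤ) ^ l.length • (wedge l * edgeVec e) := by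
  induction l with
  | nil => simp [wedge]
  | cons a l ih =>
    rw [wedge_cons, ← mul_assoc, edgeVec_mul_comm, neg_mul, mul_assoc, ih, mul_smul_comm,
      List.length_cons, pow_succ, mul_neg_one, neg_smul, mul_assoc]

theorem wedge_mul_comm (l l' : List Block) :
    wedge l * wedge l' = (-1 : ℤ) ^ (l.length * l'.length) • (wedge l' * wedge l) := by
  induction l with
  | nil => simp [wedge]
  | cons a l ih =>
    rw [wedge_cons, mul_assoc, ih, mul_smul_comm, ← mul_assoc, edgeVec_mul_wedge, smul_mul_assoc,
      smul_smul, ← pow_add, mul_assoc, List.length_cons, add_mul, one_mul]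

/-- The wedge of a list is a value of the alternating map `ExteriorAlgebra.ιMulti`. -/
theorem wedge_ofFn_perm {n : ℕ} (f : Fin n → Block) (σ : Equiv.Perm (Fin n)) :
    wedge (List.ofFn (f ∘ σ)) = (Equiv.Perm.sign σ : ℤ) • wedge (List.ofFn f) := by
  have h : ∀ f : Fin n → Block, wedge (List.ofFn f) =
      ExteriorAlgebra.ιMulti ℤ n (fun i => Finsupp.single (f i) (1 : ℤ)) := by
    intro f
    rw [ExteriorAlgebra.ιMulti_apply, wedge, List.map_ofFn]
    rfl
  rw [h, h]
  exact ((ExteriorAlgebra.ιMulti ℤ n).map_perm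
    (fun i => Finsupp.single (f i) (1 : ℤ)) σ).trans (Units.smul_def _ _)

theorem wedge_perm {l l' : List Block} (h : l.Perm l') :
    wedge l' = wedge l ∨ wedge l' = - wedge l := by
  induction h with
  | nil => exact Or.inl rfl
  | cons a _ ih =>
    rw [wedge_cons, wedge_cons]
    rcases ih with h | h <;> simp [h]
  | swap a b l =>
    right
    rw [wedge_cons, wedge_cons, wedge_cons, wedge_cons, ← mul_assoc, edgeVec_mul_comm, neg_mul,
      mul_assoc]
  | trans _ _ ih1 ih2 => rcases ih1 with h | h <;> rcases ih2 with h' | h' <;> simp [h, h']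

/-- Removing the factors one by one reduces this to `1 ≠ -1` in `ℤ`. It allows signs to be read off
from orientations. -/
theorem wedge_ne_neg {l : List Block} (h : l.Nodup) : wedge l ≠ - wedge l := by
  induction l with
  | nil =>
    intro he
    have := congrArg ExteriorAlgebra.algebraMapInv he
    rw [wedge, List.map_nil, List.prod_nil, map_neg, map_one] at this
    norm_num at this
  | cons a l ih =>
    intro he
    rw [List.nodup_cons] at h
    have := congrArg (remove a) he
    rw [map_neg, wedge_cons, remove_edgeVec_mul, if_pos rfl, remove_wedge_of_notMem h.1,
      mul_zero, sub_zero] at this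
    exact ih h.2 this

theorem IsOrientation.eq_or {S : Finset Block} {ω ω' : Ext} (h : IsOrientation S ω)
    (h' : IsOrientation S ω') : ω' = ω ∨ ω' = - ω := by
  obtain ⟨l, h1, h2, h3⟩ := h
  obtain ⟨l', h1', h2', h3'⟩ := h'
  have hp := wedge_perm (List.perm_of_nodup_nodup_toFinset_eq h1 h1' (h2.trans h2'.symm))
  rcases h3 with rfl | rfl <;> rcases h3' with rfl | rfl <;> rcases hp with hp | hp <;> simp [hp]

theorem isOrientation_wedge {S : Finset Block} {l : List Block} (h : l.Nodup)
    (hS : l.toFinset = S) : IsOrientation S (wedge l) := ⟨l, h, hS, Or.inl rfl⟩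

/-! ### Naturality of removing and renaming edges -/

/-- The span of the wedge products of elements of a set of edges. -/
def wedgeSpan (S : Set Block) : Submodule ℤ Ext :=
  Submodule.span ℤ {ω | ∃ l : List Block, (∀ x ∈ l, x ∈ S) ∧ ω = wedge l}

theorem wedge_mem_wedgeSpan {S : Set Block} {l : List Block} (h : ∀ x ∈ l, x ∈ S) :
    wedge l ∈ wedgeSpan S := Submodule.subset_span ⟨l, h, rfl⟩

/-- Reduces identities between linear operations on orientations to multiplication by a single edge.
A span is used because, unlike the set of monomials, it is stable under `remove`, which may give
zero. -/
theorem wedgeSpan_induction {S : Set Block} {p : Ext → Prop} {ω : Ext} (hω : ω ∈ wedgeSpan S)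
    (h1 : p 1) (hmul : ∀ e ∈ S, ∀ ω ∈ wedgeSpan S, p ω → p (edgeVec e * ω))
    (hadd : ∀ ω ω', p ω → p ω' → p (ω + ω')) (hsmul : ∀ (n : ℤ) ω, p ω → p (n • ω)) : p ω := by
  induction hω using Submodule.span_induction with
  | mem ω h =>
    obtain ⟨l, hl, rfl⟩ := h
    induction l with
    | nil => simpa [wedge] using h1
    | cons a l ih =>
      rw [wedge_cons]
      have hl' : ∀ x ∈ l, x ∈ S := fun x hx => hl x (List.mem_cons_of_mem _ hx)
      exact hmul a (hl a List.mem_cons_self) _ (wedge_mem_wedgeSpan hl') (ih hl')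
  | zero => simpa using hsmul 0 1 h1
  | add ω ω' _ _ h h' => exact hadd ω ω' h h'
  | smul n ω _ h => exact hsmul n ω h

theorem edgeVec_mul_mem_wedgeSpan {S : Set Block} {e : Block} (he : e ∈ S) {ω : Ext}
    (hω : ω ∈ wedgeSpan S) : edgeVec e * ω ∈ wedgeSpan S := by
  induction hω using Submodule.span_induction with
  | mem ω h =>
    obtain ⟨l, hl, rfl⟩ := h
    rw [← wedge_cons]
    exact wedge_mem_wedgeSpan (by simpa [he] using hl)
  | zero => simp
  | add ω ω' _ _ h h' => rw [mul_add]; exact add_mem h h'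
  | smul n ω _ h => rw [mul_smul_comm]; exact Submodule.smul_mem _ n h

theorem remove_one (e : Block) : remove e 1 = 0 := CliffordAlgebra.contractLeft_one _ _

theorem remove_mem_wedgeSpan {S : Set Block} (e : Block) {ω : Ext} (hω : ω ∈ wedgeSpan S) :
    remove e ω ∈ wedgeSpan S := by
  refine wedgeSpan_induction (p := fun ω => remove e ω ∈ wedgeSpan S) hω ?_ ?_ ?_ ?_
  · rw [remove_one]; exact zero_mem _
  · intro a ha ω hω h
    rw [remove_edgeVec_mul]
    refine sub_mem ?_ (edgeVec_mul_mem_wedgeSpan ha h)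
    split_ifs
    · exact hω
    · exact zero_mem _
  · intro ω ω' h h'
    rw [map_add]; exact add_mem h h'
  · intro n ω h
    rw [map_smul]; exact Submodule.smul_mem _ n h

theorem IsOrientation.mem_wedgeSpan {S : Finset Block} {ω : Ext} (h : IsOrientation S ω) :
    ω ∈ wedgeSpan S := by
  obtain ⟨l, h1, rfl, rfl | rfl⟩ := h
  · exact wedge_mem_wedgeSpan (by simp)
  · exact neg_mem (wedge_mem_wedgeSpan (by simp))

theorem relabel_edgeVec (φ : Block → Block) (e : Block) :
    relabel φ (edgeVec e) = edgeVec (φ e) := by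
  simp [relabel, edgeVec, Finsupp.mapDomain_single]

/-- It suffices that no other edge of `S` is renamed to `φ e`; the remaining edges may even be
identified with each other, because both sides are computed factor by factor. -/
theorem relabel_remove {S : Set Block} {φ : Block → Block} {e : Block}
    (hφ : ∀ x ∈ S, φ x = φ e → x = e) {ω : Ext} (hω : ω ∈ wedgeSpan S) :
    remove (φ e) (relabel φ ω) = relabel φ (remove e ω) := by
  refine wedgeSpan_induction (p := fun ω => remove (φ e) (relabel φ ω) = relabel φ (remove e ω))
    hω ?_ ?_ ?_ ?_
  · rw [map_one, remove_one, remove_one, map_zero]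
  · intro a ha ω _ h
    rw [map_mul, relabel_edgeVec, remove_edgeVec_mul, remove_edgeVec_mul, map_sub, map_mul,
      relabel_edgeVec, h]
    congr 1
    by_cases hae : a = e
    · rw [if_pos hae, if_pos (congrArg φ hae)]
    · rw [if_neg hae, if_neg fun h => hae (hφ a ha h), map_zero]
  · intro ω ω' h h'
    rw [map_add, map_add, h, h', map_add, map_add]
  · intro n ω h
    rw [map_smul, map_smul, h, map_smul, map_smul]

theorem relabel_congr {S : Set Block} {φ ψ : Block → Block} (h : ∀ x ∈ S, φ x = ψ x) {ω : Ext}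
    (hω : ω ∈ wedgeSpan S) : relabel φ ω = relabel ψ ω := by
  refine wedgeSpan_induction (p := fun ω => relabel φ ω = relabel ψ ω) hω ?_ ?_ ?_ ?_
  · rw [map_one, map_one]
  · intro a ha ω _ ih
    rw [map_mul, map_mul, relabel_edgeVec, relabel_edgeVec, h a ha, ih]
  · intro ω ω' h h'
    rw [map_add, map_add, h, h']
  · intro n ω h
    rw [map_smul, map_smul, h]

theorem relabel_id {ω : Ext} : relabel id ω = ω := by
  simp [relabel]

theorem relabel_eq_self {S : Set Block} {φ : Block → Block} (h : ∀ x ∈ S, φ x = x) {ω : Ext}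
    (hω : ω ∈ wedgeSpan S) : relabel φ ω = ω :=
  (relabel_congr (ψ := id) h hω).trans relabel_id

theorem remove_eq_zero {S : Set Block} {e : Block} (he : e ∉ S) {ω : Ext}
    (hω : ω ∈ wedgeSpan S) : remove e ω = 0 := by
  refine wedgeSpan_induction (p := fun ω => remove e ω = 0) hω (remove_one e) ?_ ?_ ?_
  · intro a ha ω _ h
    rw [remove_edgeVec_mul, h, mul_zero, sub_zero, if_neg]
    rintro rfl
    exact he ha
  · intro ω ω' h h'
    rw [map_add, h, h', add_zero]
  · intro n ω h
    rw [map_smul, h, smul_zero]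

/-! ## Standard orientations -/

variable {c : Corolla}

/-- The vertices of a diagram in the order of the gaps. -/
def Diagram.labelList (D : Diagram c) : List Block := (List.range c.arity).map D.label

theorem Diagram.labelList_toFinset (D : Diagram c) : D.labelList.toFinset = D.tags := by
  rw [← D.image_label, Diagram.labelList]
  ext b
  simp

theorem BinaryDiagram.labelList_nodup (B : BinaryDiagram c) : B.1.labelList.Nodup := by
  refine List.Nodup.map_on ?_ List.nodup_range
  intro x hx y hy h
  rw [List.mem_range] at hx hy
  exact B.1.label_injOn B.card (by simpa using hx) (by simpa using hy) h

theorem Diagram.tags_erase (D : Diagram c) : (D.tags.erase {0}).erase ∅ = D.edges := by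
  ext b
  simp only [Diagram.tags, Finset.mem_erase, Finset.mem_insert]
  constructor
  · tauto
  · intro hb
    exact ⟨(D.isBlock b hb).ne_empty, (D.isBlock b hb).ne_singleton 0, Or.inr (Or.inr hb)⟩

theorem BinaryDiagram.isOrientation_std (B : BinaryDiagram c) :
    IsOrientation B.1.edges (remove ∅ (remove {0} (wedge B.1.labelList))) := by
  have h := isOrientation_wedge B.labelList_nodup B.1.labelList_toFinset
  have h1 := h.remove (e := {0}) (by simp [Diagram.tags])
  have h2 := h1.remove (e := ∅) (by simp [Diagram.tags])
  rwa [B.1.tags_erase] at h2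

/-- The standard orientation: list the vertices of the diagram in the order of the gaps between
the leaves, and remove the tags of the root vertex. -/
def stdOrientation (c : Corolla) (B : BinaryDiagram c) : Orientation B.1.edges :=
  ⟨remove ∅ (remove {0} (wedge B.1.labelList)), B.isOrientation_std⟩

theorem Diagram.wedge_labelList_mem (D : Diagram c) :
    wedge D.labelList ∈ wedgeSpan (D.tags : Set Block) :=
  wedge_mem_wedgeSpan fun x hx => by
    rw [Finset.mem_coe, ← D.labelList_toFinset]
    exact List.mem_toFinset.2 hx

/-- Let `P` be the common label of `g` and `g'` in the contracted diagram. In `B` these gaps have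
the labels `e` and `P`, in `B'` the labels `P` and `e'`, and all other labels agree. After renaming
`e` to `e'`, the lists differ by one transposition. -/
theorem IsLocalMove.wedge_labelList {B B' : BinaryDiagram c} {e e' : Block}
    (h : IsLocalMove B B' e e') :
    wedge B'.1.labelList = - relabel (Function.update id e e') (wedge B.1.labelList) := by
  obtain ⟨hne, hr, hr'⟩ := isLocalMove_iff.1 h
  have hN := B.card_contract hr.mem
  obtain ⟨g, hg, hge⟩ := B.1.exists_label_eq hr.mem
  obtain ⟨g', hg', hge'⟩ := B'.1.exists_label_eq hr'.mem
  have hgg := hr.gap_ne hN hr' hne hg hge hge'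
  have hl := hr.label_gap_eq hN hr' hne hg hg' hge hge'
  have hD : ∀ x, (B.1.contract e).label x ≠ e := by
    intro x hx
    rcases (B.1.contract e).label_cases x with h1 | h1
    · rw [hx] at h1
      exact hr.1 h1.1
    · have := Corolla.rootTag_notMem B.1 x
      rw [← h1.2, hx] at this
      exact this hr.mem
  have hlist : ∀ D : Diagram c, D.labelList = List.ofFn fun i : Fin c.arity => D.label i := by
    intro D
    rw [Diagram.labelList, List.ofFn_eq_map, ← List.map_coe_finRange_eq_range, List.map_map]
    rfl
  have key : (fun i : Fin c.arity => B'.1.label i) =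
      (fun i : Fin c.arity => Function.update id e e' (B.1.label i)) ∘
        Equiv.swap ⟨g, hg⟩ ⟨g', hg'⟩ := by
    funext x
    rw [Function.comp_apply]
    by_cases hx : x = ⟨g, hg⟩
    · subst hx
      rw [Equiv.swap_apply_left]
      dsimp only
      rw [hr'.label_eq_of_ne hN hg' hge' hg hgg, hr.label_eq_of_ne hN hg hge hg' hgg.symm,
        Function.update_of_ne (hD _), hl]
      rfl
    · by_cases hx' : x = ⟨g', hg'⟩
      · subst hx'
        rw [Equiv.swap_apply_right]
        dsimp only
        rw [hge, hge', Function.update_self]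
      · rw [Equiv.swap_apply_of_ne_of_ne hx hx']
        have h1 : (x : ℕ) ≠ g := fun h => hx (Fin.ext h)
        have h2 : (x : ℕ) ≠ g' := fun h => hx' (Fin.ext h)
        rw [hr'.label_eq_of_ne hN hg' hge' x.2 h2, hr.label_eq_of_ne hN hg hge x.2 h1,
          Function.update_of_ne (hD _)]
        rfl
  rw [hlist, hlist, key, wedge_ofFn_perm, Equiv.Perm.sign_swap (fun h => hgg (congrArg Fin.val h)),
    relabel_wedge, List.map_ofFn]
  simp only [Units.val_neg, Units.val_one, neg_smul, one_smul]
  rfl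

/-- For the right comb the labels are `{0}`, `∅`, followed by the edges in order, so the tags are
struck out from the front without a sign. Local moves rename only `e`, which is no tag, so striking
out commutes with the renaming. -/
theorem isStandard_stdOrientation : IsStandard stdOrientation where
  comb c B hB := by
    have h2 := c.two_le_arity
    have hl : B.1.labelList = {0} :: ∅ :: combWord c := by
      refine List.ext_getElem ?_ ?_
      · simp [Diagram.labelList, combWord]; omega
      · intro i h1 h2
        simp only [Diagram.labelList, List.getElem_map, List.getElem_range]
        have no : ∀ x, x ≤ 1 → B.1.label x = c.rootTag x := by
          intro x hx
          refine Diagram.label_root fun b hb hbx => ?_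
          rw [hB, List.mem_toFinset, mem_combWord] at hb
          obtain ⟨t, ht1, ht2, rfl⟩ := hb
          obtain ⟨h1, h2⟩ := hbx
          unfold cpred at h2
          rw [Finset.mem_Ico] at h1 h2
          split_ifs at h2 <;> omega
        match i, h1, h2 with
        | 0, _, _ =>
          rw [no 0 (by omega), Corolla.rootTag, if_neg (by omega)]
          rfl
        | 1, _, _ =>
          rw [no 1 le_rfl, Corolla.rootTag, if_pos ⟨le_rfl, c.one_le_mark⟩]
          rfl
        | i + 2, h1, h2 =>
          have hi : i < c.arity - 2 := by
            simpa [combWord] using h2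
          simp only [List.getElem_cons_succ]
          have : (combWord c)[i]'(by simpa [combWord] using h2) = Finset.Ico (i + 1) c.arity := by
            simp [combWord]
          rw [this]
          refine Diagram.label_eq ?_ ?_ ?_
          · rw [hB, List.mem_toFinset, mem_combWord]
            exact ⟨i + 1, by omega, by omega, rfl⟩
          · unfold Covers cpred
            rw [Finset.mem_Ico, Finset.mem_Ico]
            split_ifs <;> omega
          · intro b hb hbx
            rw [hB, List.mem_toFinset, mem_combWord] at hb
            obtain ⟨t, ht1, ht2, rfl⟩ := hb
            have h1 := hbx.2
            unfold cpred at h1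
            rw [if_neg (by omega), Finset.mem_Ico] at h1
            exact Finset.Ico_subset_Ico_left (by omega)
    have hnd := B.labelList_nodup
    change remove ∅ (remove {0} (wedge B.1.labelList)) = _
    rw [hl] at hnd ⊢
    rw [List.nodup_cons, List.nodup_cons] at hnd
    rw [wedge_cons, remove_edgeVec_mul, if_pos rfl, remove_wedge_of_notMem hnd.1, mul_zero,
      sub_zero, wedge_cons, remove_edgeVec_mul, if_pos rfl, remove_wedge_of_notMem hnd.2.1,
      mul_zero, sub_zero]
  move c B B' e e' h := by
    obtain ⟨hne, hr, hr'⟩ := isLocalMove_iff.1 h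
    have hb := B.1.isBlock e hr.mem
    have hb' := B'.1.isBlock e' hr'.mem
    have he : Function.update id e e' ∅ = (∅ : Block) :=
      Function.update_of_ne hb.ne_empty.symm _ _
    have h0 : Function.update id e e' {0} = ({0} : Block) :=
      Function.update_of_ne (hb.ne_singleton 0).symm _ _
    have inj : ∀ a : Block, a ≠ e → a ≠ e' → ∀ x ∈ (B.1.tags : Set Block),
        Function.update id e e' x = Function.update id e e' a → x = a := by
      intro a ha ha' x _ hx
      rw [Function.update_of_ne ha] at hx
      by_cases hxe : x = e
      · subst hxe
        rw [Function.update_self] at hx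
        exact absurd hx.symm ha'
      · rwa [Function.update_of_ne hxe] at hx
    have hm := B.1.wedge_labelList_mem
    change remove ∅ (remove {0} (wedge B'.1.labelList)) =
      - relabel _ (remove ∅ (remove {0} (wedge B.1.labelList)))
    have r1 := relabel_remove (inj {0} (hb.ne_singleton 0).symm (hb'.ne_singleton 0).symm) hm
    have r2 := relabel_remove (inj ∅ hb.ne_empty.symm hb'.ne_empty.symm)
      (remove_mem_wedgeSpan {0} hm)
    rw [h0] at r1
    rw [he] at r2
    rw [h.wedge_labelList, map_neg, map_neg, r1, r2]

theorem IsLocalMove.symm {B B' : BinaryDiagram c} {e e' : Block} (h : IsLocalMove B B' e e') :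
    IsLocalMove B' B e' e := ⟨h.1.symm, h.2.2.1, h.2.1, h.2.2.2.symm⟩

/-- Descent along local moves that lower the defect: each one determines the orientation of `B` from
that of `B'`, and the descent ends at the right comb. -/
theorem IsStandard.unique {s s' : ∀ (c : Corolla) (B : BinaryDiagram c), Orientation B.1.edges}
    (h : IsStandard s) (h' : IsStandard s') : s = s' := by
  funext c B
  induction hn : B.defect using Nat.strong_induction_on generalizing B with
  | _ n ih =>
    apply Subtype.ext
    rcases B.eq_comb_or with hB | ⟨B', e, e', hm, hd⟩
    · rw [h.comb c B hB, h'.comb c B hB]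
    · rw [h.move c B' B e' e hm.symm, h'.move c B' B e' e hm.symm,
        ih _ (hn ▸ hd) B' rfl]

end
end Pairahedra

namespace Pairahedra
noncomputable section

/-! ## Grafting and gaps -/

variable {c d : Corolla} {p : ℕ}

/-- What matters is the place of the grafted leaf relative to the marked leaves: strictly between
`0` and the mark, beyond the mark, at the mark, or at `0`. Only in the last case may the numbering
rotate. These numerical facts are all that the later arguments need about the new mark. -/
theorem CanGraft.cases (h : CanGraft c d p) :
    (graftShift c d p = 0 ∧ 1 ≤ p ∧ p < c.mark ∧
      (graftCorolla c d p).mark = c.mark + d.arity - 1) ∨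
    (graftShift c d p = 0 ∧ c.mark < p ∧ (graftCorolla c d p).mark = c.mark) ∨
    (graftShift c d p = 0 ∧ p = c.mark ∧ (graftCorolla c d p).mark + 1 ≤ p + d.arity ∧
      p ≤ (graftCorolla c d p).mark) ∨
    (p = 0 ∧ (graftCorolla c d p).mark + graftShift c d p + 1 = c.mark + d.arity) := by
  have h1 := h.1
  rcases h.tree_or with ⟨⟨n, hn, rfl⟩, h2⟩ | ⟨⟨j', k', hjk', rfl⟩, h2⟩
  · cases c with
    | T m hm =>
      simp only [graftShift, graftCorolla, Corolla.mark, Corolla.arity, true_and] at h1 ⊢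
      omega
    | M j k hjk =>
      simp only [graftShift, graftCorolla, Corolla.arity, true_and] at h1 ⊢
      split_ifs <;> simp only [Corolla.mark] <;> omega
    | I j k =>
      simp only [Corolla.leafColor] at h2
      have hp : p ≠ 0 ∧ p ≠ j + 1 := by
        constructor
        · rintro rfl; simp at h2
        · rintro rfl; simp at h2
      simp only [graftShift, graftCorolla, Corolla.arity, true_and] at h1 ⊢
      split_ifs <;> simp only [Corolla.mark, and_true] <;> omega
  · cases c with
    | T m hm => exact absurd h2 (by simp [Corolla.leafColor])
    | M j k hjk =>
      have hp : p = j := by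
        by_contra hne
        simp [Corolla.leafColor, hne] at h2
      simp only [graftShift, graftCorolla, Corolla.arity, Corolla.mark, true_and] at h1 ⊢
      omega
    | I j k =>
      have hp : p = 0 ∨ p = j + 1 := by
        by_contra hne
        simp [Corolla.leafColor, hne] at h2
      simp only [graftShift, graftCorolla, Corolla.arity] at h1 ⊢
      split_ifs <;> simp only [Corolla.mark, true_and] <;> omega

/-- Together with `CanGraft.leafBelow_mark`: collapsing the attached tree to a leaf preserves both
marked leaves, so the condition on marks can be transferred to the host. -/
theorem CanGraft.leafBelow_zero (h : CanGraft c d p) : leafBelow c d p 0 = 0 := by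
  have := @graftShift_lt c d p
  have := c.two_le_arity
  have := d.two_le_arity
  have := c.mark_lt
  have := c.one_le_mark
  have := h.1
  unfold leafBelow seqPos graftArity
  rcases h.cases with h | h | h | h <;> split_ifs <;> omega

theorem CanGraft.leafBelow_mark (h : CanGraft c d p) :
    leafBelow c d p (graftCorolla c d p).mark = c.mark := by
  have := @graftShift_lt c d p
  have := c.two_le_arity
  have := d.two_le_arity
  have := c.mark_lt
  have := c.one_le_mark
  have := h.1
  have := (graftCorolla c d p).mark_lt
  rw [h.arity_graftCorolla] at this
  unfold graftArity at this
  unfold leafBelow seqPos graftArity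
  rcases h.cases with h | h | h | h <;> split_ifs <;> omega

/-- The passage from canonical numbers to positions is a rotation of the circle, so it preserves
neighbours. -/
theorem seqPos_cpred {x : ℕ} (hx : x < graftArity c d) :
    seqPos c d p (cpred (graftArity c d) x) = cpred (graftArity c d) (seqPos c d p x) := by
  have := @graftShift_lt c d p
  have := c.two_le_arity
  have := d.two_le_arity
  have key : ∀ s N : ℕ, s < N → x < N →
      (if cpred N x + s < N then cpred N x + s else cpred N x + s - N) =
        cpred N (if x + s < N then x + s else x + s - N) := by
    intro s N hs hx
    unfold cpred
    by_cases h1 : x + s < N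
    · simp only [if_pos h1]
      split_ifs <;> omega
    · simp only [if_neg h1]
      split_ifs <;> omega
  exact key _ _ (by unfold graftArity; omega) hx

/-- The gap inside of the attached diagram at position `u` of the sequence of leaves. -/
def IsGuestGap (d : Corolla) (p u : ℕ) : Prop := p < u ∧ u < p + d.arity

/-- The gap of the host at position `u` of the sequence of leaves. -/
def hostGap (d : Corolla) (p u : ℕ) : ℕ := if u ≤ p then u else u + 1 - d.arity

theorem leafBelow_guestGap {x : ℕ} (hx : x < graftArity c d)
    (hg : IsGuestGap d p (seqPos c d p x)) :
    leafBelow c d p x = p ∧ leafBelow c d p (cpred (graftArity c d) x) = p ∧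
      seqPos c d p (cpred (graftArity c d) x) = seqPos c d p x - 1 := by
  have := seqPos_lt (p := p) hx
  obtain ⟨h1, h2⟩ := hg
  have e : seqPos c d p (cpred (graftArity c d) x) = seqPos c d p x - 1 := by
    rw [seqPos_cpred hx, cpred, if_neg (by omega)]
  refine ⟨?_, ?_, e⟩
  · unfold leafBelow
    rw [if_neg (by omega), if_pos h2]
  · unfold leafBelow
    rw [e, if_neg (by omega), if_pos (by omega)]

/-- Outside of the attached tree, neighbouring leaves collapse to neighbouring leaves of the host,
so these gaps are the gaps of the host. -/
theorem CanGraft.leafBelow_hostGap (h : CanGraft c d p) {x : ℕ} (hx : x < graftArity c d)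
    (hg : ¬ IsGuestGap d p (seqPos c d p x)) :
    leafBelow c d p x = hostGap d p (seqPos c d p x) ∧
      leafBelow c d p (cpred (graftArity c d) x) =
        cpred c.arity (hostGap d p (seqPos c d p x)) := by
  have h1 := seqPos_lt (p := p) hx
  have h2 := d.two_le_arity
  have h3 := c.two_le_arity
  have h4 := h.1
  have key : ∀ k l u : ℕ, 2 ≤ k → 2 ≤ l → p < k → u < k + l - 1 → ¬ (p < u ∧ u < p + l) →
      (if u < p then u else if u < p + l then p else u + 1 - l) =
        (if u ≤ p then u else u + 1 - l) ∧
      (if cpred (k + l - 1) u < p then cpred (k + l - 1) u else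
        if cpred (k + l - 1) u < p + l then p else cpred (k + l - 1) u + 1 - l) =
        cpred k (if u ≤ p then u else u + 1 - l) := by
    intro k l u hk hl hp hu hg
    unfold cpred
    refine ⟨by split_ifs <;> omega, ?_⟩
    by_cases hup : u ≤ p
    · simp only [if_pos hup]
      split_ifs <;> omega
    · simp only [if_neg hup]
      split_ifs <;> omega
  have := key c.arity d.arity (seqPos c d p x) h3 h2 h4 h1 hg
  refine ⟨this.1, ?_⟩
  unfold leafBelow
  rw [seqPos_cpred hx]
  exact this.2

theorem CanGraft.hostGap_lt (h : CanGraft c d p) {x : ℕ} (hx : x < graftArity c d) :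
    hostGap d p (seqPos c d p x) < c.arity := by
  have h1 := seqPos_lt (p := p) hx
  have h4 := h.1
  have := d.two_le_arity
  unfold graftArity at h1
  unfold hostGap
  split_ifs <;> omega

theorem covers_hostBlock_of_guestGap {x : ℕ}
    (hx : x < graftArity c d) (hg : IsGuestGap d p (seqPos c d p x)) (b : Block) :
    Covers (graftArity c d) (hostBlock c d p b) x ↔ p ∈ b := by
  obtain ⟨e1, e2, -⟩ := leafBelow_guestGap hx hg
  rw [Covers, mem_hostBlock, mem_hostBlock, e1, e2]
  exact ⟨fun h => h.1.2, fun h => ⟨⟨hx, h⟩, cpred_lt hx, h⟩⟩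

theorem CanGraft.covers_hostBlock_of_hostGap (h : CanGraft c d p) {x : ℕ}
    (hx : x < graftArity c d) (hg : ¬ IsGuestGap d p (seqPos c d p x)) (b : Block) :
    Covers (graftArity c d) (hostBlock c d p b) x ↔
      Covers c.arity b (hostGap d p (seqPos c d p x)) := by
  obtain ⟨e1, e2⟩ := h.leafBelow_hostGap hx hg
  rw [Covers, mem_hostBlock, mem_hostBlock, e1, e2]
  exact ⟨fun h => ⟨h.1.2, h.2.2⟩, fun h => ⟨⟨hx, h.1⟩, cpred_lt hx, h.2⟩⟩

theorem CanGraft.covers_guestBlock (h : CanGraft c d p) {x : ℕ} (hx : x < graftArity c d)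
    {b : Block} (hb : b ⊆ Finset.range d.arity) :
    Covers (graftArity c d) (guestBlock c d p b) x ↔
      IsGuestGap d p (seqPos c d p x) ∧ Covers d.arity b (seqPos c d p x - p) := by
  have h2 := d.two_le_arity
  have h3 := c.two_le_arity
  have hu := seqPos_lt (p := p) hx
  have h4 := h.1
  rw [Covers, mem_guestBlock, mem_guestBlock]
  constructor
  · rintro ⟨⟨-, h5, h6⟩, -, h7, h8⟩
    have l6 := Finset.mem_range.1 (hb h6)
    have l8 := Finset.mem_range.1 (hb h8)
    have hg : IsGuestGap d p (seqPos c d p x) := by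
      rw [seqPos_cpred hx] at h7 l8
      unfold graftArity cpred at *
      unfold IsGuestGap
      split_ifs at h7 l8 <;> omega
    refine ⟨hg, h6, ?_⟩
    rw [(leafBelow_guestGap hx hg).2.2] at h8
    rw [cpred, if_neg (by have := hg.1; omega)]
    rwa [show seqPos c d p x - p - 1 = seqPos c d p x - 1 - p by omega]
  · rintro ⟨hg, h6, h8⟩
    have := hg.1
    refine ⟨⟨hx, by omega, h6⟩, cpred_lt hx, ?_⟩
    rw [(leafBelow_guestGap hx hg).2.2]
    rw [cpred, if_neg (by omega)] at h8
    exact ⟨by omega, by rwa [show seqPos c d p x - 1 - p = seqPos c d p x - p - 1 by omega]⟩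

/-- The tag of a root gap depends only on its side relative to the two marked leaves, and each of
the four cases of `CanGraft.cases` preserves the sides. -/
theorem CanGraft.rootTag_hostGap (h : CanGraft c d p) {x : ℕ} (hx : x < graftArity c d)
    (hg : ¬ IsGuestGap d p (seqPos c d p x)) :
    (graftCorolla c d p).rootTag x = c.rootTag (hostGap d p (seqPos c d p x)) := by
  have h0 := @graftShift_lt c d p
  have h1 := c.two_le_arity
  have h2 := d.two_le_arity
  have h3 := c.mark_lt
  have h4 := c.one_le_mark
  have h5 := h.1
  have h6 := (graftCorolla c d p).mark_lt
  rw [h.arity_graftCorolla] at h6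
  have key : (1 ≤ x ∧ x ≤ (graftCorolla c d p).mark) ↔
      (1 ≤ hostGap d p (seqPos c d p x) ∧ hostGap d p (seqPos c d p x) ≤ c.mark) := by
    unfold IsGuestGap at hg
    unfold hostGap
    have hs : seqPos c d p x = if x + graftShift c d p < graftArity c d then
      x + graftShift c d p else x + graftShift c d p - graftArity c d := rfl
    unfold graftArity at *
    generalize seqPos c d p x = u at *
    have := h.cases
    generalize graftShift c d p = s at *
    generalize (graftCorolla c d p).mark = m at *
    split_ifs at hs with h7
    · split_ifs <;> omega
    · split_ifs <;> omega
  unfold Corolla.rootTag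
  simp only [key]

theorem CanGraft.mark_guest (h : CanGraft c d p) : d.mark = d.arity - 1 := by
  rcases h.tree_or with ⟨⟨n, hn, rfl⟩, -⟩ | ⟨⟨j', k', hjk', rfl⟩, -⟩ <;> rfl

theorem mem_graft {h : CanGraft c d p} {D : Diagram c} {E : Diagram d} {b : Block} :
    b ∈ (graft h D E).edges ↔ (∃ a ∈ D.edges, hostBlock c d p a = b) ∨
      (∃ a ∈ E.edges, guestBlock c d p a = b) ∨ b = newEdge c d p := by
  simp only [graft, Finset.mem_union, Finset.mem_image, Finset.mem_singleton, or_assoc]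

open Classical in
/-- Transport a vertex of the host to the grafted diagram. -/
def hostTag (c d : Corolla) (p : ℕ) (b : Block) : Block :=
  if b = ∅ ∨ b = {0} then b else hostBlock c d p b

open Classical in
/-- Transport a vertex of the attached diagram to the grafted diagram. -/
def guestTag (c d : Corolla) (p : ℕ) (b : Block) : Block :=
  if b = ∅ then newEdge c d p else guestBlock c d p b

theorem hostTag_of_mem {D : Diagram c} {b : Block} (hb : b ∈ D.edges) :
    hostTag c d p b = hostBlock c d p b := by
  rw [hostTag, if_neg]
  rintro (h | h)
  · exact (D.isBlock b hb).ne_empty h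
  · exact (D.isBlock b hb).ne_singleton 0 h

theorem guestTag_of_mem {E : Diagram d} {b : Block} (hb : b ∈ E.edges) :
    guestTag c d p b = guestBlock c d p b := by
  rw [guestTag, if_neg (E.isBlock b hb).ne_empty]

theorem hostTag_root (g : ℕ) : hostTag c d p (c.rootTag g) = c.rootTag g := by
  rw [hostTag, if_pos (c.rootTag_eq g)]

/-- Neither the new edge nor an edge of the attached tree covers a gap of the host, so the smallest
covering edge is found in the host. -/
theorem CanGraft.label_hostGap (h : CanGraft c d p) (D : Diagram c) (E : Diagram d) {x : ℕ}
    (hx : x < graftArity c d) (hg : ¬ IsGuestGap d p (seqPos c d p x)) :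
    (graft h D E).label x = hostTag c d p (D.label (hostGap d p (seqPos c d p x))) := by
  have cov : ∀ b ∈ (graft h D E).edges, Covers (graftCorolla c d p).arity b x →
      ∃ a ∈ D.edges, hostBlock c d p a = b ∧ Covers c.arity a (hostGap d p (seqPos c d p x)) := by
    intro b hb hbx
    rw [h.arity_graftCorolla] at hbx
    rcases mem_graft.1 hb with ⟨a, ha, rfl⟩ | ⟨a, ha, rfl⟩ | rfl
    · exact ⟨a, ha, rfl, (h.covers_hostBlock_of_hostGap hx hg a).1 hbx⟩
    · exact absurd ((h.covers_guestBlock hx (E.isBlock a ha).subset).1 hbx).1 hg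
    · exact absurd ((h.covers_guestBlock hx subset_rfl).1 hbx).1 hg
  rcases D.label_cases (hostGap d p (seqPos c d p x)) with ⟨h1, h2, h3⟩ | ⟨h1, h2⟩
  · rw [hostTag_of_mem h1]
    refine Diagram.label_eq (mem_graft.2 (Or.inl ⟨_, h1, rfl⟩)) ?_ ?_
    · rw [h.arity_graftCorolla]
      exact (h.covers_hostBlock_of_hostGap hx hg _).2 h2
    · intro b hb hbx
      obtain ⟨a, ha, rfl, hax⟩ := cov b hb hbx
      intro y hy
      rw [mem_hostBlock] at hy ⊢
      exact ⟨hy.1, h3 a ha hax hy.2⟩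
  · rw [h2, hostTag_root, ← h.rootTag_hostGap hx hg]
    refine Diagram.label_root fun b hb hbx => ?_
    obtain ⟨a, ha, -, hax⟩ := cov b hb hbx
    exact h1 a ha hax

/-- The root vertex of the attached tree becomes the vertex of the new edge, and every host edge
that covers the gap contains the new edge. Only the tag `∅` occurs at these gaps: the mark of a tree
is its last leaf, so all its inner gaps are upper ones. -/
theorem CanGraft.label_guestGap (h : CanGraft c d p) (D : Diagram c) (E : Diagram d) {x : ℕ}
    (hx : x < graftArity c d) (hg : IsGuestGap d p (seqPos c d p x)) :
    (graft h D E).label x = guestTag c d p (E.label (seqPos c d p x - p)) := by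
  have hsub : ∀ b ∈ (graft h D E).edges, Covers (graftArity c d) b x →
      (∃ a ∈ E.edges, guestBlock c d p a = b ∧ Covers d.arity a (seqPos c d p x - p)) ∨
        newEdge c d p ⊆ b := by
    intro b hb hbx
    rcases mem_graft.1 hb with ⟨a, ha, rfl⟩ | ⟨a, ha, rfl⟩ | rfl
    · right
      rw [covers_hostBlock_of_guestGap hx hg] at hbx
      intro y hy
      rw [mem_newEdge] at hy
      rw [mem_hostBlock, hy.2]
      exact ⟨hy.1, hbx⟩
    · exact Or.inl ⟨a, ha, rfl, ((h.covers_guestBlock hx (E.isBlock a ha).subset).1 hbx).2⟩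
    · exact Or.inr subset_rfl
  rw [← h.arity_graftCorolla] at hsub
  rcases E.label_cases (seqPos c d p x - p) with ⟨h1, h2, h3⟩ | ⟨h1, h2⟩
  · rw [guestTag_of_mem h1]
    refine Diagram.label_eq (mem_graft.2 (Or.inr (Or.inl ⟨_, h1, rfl⟩))) ?_ ?_
    · rw [h.arity_graftCorolla]
      exact (h.covers_guestBlock hx (E.isBlock _ h1).subset).2 ⟨hg, h2⟩
    · intro b hb hbx
      rcases hsub b hb hbx with ⟨a, ha, rfl, hax⟩ | hs
      · intro y hy
        rw [mem_guestBlock] at hy ⊢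
        exact ⟨hy.1, hy.2.1, h3 a ha hax hy.2.2⟩
      · exact (guestBlock_subset (E.isBlock _ h1).subset).trans hs
  · rw [h2, Corolla.rootTag, if_pos (by have := h.mark_guest; obtain ⟨g1, g2⟩ := hg; omega),
      guestTag, if_pos rfl]
    refine Diagram.label_eq (mem_graft.2 (Or.inr (Or.inr rfl))) ?_ ?_
    · rw [h.arity_graftCorolla]
      refine (h.covers_guestBlock hx subset_rfl).2 ⟨hg, ?_⟩
      obtain ⟨g1, g2⟩ := hg
      rw [Covers, Finset.mem_range, Finset.mem_range, cpred, if_neg (by omega)]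
      omega
    · intro b hb hbx
      rcases hsub b hb hbx with ⟨a, ha, rfl, hax⟩ | hs
      · exact absurd hax (h1 a ha)
      · exact hs

/-! ### Cutting a diagram at an edge -/

theorem card_graft {h : CanGraft c d p} (D : Diagram c) (E : Diagram d) :
    (graft h D E).edges.card = D.edges.card + E.edges.card + 1 := by
  change (_ ∪ _ ∪ _ : Finset Block).card = _
  rw [Finset.card_union_of_disjoint (h.disjoint_newEdge D E),
    Finset.card_union_of_disjoint (h.disjoint_host_guest D E),
    Finset.card_image_of_injOn (h.injOn_host D), Finset.card_image_of_injOn (h.injOn_guest E),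
    Finset.card_singleton]

/-- The three kinds of edges can be told apart: host edges are never inside the new edge, and the
edges of the attached tree are properly inside it. Thus refining a graft by a graft is refining both
parts. -/
theorem graft_subset_iff {h : CanGraft c d p} {D D' : Diagram c} {E E' : Diagram d} :
    (graft h D E).edges ⊆ (graft h D' E').edges ↔ D.edges ⊆ D'.edges ∧ E.edges ⊆ E'.edges := by
  constructor
  · intro hs
    constructor
    · intro a ha
      rcases mem_graft.1 (hs (mem_graft.2 (Or.inl ⟨a, ha, rfl⟩))) with
        ⟨a', ha', he⟩ | ⟨a', ha', he⟩ | he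
      · rwa [← h.hostBlock_injOn (D'.isBlock a' ha').subset (D.isBlock a ha).subset he]
      · exact absurd (he ▸ guestBlock_subset (E'.isBlock a' ha').subset)
          (h.hostBlock_not_subset (D.isBlock a ha))
      · exact absurd he.subset (h.hostBlock_not_subset (D.isBlock a ha))
    · intro a ha
      rcases mem_graft.1 (hs (mem_graft.2 (Or.inr (Or.inl ⟨a, ha, rfl⟩)))) with
        ⟨a', ha', he⟩ | ⟨a', ha', he⟩ | he
      · exact absurd (he ▸ guestBlock_subset (E.isBlock a ha).subset)
          (h.hostBlock_not_subset (D'.isBlock a' ha'))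
      · rwa [← h.guestBlock_injOn (E'.isBlock a' ha').subset (E.isBlock a ha).subset he]
      · exact absurd (h.guestBlock_injOn (E.isBlock a ha).subset subset_rfl he)
          (h.ne_range (E.isBlock a ha))
  · rintro ⟨h1, h2⟩ b hb
    rcases mem_graft.1 hb with ⟨a, ha, rfl⟩ | ⟨a, ha, rfl⟩ | rfl
    · exact mem_graft.2 (Or.inl ⟨a, h1 ha, rfl⟩)
    · exact mem_graft.2 (Or.inr (Or.inl ⟨a, h2 ha, rfl⟩))
    · exact mem_graft.2 (Or.inr (Or.inr rfl))

theorem graft_injective {h : CanGraft c d p} {D D' : Diagram c} {E E' : Diagram d}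
    (he : graft h D E = graft h D' E') : D = D' ∧ E = E' := by
  have h1 := graft_subset_iff.1 (he ▸ subset_rfl : (graft h D E).edges ⊆ (graft h D' E').edges)
  have h2 := graft_subset_iff.1 (he ▸ subset_rfl : (graft h D' E').edges ⊆ (graft h D E).edges)
  exact ⟨Diagram.ext (h1.1.antisymm h2.1), Diagram.ext (h1.2.antisymm h2.2)⟩

theorem CanGraft.compatible_of_hostBlock (h : CanGraft c d p) {b b' : Block}
    (hb : b ⊆ Finset.range c.arity) (hb' : b' ⊆ Finset.range c.arity)
    (hc : Compatible (hostBlock c d p b) (hostBlock c d p b')) : Compatible b b' := by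
  have key : ∀ y < c.arity, ∃ x, ∀ b, x ∈ hostBlock c d p b ↔ y ∈ b := by
    intro y hy
    obtain ⟨x, hx, rfl⟩ := h.exists_leafBelow hy
    exact ⟨x, fun b => by rw [mem_hostBlock]; exact and_iff_right hx⟩
  have sub : ∀ b b', b ⊆ Finset.range c.arity → hostBlock c d p b ⊆ hostBlock c d p b' →
      b ⊆ b' := by
    intro b b' hb hs y hy
    obtain ⟨x, hx⟩ := key y (Finset.mem_range.1 (hb hy))
    exact (hx b').1 (hs ((hx b).2 hy))
  rcases hc with hc | hc | hc
  · exact Or.inl (sub _ _ hb hc)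
  · exact Or.inr (Or.inl (sub _ _ hb' hc))
  · refine Or.inr (Or.inr (Finset.disjoint_left.2 fun y hy hy' => ?_))
    obtain ⟨x, hx⟩ := key y (Finset.mem_range.1 (hb hy))
    exact Finset.disjoint_left.1 hc ((hx b).2 hy) ((hx b').2 hy')

theorem CanGraft.compatible_of_guestBlock (h : CanGraft c d p) {b b' : Block}
    (hb : b ⊆ Finset.range d.arity) (hb' : b' ⊆ Finset.range d.arity)
    (hc : Compatible (guestBlock c d p b) (guestBlock c d p b')) : Compatible b b' := by
  have key : ∀ y < d.arity, ∃ x, ∀ b, x ∈ guestBlock c d p b ↔ y ∈ b := by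
    intro y hy
    obtain ⟨x, hx, hxy⟩ := h.exists_guest hy
    refine ⟨x, fun b => ?_⟩
    rw [mem_guestBlock, hxy]
    simp [hx]
  have sub : ∀ b b', b ⊆ Finset.range d.arity → guestBlock c d p b ⊆ guestBlock c d p b' →
      b ⊆ b' := by
    intro b b' hb hs y hy
    obtain ⟨x, hx⟩ := key y (Finset.mem_range.1 (hb hy))
    exact (hx b').1 (hs ((hx b).2 hy))
  rcases hc with hc | hc | hc
  · exact Or.inl (sub _ _ hb hc)
  · exact Or.inr (Or.inl (sub _ _ hb' hc))
  · refine Or.inr (Or.inr (Finset.disjoint_left.2 fun y hy hy' => ?_))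
    obtain ⟨x, hx⟩ := key y (Finset.mem_range.1 (hb hy))
    exact Finset.disjoint_left.1 hc ((hx b).2 hy) ((hx b').2 hy')

/-- The collapse identifies only leaves of the attached tree. -/
theorem leafBelow_eq {x x' : ℕ} (hx : x < graftArity c d) (hx' : x' < graftArity c d)
    (he : leafBelow c d p x = leafBelow c d p x') : x = x' ∨ leafBelow c d p x = p := by
  have := @graftShift_lt c d p
  have := d.two_le_arity
  have := c.two_le_arity
  unfold leafBelow at *
  have inj : seqPos c d p x = seqPos c d p x' → x = x' := by
    intro h
    unfold seqPos graftArity at *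
    split_ifs at h <;> omega
  split_ifs at he ⊢
  · exact Or.inl (inj he)
  all_goals first
    | exact Or.inr rfl
    | (left; apply inj; omega)

/-- An edge compatible with the new edge, and not inside of it, comes from the host. -/
theorem CanGraft.exists_hostBlock (h : CanGraft c d p) {b : Block}
    (hb : (graftCorolla c d p).IsBlock b) (hs : ¬ b ⊆ newEdge c d p)
    (hc : newEdge c d p ⊆ b ∨ Disjoint (newEdge c d p) b) :
    ∃ a, c.IsBlock a ∧ hostBlock c d p a = b := by
  have hlt : ∀ x ∈ b, x < graftArity c d := fun x hx => by
    rw [← h.arity_graftCorolla]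
    exact Finset.mem_range.1 (hb.subset hx)
  -- As `b` contains the new edge or is disjoint from it, `b` is the full preimage of its image
  -- under the collapse.
  have hmem : ∀ x < graftArity c d, leafBelow c d p x ∈ b.image (leafBelow c d p) → x ∈ b := by
    intro x hx hxb
    obtain ⟨y, hy, hyx⟩ := Finset.mem_image.1 hxb
    rcases leafBelow_eq (hlt y hy) hx hyx with rfl | he
    · exact hy
    · have hyN := mem_newEdge.2 ⟨hlt y hy, he⟩
      have hxN := mem_newEdge.2 ⟨hx, hyx ▸ he⟩
      rcases hc with hc | hc
      · exact hc hxN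
      · exact absurd hy (Finset.disjoint_left.1 hc hyN)
  refine ⟨b.image (leafBelow c d p), Corolla.isBlock_of_conn ?_ ?_ ?_ ?_, ?_⟩
  · intro y hy
    obtain ⟨x, hx, rfl⟩ := Finset.mem_image.1 hy
    exact Finset.mem_range.2 (leafBelow_lt h.1 (hlt x hx))
  · obtain ⟨x, hx, y, hy, hxy⟩ := hb.exists_ne
    by_cases he : leafBelow c d p x = leafBelow c d p y
    · have hxp := (leafBelow_eq (hlt x hx) (hlt y hy) he).resolve_left hxy
      -- If the two chosen leaves collapse to `p`, a leaf of `b` outside of the new edge provides a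
      -- second point of the image.
      obtain ⟨z, hz, hzN⟩ := Finset.not_subset.1 hs
      refine ⟨_, Finset.mem_image_of_mem _ hx, _, Finset.mem_image_of_mem _ hz, fun h' => hzN ?_⟩
      exact mem_newEdge.2 ⟨hlt z hz, h' ▸ hxp⟩
    · exact ⟨_, Finset.mem_image_of_mem _ hx, _, Finset.mem_image_of_mem _ hy, he⟩
  · rintro ⟨h0, hm⟩
    rw [← h.leafBelow_zero] at h0
    rw [← h.leafBelow_mark] at hm
    have hml := (graftCorolla c d p).mark_lt
    rw [h.arity_graftCorolla] at hml
    exact hb.not_marks ⟨hmem _ (by omega) h0, hmem _ hml hm⟩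
  · intro m u v hu hv hmu hmv
    obtain ⟨x, hx, rfl⟩ := Finset.mem_image.1 hu
    obtain ⟨y, hy, rfl⟩ := Finset.mem_image.1 hv
    obtain ⟨g, hg, hgb, hgm⟩ := hb.conn (fun z => m (leafBelow c d p z)) x y hx hy hmu hmv
    rw [h.arity_graftCorolla] at hg hgb hgm
    have hgg : ¬ IsGuestGap d p (seqPos c d p g) := by
      intro hgg
      obtain ⟨e1, e2, -⟩ := leafBelow_guestGap hg hgg
      rw [e1, e2] at hgm
      exact hgm Iff.rfl
    obtain ⟨e1, e2⟩ := h.leafBelow_hostGap hg hgg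
    rw [e1, e2] at hgm
    refine ⟨_, h.hostGap_lt hg, ⟨?_, ?_⟩, hgm⟩
    · rw [← e1]; exact Finset.mem_image_of_mem _ hgb.1
    · rw [← e2]; exact Finset.mem_image_of_mem _ hgb.2
  · ext x
    rw [mem_hostBlock]
    exact ⟨fun hx => hmem x hx.1 hx.2, fun hx => ⟨hlt x hx, Finset.mem_image_of_mem _ hx⟩⟩

/-- An edge inside of the new edge comes from the attached diagram. -/
theorem CanGraft.exists_guestBlock (h : CanGraft c d p) {b : Block}
    (hb : (graftCorolla c d p).IsBlock b) (hs : b ⊆ newEdge c d p) (hne : b ≠ newEdge c d p) :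
    ∃ a, d.IsBlock a ∧ guestBlock c d p a = b := by
  have hm := h.mark_guest
  have hlt : ∀ x ∈ b, x < graftArity c d ∧ p ≤ seqPos c d p x ∧
      seqPos c d p x - p < d.arity := fun x hx => by
    have := hs hx
    rw [newEdge, mem_guestBlock, Finset.mem_range] at this
    exact this
  have inj : ∀ x < graftArity c d, ∀ y < graftArity c d, seqPos c d p x = seqPos c d p y →
      x = y := by
    intro x hx y hy hxy
    have := @graftShift_lt c d p
    have := c.two_le_arity
    unfold seqPos graftArity at *
    split_ifs at hxy <;> omega
  have heq : guestBlock c d p (b.image fun x => seqPos c d p x - p) = b := by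
    ext x
    rw [mem_guestBlock, Finset.mem_image]
    constructor
    · rintro ⟨hx, hpx, y, hy, hxy⟩
      obtain ⟨h1, h2, h3⟩ := hlt y hy
      rwa [← inj y h1 x hx (by omega)]
    · intro hx
      exact ⟨(hlt x hx).1, (hlt x hx).2.1, x, hx, rfl⟩
  -- Every gap covered by `b` is an inner gap of the attached tree, so connectedness holds along the
  -- interval of its leaves and never uses the gap between its last and its first leaf.
  have hconn : ∀ (m : ℕ → Prop) (u v : ℕ), u ∈ (b.image fun x => seqPos c d p x - p) →
      v ∈ (b.image fun x => seqPos c d p x - p) → m u → ¬ m v →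
      ∃ g, 1 ≤ g ∧ g < d.arity ∧ Covers d.arity (b.image fun x => seqPos c d p x - p) g ∧
        ¬ (m g ↔ m (g - 1)) := by
    intro m u v hu hv hmu hmv
    obtain ⟨x, hx, rfl⟩ := Finset.mem_image.1 hu
    obtain ⟨y, hy, rfl⟩ := Finset.mem_image.1 hv
    obtain ⟨g, hg, hgb, hgm⟩ := hb.conn (fun z => m (seqPos c d p z - p)) x y hx hy hmu hmv
    rw [h.arity_graftCorolla] at hg hgb hgm
    rw [← heq, h.covers_guestBlock hg] at hgb
    · obtain ⟨hgg, hgb⟩ := hgb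
      rw [(leafBelow_guestGap hg hgg).2.2] at hgm
      have h1 := hgg.1
      have h2 := hgg.2
      refine ⟨_, ?_, ?_, hgb, ?_⟩
      · omega
      · omega
      · rwa [show seqPos c d p g - p - 1 = seqPos c d p g - 1 - p by omega]
    · intro z hz
      obtain ⟨w, hw, rfl⟩ := Finset.mem_image.1 hz
      exact Finset.mem_range.2 (hlt w hw).2.2
  refine ⟨b.image fun x => seqPos c d p x - p, Corolla.isBlock_of_conn ?_ ?_ ?_ ?_, heq⟩
  · intro z hz
    obtain ⟨w, hw, rfl⟩ := Finset.mem_image.1 hz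
    exact Finset.mem_range.2 (hlt w hw).2.2
  · obtain ⟨x, hx, y, hy, hxy⟩ := hb.exists_ne
    refine ⟨_, Finset.mem_image_of_mem _ hx, _, Finset.mem_image_of_mem _ hy, fun he => hxy ?_⟩
    obtain ⟨h1, h2, h3⟩ := hlt x hx
    obtain ⟨h4, h5, h6⟩ := hlt y hy
    exact inj x h1 y h4 (by omega)
  · rintro ⟨h0, h1⟩
    apply hne
    rw [← heq, newEdge]
    congr 1
    -- A set that contains both end leaves and is connected along the interval consists of all
    -- leaves of the tree, so `b` would be the new edge itself.
    ext y
    rw [Finset.mem_range]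
    constructor
    · intro hz
      obtain ⟨w, hw, rfl⟩ := Finset.mem_image.1 hz
      exact (hlt w hw).2.2
    · intro hy
      by_contra hyb
      have hy0 : y ≠ 0 := fun h => hyb (h ▸ h0)
      rw [hm] at h1
      have hy1 : y ≠ d.arity - 1 := fun h => hyb (h ▸ h1)
      obtain ⟨g, hg1, hg2, hgb, hgm⟩ := hconn (· < y) 0 _ h0 h1 (by omega) (by omega)
      have : g = y := by omega
      exact hyb (this ▸ hgb.1)
  · intro m u v hu hv hmu hmv
    obtain ⟨g, hg1, hg2, hgb, hgm⟩ := hconn m u v hu hv hmu hmv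
    refine ⟨g, hg2, hgb, ?_⟩
    rwa [cpred, if_neg (by omega)]

/-- A diagram can be cut at each of its edges. -/
theorem CanGraft.exists_graft_eq (h : CanGraft c d p) (G : Diagram (graftCorolla c d p))
    (hG : newEdge c d p ∈ G.edges) : ∃ D E, graft h D E = G := by
  classical
  -- Both parts are obtained by pulling back the edges of `G`; compatibility descends along the two
  -- embeddings.
  let D : Diagram c :=
    { edges := (Finset.range c.arity).powerset.filter fun b =>
        c.IsBlock b ∧ hostBlock c d p b ∈ G.edges
      isBlock := fun b hb => (Finset.mem_filter.1 hb).2.1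
      compatible := fun b hb b' hb' => by
        rw [Finset.mem_filter] at hb hb'
        exact h.compatible_of_hostBlock hb.2.1.subset hb'.2.1.subset
          (G.compatible _ hb.2.2 _ hb'.2.2) }
  let E : Diagram d :=
    { edges := (Finset.range d.arity).powerset.filter fun b =>
        d.IsBlock b ∧ guestBlock c d p b ∈ G.edges
      isBlock := fun b hb => (Finset.mem_filter.1 hb).2.1
      compatible := fun b hb b' hb' => by
        rw [Finset.mem_filter] at hb hb'
        exact h.compatible_of_guestBlock hb.2.1.subset hb'.2.1.subset
          (G.compatible _ hb.2.2 _ hb'.2.2) }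
  refine ⟨D, E, Diagram.ext ?_⟩
  ext b
  rw [mem_graft]
  constructor
  · rintro (⟨a, ha, rfl⟩ | ⟨a, ha, rfl⟩ | rfl)
    · exact (Finset.mem_filter.1 ha).2.2
    · exact (Finset.mem_filter.1 ha).2.2
    · exact hG
  · intro hb
    have hbb := G.isBlock b hb
    by_cases hne : b = newEdge c d p
    · exact Or.inr (Or.inr hne)
    by_cases hs : b ⊆ newEdge c d p
    · obtain ⟨a, ha, rfl⟩ := h.exists_guestBlock hbb hs hne
      exact Or.inr (Or.inl ⟨a, Finset.mem_filter.2
        ⟨Finset.mem_powerset.2 ha.subset, ha, hb⟩, rfl⟩)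
    · obtain ⟨a, ha, rfl⟩ := h.exists_hostBlock hbb hs (by
        rcases G.compatible _ hG b hb with h1 | h1 | h1
        · exact Or.inl h1
        · exact absurd h1 hs
        · exact Or.inr h1)
      exact Or.inl ⟨a, Finset.mem_filter.2 ⟨Finset.mem_powerset.2 ha.subset, ha, hb⟩, rfl⟩

end
end Pairahedra

namespace Pairahedra
noncomputable section

variable {c d : Corolla} {p : ℕ}

/-! ### Every possible edge as the new edge of a grafting -/

theorem CanGraft.newEdge_eq_Ico (h : CanGraft c d p) (hs : graftShift c d p = 0) :
    newEdge c d p = Finset.Ico p (p + d.arity) := by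
  have := h.1
  ext x
  rw [newEdge, mem_guestBlock_of_shift hs, Finset.mem_range, Finset.mem_Ico]
  unfold graftArity
  omega

/-- Every set of leaves that can be cut off by an edge is cut off by the new edge of some
grafting. -/
theorem Corolla.IsBlock.exists_newEdge {b : Block} (hb : c.IsBlock b) :
    ∃ (c' d : Corolla) (p : ℕ) (_ : CanGraft c' d p), graftCorolla c' d p = c ∧
      newEdge c' d p = b := by
  cases c with
  | T n hn =>
    obtain ⟨x, y, h1, h2, h3, rfl⟩ := hb
    have h : CanGraft (.T (n - (y - x) + 1) (by omega)) (.T (y - x) (by omega)) x :=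
      ⟨by simp only [Corolla.arity]; omega, rfl⟩
    refine ⟨_, _, x, h, ?_, ?_⟩
    · simp only [graftCorolla, Corolla.T.injEq]; omega
    · rw [h.newEdge_eq_Ico rfl, Corolla.arity, Nat.add_sub_cancel' (by omega)]
  | M j k hjk =>
    obtain ⟨x, y, h1, h2, h3, rfl⟩ := hb
    by_cases hx : j < x
    · have h : CanGraft (.M j (k + 1 - (y - x)) (by omega)) (.T (y - x) (by omega)) x :=
        ⟨by simp only [Corolla.arity]; omega, by
          simp only [Corolla.leafColor, Corolla.root]
          rw [if_neg (by omega)]⟩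
      refine ⟨_, _, x, h, ?_, ?_⟩
      · simp only [graftCorolla]
        rw [if_neg (by omega)]
        simp only [Corolla.M.injEq, true_and]; omega
      · rw [h.newEdge_eq_Ico rfl, Corolla.arity, Nat.add_sub_cancel' (by omega)]
    · by_cases hy : y ≤ j
      · have h : CanGraft (.M (j + 1 - (y - x)) k (by omega)) (.T (y - x) (by omega)) x :=
          ⟨by simp only [Corolla.arity]; omega, by
            simp only [Corolla.leafColor, Corolla.root]
            rw [if_neg (by omega)]⟩
        refine ⟨_, _, x, h, ?_, ?_⟩
        · simp only [graftCorolla]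
          rw [if_pos (by omega)]
          simp only [Corolla.M.injEq, and_true]; omega
        · rw [h.newEdge_eq_Ico rfl, Corolla.arity, Nat.add_sub_cancel' (by omega)]
      -- The interval contains the thick leaf `j`, so a module tree is cut off, with `j - x` thin
      -- leaves to the left and `y - 1 - j` to the right of the thick one.
      · have h : CanGraft (.M x (j + k + 1 - y) (by omega)) (.M (j - x) (y - 1 - j) (by omega)) x :=
          ⟨by simp only [Corolla.arity]; omega, by simp [Corolla.leafColor, Corolla.root]⟩
        refine ⟨_, _, x, h, ?_, ?_⟩
        · simp only [graftCorolla, Corolla.M.injEq]; omega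
        · rw [h.newEdge_eq_Ico rfl, Corolla.arity]
          congr 1; omega
  | I j k =>
    rcases hb with ⟨x, y, h1, h2, h3, rfl⟩ | ⟨x, y, h1, h2, h3, h4, h5, rfl⟩
    · by_cases hy : y ≤ j + 1
      · have h : CanGraft (.I (j + 1 - (y - x)) k) (.T (y - x) (by omega)) x :=
          ⟨by simp only [Corolla.arity]; omega, by
            simp only [Corolla.leafColor, Corolla.root]
            rw [if_neg (by omega)]⟩
        refine ⟨_, _, x, h, ?_, ?_⟩
        · simp only [graftCorolla]
          rw [if_pos (by omega)]
          simp only [Corolla.I.injEq, and_true]; omega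
        · rw [h.newEdge_eq_Ico rfl, Corolla.arity, Nat.add_sub_cancel' (by omega)]
      · by_cases hx : j + 1 < x
        · have h : CanGraft (.I j (k + 1 - (y - x))) (.T (y - x) (by omega)) x :=
            ⟨by simp only [Corolla.arity]; omega, by
              simp only [Corolla.leafColor, Corolla.root]
              rw [if_neg (by omega)]⟩
          refine ⟨_, _, x, h, ?_, ?_⟩
          · simp only [graftCorolla]
            rw [if_neg (by omega)]
            simp only [Corolla.I.injEq, true_and]; omega
          · rw [h.newEdge_eq_Ico rfl, Corolla.arity, Nat.add_sub_cancel' (by omega)]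
        · have h : CanGraft (.I (x - 1) (k - (y - j - 2)))
              (.M (j + 1 - x) (y - j - 2) (by omega)) x :=
            ⟨by simp only [Corolla.arity]; omega, by
              simp only [Corolla.leafColor, Corolla.root]
              rw [if_pos (by omega)]⟩
          refine ⟨_, _, x, h, ?_, ?_⟩
          · simp only [graftCorolla]
            rw [if_neg (by omega)]
            simp only [Corolla.I.injEq]; omega
          · rw [h.newEdge_eq_Ico (by simp only [graftShift]; rw [if_neg (by omega)]),
              Corolla.arity]
            congr 1; omega
    -- An arc through the left thick leaf `0`. The left thin leaves of the module tree come last in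
    -- the canonical numbering, so they are the `j + k + 2 - x` leaves from `x` on; the right ones
    -- follow `0`.
    · have h : CanGraft (.I (j - (y - 1)) (k - (j + k + 2 - x)))
          (.M (j + k + 2 - x) (y - 1) (by omega)) 0 :=
        ⟨by simp only [Corolla.arity]; omega, by simp [Corolla.leafColor, Corolla.root]⟩
      refine ⟨_, _, 0, h, ?_, ?_⟩
      · simp only [graftCorolla, if_true, Corolla.I.injEq]; omega
      · ext z
        simp only [newEdge, mem_guestBlock, seqPos, graftShift, graftArity, Corolla.arity,
          Finset.mem_Ico, Finset.mem_union, Finset.mem_range, if_true]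
        split_ifs <;> omega

/-! ### Standard orientations and grafting -/

theorem neg_one_pow_congr {m n : ℕ} (h : m % 2 = n % 2) : (-1 : ℤ) ^ m = (-1) ^ n := by
  rw [neg_one_pow_eq_pow_mod_two, h, ← neg_one_pow_eq_pow_mod_two]

theorem remove_wedge_mul {a : Block} {l : List Block} (ha : a ∉ l) (ω : Ext) :
    remove a (wedge l * ω) = (-1 : ℤ) ^ l.length • (wedge l * remove a ω) := by
  induction l with
  | nil => simp [wedge]
  | cons e l ih =>
    rw [List.mem_cons, not_or] at ha
    rw [wedge_cons, mul_assoc, remove_edgeVec_mul, if_neg (Ne.symm ha.1), ih ha.2, zero_sub,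
      mul_smul_comm, mul_assoc, List.length_cons, pow_succ, mul_neg_one, neg_smul]

/-- Moving a factor to the front costs the same sign as removing it. -/
theorem edgeVec_mul_remove {a : Block} {l : List Block} (hl : l.Nodup) (ha : a ∈ l) :
    edgeVec a * remove a (wedge l) = wedge l := by
  obtain ⟨i, hi, rfl⟩ := List.getElem_of_mem ha
  have key : wedge l = (-1 : ℤ) ^ i • wedge (l[i] :: l.eraseIdx i) := by
    conv_lhs => rw [← List.take_append_drop i l, List.drop_eq_getElem_cons hi]
    rw [wedge_append, wedge_cons, wedge_cons, List.eraseIdx_eq_take_drop_succ, wedge_append,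
      ← mul_assoc, ← mul_assoc, edgeVec_mul_wedge, smul_mul_assoc, smul_smul, ← pow_add,
      List.length_take, min_eq_left hi.le, ← two_mul, pow_mul]
    simp
  rw [remove_wedge hl, mul_smul_comm, ← wedge_cons, ← key]

theorem IsOrientation.mul_comm {S S' : Finset Block} {ω ω' : Ext} (h : IsOrientation S ω)
    (h' : IsOrientation S' ω') : ω * ω' = (-1 : ℤ) ^ (S.card * S'.card) • (ω' * ω) := by
  obtain ⟨l, h1, rfl, h3⟩ := h
  obtain ⟨l', h1', rfl, h3'⟩ := h'
  rw [List.toFinset_card_of_nodup h1, List.toFinset_card_of_nodup h1']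
  rcases h3 with rfl | rfl <;> rcases h3' with rfl | rfl <;>
    simp only [neg_mul, mul_neg, neg_neg, wedge_mul_comm l l', smul_neg]

/-- `canonPos` is a rotation: it exchanges an initial segment of length `graftShift` with the rest
of the list. -/
theorem wedge_map_canonPos (c d : Corolla) (p : ℕ) (f : ℕ → Block) :
    wedge ((List.range (graftArity c d)).map fun u => f (canonPos c d p u)) =
      (-1 : ℤ) ^ (graftShift c d p * (graftArity c d - graftShift c d p)) •
        wedge ((List.range (graftArity c d)).map f) := by
  have h0 := @graftShift_lt c d p
  have h1 := c.two_le_arity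
  have key : ∀ s N : ℕ, s < N →
      wedge ((List.range N).map fun u => f (if s ≤ u then u - s else u + N - s)) =
        (-1 : ℤ) ^ (s * (N - s)) • wedge ((List.range N).map f) := by
    intro s N hs
    have e1 : List.range N = List.range s ++ (List.range (N - s)).map (s + ·) := by
      rw [← List.range_add, Nat.add_sub_cancel' hs.le]
    have e2 : List.range N = List.range (N - s) ++ (List.range s).map (N - s + ·) := by
      rw [← List.range_add, Nat.sub_add_cancel hs.le]
    have a1 : (List.range s).map (fun u => f (if s ≤ u then u - s else u + N - s)) =
        ((List.range s).map (N - s + ·)).map f := by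
      rw [List.map_map]
      refine List.map_congr_left fun u hu => ?_
      rw [List.mem_range] at hu
      rw [if_neg (by omega), Function.comp_apply]
      congr 1; omega
    have a2 : ((List.range (N - s)).map (s + ·)).map
        (fun u => f (if s ≤ u then u - s else u + N - s)) = (List.range (N - s)).map f := by
      rw [List.map_map]
      refine List.map_congr_left fun u hu => ?_
      rw [Function.comp_apply, if_pos (by omega)]
      congr 1; omega
    conv_lhs => rw [e1]
    rw [List.map_append, a1, a2, wedge_append, wedge_mul_comm, ← wedge_append, ← List.map_append,
      ← e2]
    simp
  exact key _ _ (by unfold graftArity; omega)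

/-- Degrees add under grafting and are nonnegative by `Diagram.card_edges_le`. -/
theorem isBinary_graft {h : CanGraft c d p} {D : Diagram c} {E : Diagram d} :
    (graft h D E).degree = 0 ↔ D.degree = 0 ∧ E.degree = 0 := by
  have h1 := D.card_edges_le
  have h2 := E.card_edges_le
  have h3 := h.arity_graftCorolla
  rw [Diagram.degree_eq_zero_iff, Diagram.degree_eq_zero_iff, Diagram.degree_eq_zero_iff,
    card_graft, h3, graftArity]
  omega

/-- Graft binary diagrams. -/
def graftBinary (h : CanGraft c d p) (B : BinaryDiagram c) (B' : BinaryDiagram d) :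
    BinaryDiagram (graftCorolla c d p) :=
  ⟨graft h B.1 B'.1, isBinary_graft.2 ⟨B.2, B'.2⟩⟩

/-- In the sequence of positions, the host gaps `0, …, p` are followed by the inner gaps of the
attached tree and then by the other host gaps. The tail is taken because gap `0` of the tree does
not lie between two of its leaves in this sequence. -/
theorem CanGraft.map_label (h : CanGraft c d p) (D : Diagram c) (E : Diagram d) :
    (List.range (graftArity c d)).map (fun u => (graft h D E).label (canonPos c d p u)) =
      (D.labelList.take (p + 1)).map (hostTag c d p) ++
        (E.labelList.tail.map (guestTag c d p) ++
          (D.labelList.drop (p + 1)).map (hostTag c d p)) := by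
  have h1 := h.1
  have h2 := d.two_le_arity
  refine List.ext_getElem ?_ ?_
  · simp [Diagram.labelList, graftArity]; omega
  · intro i hi hi'
    rw [List.length_map, List.length_range] at hi
    have hx := canonPos_lt (p := p) hi
    have hs := seqPos_canonPos (p := p) hi
    have t1 : ((D.labelList.take (p + 1)).map (hostTag c d p)).length = p + 1 := by
      simp [Diagram.labelList]; omega
    have t2 : (E.labelList.tail.map (guestTag c d p)).length = d.arity - 1 := by
      simp [Diagram.labelList]
    rw [List.getElem_map, List.getElem_range]
    by_cases hg : IsGuestGap d p i
    · rw [h.label_guestGap D E hx (by rwa [hs]), hs]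
      obtain ⟨g1, g2⟩ := hg
      rw [List.getElem_append_right (by omega), List.getElem_append_left (by omega)]
      simp only [List.getElem_map, List.getElem_tail, Diagram.labelList, List.getElem_range]
      congr 2
      rw [List.length_map, List.length_take, List.length_map, List.length_range]
      omega
    · rw [h.label_hostGap D E hx (by rwa [hs]), hs]
      unfold IsGuestGap at hg
      unfold hostGap
      by_cases hip : i ≤ p
      · rw [List.getElem_append_left (by omega), if_pos hip]
        simp only [List.getElem_map, List.getElem_take, Diagram.labelList, List.getElem_range]
      · rw [List.getElem_append_right (by omega), List.getElem_append_right (by omega),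
          if_neg hip]
        simp only [List.getElem_map, List.getElem_drop, Diagram.labelList, List.getElem_range]
        congr 2
        simp only [List.length_map, List.length_take, List.length_tail, List.length_range]
        omega

theorem Diagram.labelList_eq_cons (D : Diagram c) : D.labelList = D.label 0 :: D.labelList.tail := by
  have h2 := c.two_le_arity
  obtain ⟨n, hn⟩ : ∃ n, c.arity = n + 1 := ⟨c.arity - 1, by omega⟩
  simp [Diagram.labelList, hn, List.range_succ_eq_map]

/-- The standard orientations are multiplicative up to sign. -/
theorem stdOrientation_graft (h : CanGraft c d p) (B : BinaryDiagram c) (B' : BinaryDiagram d) :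
    (stdOrientation _ (graftBinary h B B')).1 =
      (-1 : ℤ) ^ (graftShift c d p * (graftArity c d - graftShift c d p) +
        (p + 1) * (d.arity - 1) + B.1.edges.card * B'.1.edges.card) •
      (edgeVec (newEdge c d p) * (relabel (hostBlock c d p) (stdOrientation c B).1 *
        relabel (guestBlock c d p) (stdOrientation d B').1)) := by
  have h1 := h.1
  have h2 := d.two_le_arity
  have hnd := B'.labelList_nodup
  have hm := h.mark_guest
  -- the vertices of the attached diagram
  have l0 : B'.1.label 0 = {0} := by
    rw [Diagram.label_root, Corolla.rootTag, if_neg (by omega)]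
    intro b hb hb0
    refine (B'.1.isBlock b hb).not_marks ⟨hb0.1, ?_⟩
    rw [hm]
    simpa [cpred] using hb0.2
  have hcons := B'.1.labelList_eq_cons
  rw [l0] at hcons
  have htags := B'.1.labelList_toFinset
  have hnd' : ({0} : Block) ∉ B'.1.labelList.tail ∧ B'.1.labelList.tail.Nodup := by
    rw [hcons, List.nodup_cons] at hnd
    exact hnd
  have htail : ∀ b ∈ B'.1.labelList.tail, b = ∅ ∨ b ∈ B'.1.edges := by
    intro b hb
    have h3 : b ∈ B'.1.tags := by
      rw [← htags, List.mem_toFinset]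
      exact List.mem_of_mem_tail hb
    simp only [Diagram.tags, Finset.mem_insert] at h3
    rcases h3 with h3 | h3 | h3
    · exact Or.inl h3
    · exact absurd (h3 ▸ hb) hnd'.1
    · exact Or.inr h3
  have hempty : ∅ ∈ B'.1.labelList.tail := by
    have h3 : ∅ ∈ B'.1.labelList := by
      rw [← List.mem_toFinset, htags]
      simp [Diagram.tags]
    rw [hcons, List.mem_cons] at h3
    exact h3.resolve_left (Finset.singleton_ne_empty 0).symm
  have hstd' : (stdOrientation d B').1 = remove ∅ (wedge B'.1.labelList.tail) := by
    change remove ∅ (remove {0} (wedge B'.1.labelList)) = _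
    conv_lhs => rw [hcons]
    rw [wedge_cons, remove_edgeVec_mul, if_pos rfl, remove_wedge_of_notMem hnd'.1, mul_zero,
      sub_zero]
  -- The upper tag of the attached tree turns into the new edge; pulling it to the front leaves the
  -- standard orientation, without a sign.
  have hG : wedge (B'.1.labelList.tail.map (guestTag c d p)) =
      edgeVec (newEdge c d p) * relabel (guestBlock c d p) (stdOrientation d B').1 := by
    have ge : guestTag c d p ∅ = newEdge c d p := by rw [guestTag, if_pos rfl]
    have gc := relabel_congr (fun b hb => guestTag_of_mem (c := c) (p := p) hb)
      (stdOrientation d B').2.mem_wedgeSpan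
    rw [← relabel_wedge, ← edgeVec_mul_remove hnd'.2 hempty, map_mul, relabel_edgeVec, ← hstd',
      ge, gc]
  have hGl : (B'.1.labelList.tail.map (guestTag c d p)).length = d.arity - 1 := by
    simp [Diagram.labelList]
  -- the vertices of the attached diagram are no tags
  have hGr : ∀ a : Block, a = ∅ ∨ a = {0} → a ∉ B'.1.labelList.tail.map (guestTag c d p) := by
    intro a ha hmem
    obtain ⟨b, hb, rfl⟩ := List.mem_map.1 hmem
    have hbl : (graftCorolla c d p).IsBlock (guestTag c d p b) := by
      rcases htail b hb with rfl | hb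
      · rw [guestTag, if_pos rfl]; exact h.isBlock_newEdge
      · rw [guestTag_of_mem hb]; exact h.isBlock_guestBlock (B'.1.isBlock b hb)
    rcases ha with ha | ha
    · exact hbl.ne_empty ha
    · exact hbl.ne_singleton 0 ha
  -- the vertices of the host
  have hinj : ∀ a : Block, a = ∅ ∨ a = {0} → ∀ x ∈ (B.1.tags : Set Block),
      hostTag c d p x = hostTag c d p a → x = a := by
    intro a ha x hx he
    have ea : hostTag c d p a = a := by rw [hostTag, if_pos ha]
    rw [ea] at he
    simp only [Diagram.tags, Finset.coe_insert, Set.mem_insert_iff, Finset.mem_coe] at hx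
    rcases hx with hx | hx | hx
    · rwa [hostTag, if_pos (Or.inl hx)] at he
    · rwa [hostTag, if_pos (Or.inr hx)] at he
    · rw [hostTag_of_mem hx] at he
      have hbl := h.isBlock_hostBlock (B.1.isBlock x hx)
      rcases ha with rfl | rfl
      · exact absurd he hbl.ne_empty
      · exact absurd he (hbl.ne_singleton 0)
  have hte : hostTag c d p ∅ = ∅ := by rw [hostTag, if_pos (Or.inl rfl)]
  have ht0 : hostTag c d p {0} = {0} := by rw [hostTag, if_pos (Or.inr rfl)]
  have hD : remove ∅ (remove {0} (relabel (hostTag c d p) (wedge B.1.labelList))) =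
      relabel (hostBlock c d p) (stdOrientation c B).1 := by
    have r1 := relabel_remove (hinj {0} (Or.inr rfl)) B.1.wedge_labelList_mem
    have r2 := relabel_remove (hinj ∅ (Or.inl rfl))
      (remove_mem_wedgeSpan {0} B.1.wedge_labelList_mem)
    rw [ht0] at r1
    rw [hte] at r2
    rw [r1, r2]
    exact relabel_congr (fun b hb => hostTag_of_mem hb) (stdOrientation c B).2.mem_wedgeSpan
  -- Two signs arise: one from the rotation of the numbering, the other from moving the `d.arity -
  -- 1` labels of the attached tree in front of the first `p + 1` labels of the host.
  have hW : wedge (graft h B.1 B'.1).labelList =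
      (-1 : ℤ) ^ (graftShift c d p * (graftArity c d - graftShift c d p) +
        (p + 1) * (d.arity - 1)) •
      (wedge (B'.1.labelList.tail.map (guestTag c d p)) *
        relabel (hostTag c d p) (wedge B.1.labelList)) := by
    have hr := wedge_map_canonPos c d p (graft h B.1 B'.1).label
    rw [h.map_label, wedge_append, wedge_append, ← mul_assoc, wedge_mul_comm, hGl] at hr
    have htl : ((B.1.labelList.take (p + 1)).map (hostTag c d p)).length = p + 1 := by
      simp [Diagram.labelList]; omega
    rw [htl, smul_mul_assoc, mul_assoc, ← wedge_append, ← List.map_append,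
      List.take_append_drop] at hr
    have hr' := congrArg (fun z => (-1 : ℤ) ^ (graftShift c d p *
      (graftArity c d - graftShift c d p)) • z) hr
    simp only [smul_smul, ← pow_add] at hr'
    rw [relabel_wedge, hr', ← two_mul, pow_mul]
    simp only [even_two, Even.neg_pow, one_pow, one_smul]
    rw [Diagram.labelList, h.arity_graftCorolla]
  change remove ∅ (remove {0} (wedge (graft h B.1 B'.1).labelList)) = _
  -- Both tags pass the labels of the attached tree, so these two signs cancel. The exchange of the
  -- two standard orientations gives the product of their numbers of edges.
  rw [hW, map_smul, map_smul, remove_wedge_mul (hGr _ (Or.inr rfl)), map_smul,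
    remove_wedge_mul (hGr _ (Or.inl rfl)), hD, hG, mul_assoc,
    ((stdOrientation d B').2.relabel (h.injOn_guest B'.1)).mul_comm
      ((stdOrientation c B).2.relabel (h.injOn_host B.1)),
    Finset.card_image_of_injOn (h.injOn_host B.1), Finset.card_image_of_injOn (h.injOn_guest B'.1),
    mul_smul_comm, smul_smul, smul_smul, smul_smul]
  congr 1
  rw [← pow_add, ← pow_add, ← pow_add, hGl, mul_comm B'.1.edges.card]
  refine neg_one_pow_congr ?_
  omega

end
end Pairahedra

namespace Pairahedra
noncomputable section

/-! ## The signs of labelings -/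

variable {c d : Corolla}

theorem wedge_map_perm {n : ℕ} (σ : Equiv.Perm (Fin n)) (F : ℕ → Block) :
    wedge ((List.ofFn fun j => ((σ j : Fin n) : ℕ)).map F) =
      (Equiv.Perm.sign σ : ℤ) • wedge ((List.range n).map F) := by
  have h := wedge_ofFn_perm (fun j : Fin n => F j) σ
  have e : (List.range n).map F = List.ofFn fun j : Fin n => F j := by
    rw [List.ofFn_eq_map, ← List.map_coe_finRange_eq_range, List.map_map]
    rfl
  rw [e, ← h, List.map_ofFn]
  rfl

theorem eq_of_smul_wedge_eq {l : List Block} (hl : l.Nodup) {a b : ℤ} (ha : a = 1 ∨ a = -1)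
    (hb : b = 1 ∨ b = -1) (h : a • wedge l = b • wedge l) : a = b := by
  have hne := wedge_ne_neg hl
  rcases ha with rfl | rfl <;> rcases hb with rfl | rfl
  · rfl
  · exact absurd (by simpa using h) hne
  · exact absurd (by simpa using h.symm) hne
  · rfl

/-- Cut out one entry of a permuted list. -/
theorem wedge_eraseIdx_perm {n : ℕ} (f : Equiv.Perm (Fin n)) (i : Fin n) {F : ℕ → Block}
    (hF : Set.InjOn F (Finset.range n)) :
    wedge (((List.ofFn fun j => ((f j : Fin n) : ℕ)).eraseIdx i).map F) =
      ((Equiv.Perm.sign f : ℤ) * (-1) ^ ((i : ℕ) + (f i : ℕ))) •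
        wedge (((List.range n).eraseIdx (f i)).map F) := by
  have h := congrArg (remove (F (f i))) (wedge_map_perm f F)
  have nd : ∀ g : Equiv.Perm (Fin n), ((List.ofFn fun j => ((g j : Fin n) : ℕ)).map F).Nodup := by
    intro g
    rw [List.map_ofFn, List.nodup_ofFn]
    intro x y hxy
    have := hF (by simp) (by simp) hxy
    exact g.injective (Fin.ext this)
  have nd' : ((List.range n).map F).Nodup := by
    refine List.Nodup.map_on ?_ List.nodup_range
    intro x hx y hy
    exact hF (by simpa using hx) (by simpa using hy)
  have h1 := remove_wedge (nd f) i (by simp)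
  have h2 := remove_wedge nd' (f i) (by simp)
  simp only [List.getElem_map, List.getElem_ofFn, List.getElem_range, Fin.eta] at h1 h2
  rw [map_smul, h1, h2, List.eraseIdx_map, List.eraseIdx_map] at h
  have h' := congrArg (fun z => (-1 : ℤ) ^ (i : ℕ) • z) h
  simp only [smul_smul, ← pow_add] at h'
  rw [← two_mul, pow_mul] at h'
  simp only [even_two, Even.neg_pow, one_pow, one_smul] at h'
  rw [h']
  congr 1
  rw [pow_add]
  ring

theorem graftLabel_list (f : Equiv.Perm (Fin c.arity)) (g : Equiv.Perm (Fin d.arity))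
    (i : Fin c.arity) (F : ℕ → Block) :
    (List.ofFn fun j => F (graftLabelFun f g i j)) =
      ((List.ofFn fun j => ((f j : Fin _) : ℕ)).take i).map (F ∘ hostLeaf c d (f i)) ++
        ((List.ofFn fun j => ((g j : Fin _) : ℕ)).map (F ∘ guestLeaf c d (f i)) ++
          ((List.ofFn fun j => ((f j : Fin _) : ℕ)).drop (i + 1)).map
            (F ∘ hostLeaf c d (f i))) := by
  have h1 := i.2
  have h2 := d.two_le_arity
  refine List.ext_getElem ?_ ?_
  · simp [graftArity]; omega
  · intro j hj hj'
    rw [List.length_ofFn] at hj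
    rw [List.getElem_ofFn]
    unfold graftLabelFun
    dsimp only
    by_cases hji : j < i
    · rw [dif_pos hji, List.getElem_append_left (by simp; omega)]
      simp
    · rw [dif_neg hji, List.getElem_append_right (by simp; omega)]
      by_cases hji' : j < i + d.arity
      · rw [dif_pos hji', List.getElem_append_left (by simp; omega)]
        simp
      · rw [dif_neg hji', List.getElem_append_right (by simp; omega)]
        simp only [List.getElem_map, List.getElem_drop, List.getElem_ofFn, Function.comp_apply]
        congr 4
        simp
        omega

/-- The sign of a permutation is read off from the wedge of its list of values, encoded as
singletons. Moving the labels of the attached tree to the front and sorting both parts gives a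
normal form. Doing the same for identity labelings and grafting at position `f i`, where the list is
merely a rotation, identifies the sign of the normal form. -/
theorem sign_graftLabel (f : Equiv.Perm (Fin c.arity)) (g : Equiv.Perm (Fin d.arity))
    (i : Fin c.arity) (h : CanGraft c d (f i)) :
    (Equiv.Perm.sign (graftLabel f g i h) : ℤ) = Equiv.Perm.sign f * Equiv.Perm.sign g *
      (-1) ^ (((i : ℕ) + (f i : ℕ)) * (d.arity + 1) +
        graftShift c d (f i) * (graftArity c d - graftShift c d (f i))) := by
  have hd := d.two_le_arity
  have hc := c.two_le_arity
  let S : ℕ → Block := fun x => {x}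
  -- the list of all leaves, for arbitrary labelings
  have key : ∀ (f' : Equiv.Perm (Fin c.arity)) (g' : Equiv.Perm (Fin d.arity)) (i' : Fin c.arity),
      f' i' = f i →
      wedge (List.ofFn fun j => S (graftLabelFun f' g' i' j)) =
        ((-1) ^ ((i' : ℕ) * d.arity) * ((Equiv.Perm.sign g' : ℤ) *
          ((Equiv.Perm.sign f' : ℤ) * (-1) ^ ((i' : ℕ) + (f i : ℕ))))) •
        (wedge ((List.range d.arity).map (S ∘ guestLeaf c d (f i))) *
          wedge (((List.range c.arity).eraseIdx (f i)).map (S ∘ hostLeaf c d (f i)))) := by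
    intro f' g' i' hf
    -- The entry of the grafted leaf gets cut out; the value `∅`, which is no singleton, keeps `F`
    -- injective.
    let F : ℕ → Block := fun y => if y = f i then ∅ else S (hostLeaf c d (f i) y)
    have hF : Set.InjOn F (Finset.range c.arity) := by
      intro x hx y hy hxy
      rw [Finset.mem_coe, Finset.mem_range] at hx hy
      simp only [F] at hxy
      split_ifs at hxy with h1 h2 h2
      · rw [h1, h2]
      · exact absurd hxy.symm (Finset.singleton_ne_empty _)
      · exact absurd hxy (Finset.singleton_ne_empty _)
      · exact h.hostLeaf_inj hx hy h1 h2 (Finset.singleton_injective hxy)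
    have hE : ∀ (l : List ℕ), (f i : ℕ) ∉ l → l.map F = l.map (S ∘ hostLeaf c d (f i)) := by
      intro l hl
      refine List.map_congr_left fun y hy => ?_
      simp only [F]
      rw [if_neg]
      · rfl
      · rintro rfl
        exact hl hy
    have hfn : (f i : ℕ) ∉ (List.ofFn fun j => ((f' j : Fin _) : ℕ)).eraseIdx i' := by
      intro hmem
      have hnd : (List.ofFn fun j => ((f' j : Fin _) : ℕ)).Nodup := by
        rw [List.nodup_ofFn]
        exact fun x y hxy => f'.injective (Fin.ext hxy)
      have e : (List.ofFn fun j => ((f' j : Fin _) : ℕ))[(i' : ℕ)]'(by simp) = f i := by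
        simp [hf]
      rw [← hnd.erase_getElem (i' : ℕ) (by simp), e] at hmem
      exact hnd.not_mem_erase hmem
    have hrn : (f i : ℕ) ∉ (List.range c.arity).eraseIdx (f i) := by
      intro hmem
      have hnd := List.nodup_range (n := c.arity)
      have e : (List.range c.arity)[((f i : Fin _) : ℕ)]'(by simp) = f i := by simp
      rw [← hnd.erase_getElem ((f i : Fin _) : ℕ) (by simp), e] at hmem
      exact hnd.not_mem_erase hmem
    have hcut := wedge_eraseIdx_perm f' i' hF
    rw [hf, hE _ hfn, hE _ hrn, List.eraseIdx_eq_take_drop_succ, List.map_append] at hcut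
    rw [graftLabel_list, hf, wedge_append, wedge_append, ← mul_assoc, wedge_mul_comm,
      smul_mul_assoc, mul_assoc, ← wedge_append, hcut, wedge_map_perm, mul_smul_comm,
      smul_mul_assoc, smul_smul, smul_smul]
    congr 1
    have t : (((List.ofFn fun j => ((f' j : Fin _) : ℕ)).take i').map
        (S ∘ hostLeaf c d (f i))).length = i' := by
      simp
    rw [t, List.length_map, List.length_ofFn]
    ring
  -- the case of the canonical labelings
  have hbase : (List.ofFn fun j => S (graftLabelFun (1 : Equiv.Perm (Fin c.arity))
      (1 : Equiv.Perm (Fin d.arity)) (f i) j)) =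
      (List.range (graftArity c d)).map fun u => S (canonPos c d (f i) u) := by
    refine List.ext_getElem (by simp) ?_
    intro j hj hj'
    rw [List.length_ofFn] at hj
    rw [List.getElem_ofFn, List.getElem_map, List.getElem_range]
    congr 1
    unfold graftLabelFun
    simp only [Equiv.Perm.coe_one, id_eq]
    split_ifs with h1 h2
    · unfold hostLeaf; rw [if_pos h1]
    · unfold guestLeaf; congr 1; omega
    · unfold hostLeaf; rw [if_neg (by omega)]; congr 1; omega
  have e1 := key f g i rfl
  have e2 := key 1 1 (f i) rfl
  rw [hbase, wedge_map_canonPos] at e2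
  have hperm : wedge (List.ofFn fun j => S (graftLabelFun f g i j)) =
      (Equiv.Perm.sign (graftLabel f g i h) : ℤ) •
        wedge ((List.range (graftArity c d)).map S) := by
    rw [graftLabel, Equiv.Perm.sign_permCongr, ← wedge_map_perm, List.map_ofFn]
    rfl
  rw [hperm] at e1
  -- Multiplying by the sign, which is its own inverse, expresses the normal form by the sorted
  -- list.
  have e2' := congrArg (fun z => ((-1) ^ ((f i : ℕ) * d.arity) * ((Equiv.Perm.sign
    (1 : Equiv.Perm (Fin d.arity)) : ℤ) * ((Equiv.Perm.sign (1 : Equiv.Perm (Fin c.arity)) : ℤ) *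
      (-1) ^ ((f i : ℕ) + (f i : ℕ))))) • z) e2
  have sq : ∀ n : ℕ, ((-1 : ℤ) ^ n) * (-1) ^ n = 1 := by
    intro n
    rw [← pow_add, ← two_mul, pow_mul]
    simp
  simp only [smul_smul, Equiv.Perm.sign_one, Units.val_one, one_mul] at e2'
  rw [mul_mul_mul_comm, sq, sq, mul_one, one_smul] at e2'
  rw [← e2', smul_smul] at e1
  have hnd : ((List.range (graftArity c d)).map S).Nodup :=
    List.nodup_range.map Finset.singleton_injective
  have hpm : ∀ u : ℤˣ, (u : ℤ) = 1 ∨ (u : ℤ) = -1 := fun u => by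
    rcases Int.units_eq_one_or u with rfl | rfl <;> simp
  have hpow : ∀ n : ℕ, (-1 : ℤ) ^ n = ((-1 : ℤˣ) ^ n : ℤˣ) := fun n => by simp
  rw [eq_of_smul_wedge_eq hnd (hpm _) ?_ e1]
  · have h2 : ((f i : ℕ) + (f i : ℕ)) % 2 = 0 := by omega
    rw [pow_add, pow_add (-1 : ℤ) (f i : ℕ) (f i : ℕ), sq, add_mul, pow_add, mul_add, mul_add,
      mul_one, mul_one, pow_add, pow_add]
    ring
  · rw [hpow, hpow, hpow, hpow, hpow]
    simp only [← Units.val_mul]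
    exact hpm _

end
end Pairahedra

namespace Pairahedra
noncomputable section

/-! ## Contraction by orientations -/

/-- The linear form on the edges that belongs to a linear combination of edges. -/
def edgeForm : (Block →₀ ℤ) →ₗ[ℤ] Module.Dual ℤ (Block →₀ ℤ) :=
  Finsupp.linearCombination ℤ fun e => (Finsupp.lapply e : (Block →₀ ℤ) →ₗ[ℤ] ℤ)

/-- The contraction by elements of the exterior algebra: `e₁ ∧ ⋯ ∧ eₖ` acts as
`remove e₁ ∘ ⋯ ∘ remove eₖ`. -/
def contr : Ext →ₐ[ℤ] Module.End ℤ Ext :=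
  ExteriorAlgebra.lift ℤ
    ⟨(CliffordAlgebra.contractLeft (Q := (0 : QuadraticForm ℤ (Block →₀ ℤ)))).comp edgeForm,
      fun _ => LinearMap.ext fun _ => CliffordAlgebra.contractLeft_contractLeft _ _⟩

theorem contr_edgeVec (e : Block) : contr (edgeVec e) = remove e := by
  unfold contr edgeVec
  rw [ExteriorAlgebra.lift_ι_apply]
  simp [edgeForm, remove]

theorem contr_one (x : Ext) : contr 1 x = x := by rw [map_one]; rfl

theorem contr_mul (ω ω' x : Ext) : contr (ω * ω') x = contr ω (contr ω' x) := by
  rw [map_mul]; rfl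

theorem contr_edgeVec_mul (e : Block) (ω x : Ext) :
    contr (edgeVec e * ω) x = remove e (contr ω x) := by
  rw [contr_mul, contr_edgeVec]

theorem contr_add (ω ω' x : Ext) : contr (ω + ω') x = contr ω x + contr ω' x := by
  rw [map_add]; rfl

theorem contr_smul (n : ℤ) (ω x : Ext) : contr (n • ω) x = n • contr ω x := by
  rw [map_zsmul]; rfl

theorem contr_neg (ω x : Ext) : contr (-ω) x = - contr ω x := by
  rw [map_neg]; rfl

theorem contr_mem_wedgeSpan {S T : Set Block} {ω x : Ext} (hω : ω ∈ wedgeSpan T)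
    (hx : x ∈ wedgeSpan S) : contr ω x ∈ wedgeSpan S := by
  refine wedgeSpan_induction (p := fun ω => contr ω x ∈ wedgeSpan S) hω ?_ ?_ ?_ ?_
  · rwa [contr_one]
  · intro e _ ω _ h
    rw [contr_edgeVec_mul]
    exact remove_mem_wedgeSpan e h
  · intro ω ω' h h'
    rw [contr_add]
    exact add_mem h h'
  · intro n ω h
    rw [contr_smul]
    exact Submodule.smul_mem _ n h

theorem contr_relabel {S T : Set Block} {φ : Block → Block}
    (hφ : ∀ e ∈ T, ∀ x ∈ S, φ x = φ e → x = e) {ω x : Ext} (hω : ω ∈ wedgeSpan T)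
    (hx : x ∈ wedgeSpan S) : contr (relabel φ ω) (relabel φ x) = relabel φ (contr ω x) := by
  refine wedgeSpan_induction
    (p := fun ω => contr (relabel φ ω) (relabel φ x) = relabel φ (contr ω x)) hω ?_ ?_ ?_ ?_
  · rw [map_one, contr_one, contr_one]
  · intro e he ω hω h
    rw [map_mul, relabel_edgeVec, contr_edgeVec_mul, contr_edgeVec_mul, h,
      relabel_remove (hφ e he) (contr_mem_wedgeSpan hω hx)]
  · intro ω ω' h h'
    rw [map_add, contr_add, h, h', contr_add, map_add]
  · intro n ω h
    rw [map_smul, contr_smul, h, contr_smul, map_smul]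

theorem remove_mul_of_eq_zero {S : Set Block} {e : Block} {x y : Ext} (hx : x ∈ wedgeSpan S)
    (hy : remove e y = 0) : remove e (x * y) = remove e x * y := by
  refine wedgeSpan_induction (p := fun x => remove e (x * y) = remove e x * y) hx ?_ ?_ ?_ ?_
  · rw [one_mul, hy, remove_one, zero_mul]
  · intro a _ x _ h
    rw [mul_assoc, remove_edgeVec_mul, remove_edgeVec_mul, h, sub_mul, mul_assoc]
    split_ifs <;> simp
  · intro x x' h h'
    rw [add_mul, map_add, h, h', map_add, add_mul]
  · intro n x h
    rw [smul_mul_assoc, map_smul, h, map_smul, smul_mul_assoc]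

theorem contr_mul_right {S S' T : Set Block} (hT : Disjoint T S') {ω x y : Ext}
    (hω : ω ∈ wedgeSpan T) (hx : x ∈ wedgeSpan S) (hy : y ∈ wedgeSpan S') :
    contr ω (x * y) = contr ω x * y := by
  refine wedgeSpan_induction (p := fun ω => contr ω (x * y) = contr ω x * y) hω ?_ ?_ ?_ ?_
  · rw [contr_one, contr_one]
  · intro e he ω hω h
    rw [contr_edgeVec_mul, contr_edgeVec_mul, h,
      remove_mul_of_eq_zero (contr_mem_wedgeSpan hω hx)
        (remove_eq_zero (Set.disjoint_left.1 hT he) hy)]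
  · intro ω ω' h h'
    rw [contr_add, contr_add, h, h', add_mul]
  · intro n ω h
    rw [contr_smul, contr_smul, h, smul_mul_assoc]

/-- Each of the `T.card` removals passes `S.card` factors that it does not meet. -/
theorem contr_mul_left {S T : Finset Block} (hST : Disjoint T S) {ω x y : Ext}
    (hω : IsOrientation T ω) (hx : IsOrientation S x) :
    contr ω (x * y) = (-1 : ℤ) ^ (S.card * T.card) • (x * contr ω y) := by
  obtain ⟨l, h1, rfl, h3⟩ := hx
  obtain ⟨t, h1', rfl, h3'⟩ := hω
  rw [List.toFinset_card_of_nodup h1, List.toFinset_card_of_nodup h1']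
  have key : contr (wedge t) (wedge l * y) =
      (-1 : ℤ) ^ (l.length * t.length) • (wedge l * contr (wedge t) y) := by
    have hd : ∀ a ∈ t, a ∉ l := fun a ha ha' =>
      Finset.disjoint_left.1 hST (List.mem_toFinset.2 ha) (List.mem_toFinset.2 ha')
    clear h1 h1' hST h3 h3'
    induction t with
    | nil => simp [wedge]
    | cons a t ih =>
      rw [wedge_cons, contr_edgeVec_mul, contr_edgeVec_mul,
        ih fun b hb => hd b (List.mem_cons_of_mem _ hb), map_smul,
        remove_wedge_mul (hd a List.mem_cons_self), smul_smul, ← pow_add, List.length_cons]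
      congr 2
  rcases h3 with rfl | rfl <;> rcases h3' with rfl | rfl <;>
    simp only [contr_neg, neg_mul, (contr (wedge t)).map_neg, mul_neg, smul_neg, key]

theorem IsOrientation.contr {S T : Finset Block} {ω x : Ext} (hω : IsOrientation T ω)
    (hx : IsOrientation S x) (hTS : T ⊆ S) : IsOrientation (S \ T) (contr ω x) := by
  obtain ⟨t, h1, rfl, h3⟩ := hω
  have key : IsOrientation (S \ t.toFinset) (Pairahedra.contr (wedge t) x) := by
    clear h3
    induction t with
    | nil => simpa [wedge] using hx
    | cons a t ih =>
      rw [List.nodup_cons] at h1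
      rw [List.toFinset_cons, Finset.insert_subset_iff] at hTS
      rw [wedge_cons, contr_edgeVec_mul]
      have := (ih h1.2 hTS.2).remove (e := a)
        (Finset.mem_sdiff.2 ⟨hTS.1, fun h => h1.1 (List.mem_toFinset.1 h)⟩)
      rwa [List.toFinset_cons, Finset.insert_eq, Finset.union_comm, Finset.sdiff_union_distrib,
        ← Finset.inter_sdiff_assoc, Finset.inter_eq_left.2 Finset.sdiff_subset,
        Finset.sdiff_singleton_eq_erase]
  rcases h3 with rfl | rfl
  · exact key
  · rw [contr_neg]
    exact key.neg

theorem isOrientation_empty_iff {ω : Ext} (h : IsOrientation ∅ ω) : ω = 1 ∨ ω = -1 := by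
  obtain ⟨l, -, h2, h3⟩ := h
  rw [List.toFinset_eq_empty_iff] at h2
  subst h2
  simpa [wedge] using h3

/-! ## The subdivision map -/

variable (R : Type*) [CommRing R] {c d : Corolla}

open Classical in
/-- The generators of `Q_* Â`, extended by `0` to invalid data. -/
def Q.ofData (D : Diagram c) (f : Equiv.Perm (Fin c.arity)) (m : Finset Block) (ω : Ext) : Q R :=
  if h : m ⊆ D.edges ∧ IsOrientation m ω then Q.gen R D f m h.1 ⟨ω, h.2⟩ else 0

/-- `Q.ofData` takes no proofs as arguments, so the sets of edges and the orientations in it can be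
rewritten freely. -/
theorem Q.gen_eq_ofData (D : Diagram c) (f : Equiv.Perm (Fin c.arity)) (m : Finset Block)
    (hm : m ⊆ D.edges) (ω : Orientation m) : Q.gen R D f m hm ω = Q.ofData R D f m ω.1 := by
  rw [Q.ofData, dif_pos ⟨hm, ω.2⟩]
  rfl

theorem Q.ofData_of_valid (D : Diagram c) (f : Equiv.Perm (Fin c.arity)) {m : Finset Block}
    (hm : m ⊆ D.edges) {ω : Ext} (hω : IsOrientation m ω) :
    Q.ofData R D f m ω = Q.gen R D f m hm ⟨ω, hω⟩ := dif_pos ⟨hm, hω⟩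

theorem Q.ofData_neg (D : Diagram c) (f : Equiv.Perm (Fin c.arity)) (m : Finset Block) (ω : Ext) :
    Q.ofData R D f m (-ω) = - Q.ofData R D f m ω := by
  by_cases h : m ⊆ D.edges ∧ IsOrientation m ω
  · rw [Q.ofData_of_valid R D f h.1 h.2, Q.ofData_of_valid R D f h.1 h.2.neg]
    exact OrMod.mk_eq_neg rfl
  · rw [Q.ofData, Q.ofData, dif_neg h, dif_neg, neg_zero]
    exact fun h' => h ⟨h'.1, by simpa using h'.2.neg⟩

theorem Q.ofData_smul (D : Diagram c) (f : Equiv.Perm (Fin c.arity)) (m : Finset Block) (u : ℤˣ)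
    (ω : Ext) : Q.ofData R D f m ((u : ℤ) • ω) = u • Q.ofData R D f m ω := by
  rcases Int.units_eq_one_or u with rfl | rfl
  · simp
  · simp [Q.ofData_neg]

open Classical in
/-- The generators of `C_* Â`, extended by `0` to invalid data. -/
def C.ofData (D : Diagram c) (f : Equiv.Perm (Fin c.arity)) (ω : Ext) : C R :=
  if h : IsOrientation D.edges ω then C.gen R D f ⟨ω, h⟩ else 0

theorem C.ofData_of_valid (D : Diagram c) (f : Equiv.Perm (Fin c.arity)) {ω : Ext}
    (hω : IsOrientation D.edges ω) : C.ofData R D f ω = C.gen R D f ⟨ω, hω⟩ := dif_pos hω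

theorem C.gen_eq_ofData (D : Diagram c) (f : Equiv.Perm (Fin c.arity))
    (ω : Orientation D.edges) : C.gen R D f ω = C.ofData R D f ω.1 :=
  (C.ofData_of_valid R D f ω.2).symm

open Classical in
/-- The contribution of the binary diagram `B` to the value of the subdivision map. -/
def subdivisionTerm (D : Diagram c) (f : Equiv.Perm (Fin c.arity)) (ω : Ext)
    (B : BinaryDiagram c) : Q R :=
  if D.edges ⊆ B.1.edges then
    Q.ofData R B.1 f (B.1.edges \ D.edges) (contr ω (stdOrientation c B).1)
  else 0

theorem subdivisionTerm_of_subset {D : Diagram c} (f : Equiv.Perm (Fin c.arity)) (ω : Ext)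
    {B : BinaryDiagram c} (h : D.edges ⊆ B.1.edges) : subdivisionTerm R D f ω B =
      Q.ofData R B.1 f (B.1.edges \ D.edges) (contr ω (stdOrientation c B).1) := if_pos h

theorem subdivisionTerm_of_not_subset {D : Diagram c} (f : Equiv.Perm (Fin c.arity)) (ω : Ext)
    {B : BinaryDiagram c} (h : ¬ D.edges ⊆ B.1.edges) : subdivisionTerm R D f ω B = 0 := if_neg h

theorem subdivisionTerm_neg (D : Diagram c) (f : Equiv.Perm (Fin c.arity)) (ω : Ext)
    (B : BinaryDiagram c) : subdivisionTerm R D f (-ω) B = - subdivisionTerm R D f ω B := by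
  by_cases h : D.edges ⊆ B.1.edges
  · rw [subdivisionTerm_of_subset R f _ h, subdivisionTerm_of_subset R f _ h, contr_neg,
      Q.ofData_neg]
  · rw [subdivisionTerm_of_not_subset R f _ h, subdivisionTerm_of_not_subset R f _ h, neg_zero]

/-- The values of the subdivision map on generators: the sum of all binary diagrams that refine the
given diagram, the new edges being metric. -/
def subdivisionGen : (s : CIndex) → Orientation s.edges → Q R
  | .unit a, ω => OrMod.mk R (.unit a) ω
  | .diag c D f, ω => Equiv.Perm.sign f • ∑ B : BinaryDiagram c, subdivisionTerm R D f ω.1 B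

theorem subdivisionGen_neg (s : CIndex) (ω : Orientation s.edges) :
    subdivisionGen R s (-ω) = - subdivisionGen R s ω := by
  cases s with
  | unit a => exact OrMod.mk_neg _ _
  | diag c D f =>
    simp only [subdivisionGen]
    rw [← smul_neg, ← Finset.sum_neg_distrib]
    congr 1
    exact Finset.sum_congr rfl fun B _ => subdivisionTerm_neg R D f ω.1 B

/-- The subdivision map `q`. -/
def subdivision : C R →ₗ[R] Q R := OrMod.lift (subdivisionGen R) (subdivisionGen_neg R)

theorem subdivision_mk (s : CIndex) (ω : Orientation s.edges) :
    subdivision R (OrMod.mk R s ω) = subdivisionGen R s ω := OrMod.lift_mk _ _ _ _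

theorem subdivision_ofData (D : Diagram c) (f : Equiv.Perm (Fin c.arity)) {ω : Ext}
    (hω : IsOrientation D.edges ω) : subdivision R (C.ofData R D f ω) =
      Equiv.Perm.sign f • ∑ B : BinaryDiagram c, subdivisionTerm R D f ω B := by
  rw [C.ofData_of_valid R D f hω]
  exact subdivision_mk R (CIndex.diag c D f) _

/-! ### Equivariance, units, corollas and degrees -/

theorem Q.act_ofData (σ : ∀ n, Equiv.Perm (Fin n)) (D : Diagram c) (f : Equiv.Perm (Fin c.arity))
    (m : Finset Block) (ω : Ext) :
    Q.act R σ (Q.ofData R D f m ω) = Q.ofData R D (f * σ c.arity) m ω := by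
  by_cases h : m ⊆ D.edges ∧ IsOrientation m ω
  · rw [Q.ofData_of_valid R D f h.1 h.2, Q.ofData_of_valid R D _ h.1 h.2]
    exact OrMod.lift_mk _ _ _ _
  · rw [Q.ofData, Q.ofData, dif_neg h, dif_neg h, map_zero]

theorem C.act_ofData (σ : ∀ n, Equiv.Perm (Fin n)) (D : Diagram c) (f : Equiv.Perm (Fin c.arity))
    (ω : Ext) : C.act R σ (C.ofData R D f ω) =
      Equiv.Perm.sign (σ c.arity) • C.ofData R D (f * σ c.arity) ω := by
  by_cases h : IsOrientation D.edges ω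
  · rw [C.ofData_of_valid R D f h, C.ofData_of_valid R D _ h]
    exact OrMod.lift_mk _ _ _ _
  · rw [C.ofData, C.ofData, dif_neg h, dif_neg h, map_zero, smul_zero]

theorem map_units_smul {M N : Type*} [AddCommGroup M] [AddCommGroup N] [Module R M] [Module R N]
    (φ : M →ₗ[R] N) (u : ℤˣ) (x : M) : φ (u • x) = u • φ x := by
  rw [Units.smul_def, Units.smul_def, map_zsmul]

theorem C.act_unit (σ : ∀ n, Equiv.Perm (Fin n)) (a : Color) :
    C.act R σ (C.unit R a) = C.unit R a := OrMod.lift_mk _ _ (CIndex.unit a) _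

theorem Q.act_unit (σ : ∀ n, Equiv.Perm (Fin n)) (a : Color) :
    Q.act R σ (Q.unit R a) = Q.unit R a := OrMod.lift_mk _ _ (QIndex.unit a) _

theorem OrMod.mk_congr {X : Type} {S : X → Finset Block} {x : X} {ω ω' : Orientation (S x)}
    (h : ω.1 = ω'.1) : OrMod.mk R x ω = OrMod.mk R x ω' :=
  congrArg _ (Subtype.ext h)

/-- Linear maps on `C_* Â` are determined by the values on units and on diagrams. -/
theorem C.hom_ext {N : Type*} [AddCommGroup N] [Module R N] {φ ψ : C R →ₗ[R] N}
    (hu : ∀ a, φ (C.unit R a) = ψ (C.unit R a))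
    (hd : ∀ (c : Corolla) (D : Diagram c) (f : Equiv.Perm (Fin c.arity)) (ω : Ext),
      IsOrientation D.edges ω → φ (C.ofData R D f ω) = ψ (C.ofData R D f ω)) : φ = ψ := by
  refine OrMod.hom_ext R fun s ω => ?_
  cases s with
  | unit a =>
    rcases isOrientation_empty_iff ω.2 with h | h
    · have e : OrMod.mk R (CIndex.unit a) ω = C.unit R a := OrMod.mk_congr R h
      rw [e, hu]
    · have e : OrMod.mk R (CIndex.unit a) ω = - C.unit R a := OrMod.mk_eq_neg h
      rw [e, map_neg, map_neg, hu]
  | diag c D f =>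
    have e : OrMod.mk R (CIndex.diag c D f) ω = C.ofData R D f ω.1 := C.gen_eq_ofData R D f ω
    rw [e]
    exact hd c D f ω.1 ω.2

theorem subdivision_unit (a : Color) : subdivision R (C.unit R a) = Q.unit R a :=
  subdivision_mk R (.unit a) _

/-- The factor `sign f` in the formula for `q` absorbs the sign by which the action on `C` differs
from that on `Q`. -/
theorem subdivision_act (σ : ∀ n, Equiv.Perm (Fin n)) (z : C R) :
    subdivision R (C.act R σ z) = Q.act R σ (subdivision R z) := by
  have : (subdivision R).comp (C.act R σ) = (Q.act R σ).comp (subdivision R) := by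
    refine C.hom_ext R (fun a => ?_) fun c D f ω hω => ?_
    · rw [LinearMap.comp_apply, LinearMap.comp_apply, C.act_unit, subdivision_unit, Q.act_unit]
    · rw [LinearMap.comp_apply, LinearMap.comp_apply, C.act_ofData, map_units_smul,
        subdivision_ofData R D _ hω, subdivision_ofData R D f hω, map_units_smul, map_sum, smul_smul]
      congr 1
      · rw [Equiv.Perm.sign_mul, mul_left_comm, Int.units_mul_self, mul_one]
      · refine Finset.sum_congr rfl fun B _ => ?_
        by_cases h : D.edges ⊆ B.1.edges
        · rw [subdivisionTerm_of_subset R _ _ h, subdivisionTerm_of_subset R _ _ h, Q.act_ofData]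
        · rw [subdivisionTerm_of_not_subset R _ _ h, subdivisionTerm_of_not_subset R _ _ h, map_zero]
  exact LinearMap.congr_fun this z

theorem subdivision_corolla (c : Corolla) :
    subdivision R (C.gen R (Diagram.ofCorolla c) 1 ⟨1, isOrientation_empty_one⟩) =
      ∑ B : BinaryDiagram c, Q.gen R B.1 1 B.1.edges subset_rfl (stdOrientation c B) := by
  refine (subdivision_mk R (CIndex.diag c (Diagram.ofCorolla c) 1) _).trans ?_
  change Equiv.Perm.sign 1 • ∑ B : BinaryDiagram c,
    subdivisionTerm R (Diagram.ofCorolla c) 1 1 B = _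
  rw [Equiv.Perm.sign_one, one_smul]
  refine Finset.sum_congr rfl fun B _ => ?_
  refine (subdivisionTerm_of_subset R 1 1 (Finset.empty_subset _)).trans ?_
  refine Eq.trans ?_ (Q.gen_eq_ofData R B.1 1 B.1.edges subset_rfl (stdOrientation c B)).symm
  change Q.ofData R B.1 1 (B.1.edges \ ∅) (contr 1 _) = _
  rw [Finset.sdiff_empty, contr_one]

/-- A binary diagram has `c.arity - 2` edges, so the number of metric edges added to `D` is the
degree of `D`. -/
theorem subdivision_mem_part (n : ℤ) (x : List Color) (y : Color) (z : C R)
    (hz : z ∈ C.part R n x y) : subdivision R z ∈ Q.part R n x y := by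
  induction hz using Submodule.span_induction with
  | mem z h =>
    obtain ⟨s, ω, h1, h2, rfl⟩ := h
    rw [subdivision_mk]
    cases s with
    | unit a => exact Submodule.subset_span ⟨.unit a, ω, h1, h2, rfl⟩
    | diag c D f =>
      rw [subdivisionGen, Units.smul_def]
      refine zsmul_mem (sum_mem fun B _ => ?_) _
      by_cases h : D.edges ⊆ B.1.edges
      · have hω : IsOrientation D.edges ω.1 := ω.2
        rw [subdivisionTerm_of_subset R _ _ h,
          Q.ofData_of_valid R _ _ Finset.sdiff_subset (hω.contr (stdOrientation c B).2 h)]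
        refine Submodule.subset_span ⟨.diag c B.1 f _ Finset.sdiff_subset, _, ?_, h2, rfl⟩
        change ((B.1.edges \ D.edges).card : ℤ) = n
        rw [← h1]
        change _ = (c.arity : ℤ) - D.edges.card - 2
        have := B.card
        have := Finset.card_le_card h
        rw [Finset.card_sdiff_of_subset h]
        omega
      · rw [subdivisionTerm_of_not_subset R _ _ h]
        exact zero_mem _
  | zero => rw [map_zero]; exact zero_mem _
  | add z z' _ _ h h' => rw [map_add]; exact add_mem h h'
  | smul a z _ h => rw [map_smul]; exact Submodule.smul_mem _ a h

end
end Pairahedra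

namespace Pairahedra
noncomputable section

/-! ## The subdivision map and compositions -/

variable {c d : Corolla} {p : ℕ}

/-- The new edge belongs to both grafts and drops out of the difference, in accordance with its
being non-metric. -/
theorem graft_sdiff (h : CanGraft c d p) {D B : Diagram c} {E B' : Diagram d} (hD : D.edges ⊆ B.edges)
    (hE : E.edges ⊆ B'.edges) : (graft h B B').edges \ (graft h D E).edges =
      graftMetric c d p (B.edges \ D.edges) (B'.edges \ E.edges) := by
  ext b
  rw [Finset.mem_sdiff, mem_graft, mem_graft, graftMetric, Finset.mem_union, Finset.mem_image,
    Finset.mem_image]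
  constructor
  · rintro ⟨⟨a, ha, rfl⟩ | ⟨a, ha, rfl⟩ | rfl, h2⟩
    · exact Or.inl ⟨a, Finset.mem_sdiff.2 ⟨ha, fun h => h2 (Or.inl ⟨a, h, rfl⟩)⟩, rfl⟩
    · exact Or.inr ⟨a, Finset.mem_sdiff.2 ⟨ha, fun h => h2 (Or.inr (Or.inl ⟨a, h, rfl⟩))⟩, rfl⟩
    · exact absurd (Or.inr (Or.inr rfl)) h2
  · have hd := Finset.disjoint_left.1 (h.disjoint_host_guest B B')
    have hn := Finset.disjoint_left.1 (h.disjoint_newEdge B B')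
    rintro (⟨a, ha, rfl⟩ | ⟨a, ha, rfl⟩) <;> rw [Finset.mem_sdiff] at ha
    · have ha' := Finset.mem_image_of_mem (hostBlock c d p) ha.1
      refine ⟨Or.inl ⟨a, ha.1, rfl⟩, ?_⟩
      rintro (⟨x, hx, he⟩ | ⟨x, hx, he⟩ | he)
      · exact ha.2 (h.injOn_host B (hD hx) ha.1 he ▸ hx)
      · exact hd ha' (he ▸ Finset.mem_image_of_mem _ (hE hx))
      · exact hn (Finset.mem_union_left _ ha') (Finset.mem_singleton.2 he)
    · have ha' := Finset.mem_image_of_mem (guestBlock c d p) ha.1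
      refine ⟨Or.inr (Or.inl ⟨a, ha.1, rfl⟩), ?_⟩
      rintro (⟨x, hx, he⟩ | ⟨x, hx, he⟩ | he)
      · exact hd (he ▸ Finset.mem_image_of_mem _ (hD hx)) ha'
      · exact ha.2 (h.injOn_guest B' (hE hx) ha.1 he ▸ hx)
      · exact hn (Finset.mem_union_right _ ha') (Finset.mem_singleton.2 he)

/-- The last factor, the new edge, acts first and cancels the leading factor in
`stdOrientation_graft`. Then `ω'` passes the orientation of `B`, which gives the sign with exponent
`B.1.edges.card * E.edges.card`, and `ω` acts on the left factor alone. -/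
theorem contr_graft (h : CanGraft c d p) {D : Diagram c} {E : Diagram d} (B : BinaryDiagram c)
    (B' : BinaryDiagram d) (hD : D.edges ⊆ B.1.edges) (hE : E.edges ⊆ B'.1.edges) {ω ω' : Ext}
    (hω : IsOrientation D.edges ω) (hω' : IsOrientation E.edges ω') :
    contr (relabel (hostBlock c d p) ω * relabel (guestBlock c d p) ω' * edgeVec (newEdge c d p))
        (stdOrientation _ (graftBinary h B B')).1 =
      (-1 : ℤ) ^ (graftShift c d p * (graftArity c d - graftShift c d p) +
        (p + 1) * (d.arity - 1) + B.1.edges.card * B'.1.edges.card +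
          B.1.edges.card * E.edges.card) •
        (relabel (hostBlock c d p) (contr ω (stdOrientation c B).1) *
          relabel (guestBlock c d p) (contr ω' (stdOrientation d B').1)) := by
  have iH := h.injOn_host B.1
  have iG := h.injOn_guest B'.1
  have hd := h.disjoint_host_guest B.1 B'.1
  have oD := hω.relabel (iH.mono (Finset.coe_subset.2 hD))
  have oE := hω'.relabel (iG.mono (Finset.coe_subset.2 hE))
  have oB := (stdOrientation c B).2.relabel iH
  have oB' := (stdOrientation d B').2.relabel iG
  have h0 : remove (newEdge c d p) (relabel (hostBlock c d p) (stdOrientation c B).1 *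
      relabel (guestBlock c d p) (stdOrientation d B').1) = 0 :=
    remove_eq_zero (fun hm => Finset.disjoint_left.1 (h.disjoint_newEdge B.1 B'.1)
      (Finset.mem_coe.1 hm) (Finset.mem_singleton_self _)) (oB.mul oB' hd).mem_wedgeSpan
  have eB := contr_relabel (φ := hostBlock c d p) (S := B.1.edges) (T := D.edges)
    (fun e he x hx hxe => iH hx (hD he) hxe) hω.mem_wedgeSpan (stdOrientation c B).2.mem_wedgeSpan
  have eB' := contr_relabel (φ := guestBlock c d p) (S := B'.1.edges) (T := E.edges)
    (fun e he x hx hxe => iG hx (hE he) hxe) hω'.mem_wedgeSpan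
    (stdOrientation d B').2.mem_wedgeSpan
  have d1 := Finset.disjoint_of_subset_right (Finset.image_subset_image hE) hd
  have d2 := Finset.disjoint_of_subset_left (Finset.image_subset_image hD) hd
  rw [stdOrientation_graft, map_smul, contr_mul, contr_mul, contr_edgeVec, remove_edgeVec_mul,
    if_pos rfl, h0, mul_zero, sub_zero, contr_mul_left d1.symm oE oB, map_smul,
    contr_mul_right (Finset.disjoint_coe.2 d2) oD.mem_wedgeSpan oB.mem_wedgeSpan
      (contr_mem_wedgeSpan oE.mem_wedgeSpan oB'.mem_wedgeSpan), eB, eB', smul_smul, ← pow_add,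
    Finset.card_image_of_injOn iH,
    Finset.card_image_of_injOn (iG.mono (Finset.coe_subset.2 hE))]

theorem negOnePow_natCast (n : ℕ) : ((Int.negOnePow (n : ℤ) : ℤˣ) : ℤ) = (-1) ^ n := by
  rw [Int.negOnePow_def, zpow_natCast]
  simp

/-- The sign of the composition in `C_* Â` is the sign that the standard orientations require. -/
theorem sign_comp {f : Equiv.Perm (Fin c.arity)} {g : Equiv.Perm (Fin d.arity)} {i : ℕ}
    (h : 1 ≤ i ∧ i ≤ c.arity) (h' : CanGraft c d (f (pos h))) (E : Diagram d) {b b' : ℕ}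
    (hb : b + 2 = c.arity) (hb' : b' + 2 = d.arity) :
    ((Int.negOnePow (i * (d.arity + 1) + c.arity * E.degree) : ℤˣ) : ℤ) *
      (Equiv.Perm.sign (graftLabel f g (pos h) h') : ℤ) *
      (-1) ^ (graftShift c d (f (pos h)) * (graftArity c d - graftShift c d (f (pos h))) +
        ((f (pos h) : ℕ) + 1) * (d.arity - 1) + b * b' + b * E.edges.card) =
    Equiv.Perm.sign f * Equiv.Perm.sign g := by
  have hE := E.card_edges_le
  have h1 : (i * (d.arity + 1) + c.arity * E.degree : ℤ) =
      ((i * (d.arity + 1) + c.arity * (b' - E.edges.card) : ℕ) : ℤ) := by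
    rw [Diagram.degree, ← hb']
    push_cast [Nat.cast_sub (show E.edges.card ≤ b' by omega)]
    ring
  rw [h1, negOnePow_natCast, sign_graftLabel]
  generalize graftShift c d (f (pos h)) * (graftArity c d - graftShift c d (f (pos h))) = s
  obtain ⟨i, rfl⟩ : ∃ j, i = j + 1 := ⟨i - 1, by omega⟩
  change _ * (_ * _ * (-1) ^ ((i + 1 - 1 + _) * _ + s)) * _ = _
  rw [Nat.add_sub_cancel]
  generalize ((f (pos h) : Fin c.arity) : ℕ) = p
  generalize ((Equiv.Perm.sign f : ℤˣ) : ℤ) = u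
  generalize ((Equiv.Perm.sign g : ℤˣ) : ℤ) = v
  rw [← hb, ← hb']
  obtain ⟨r, hr⟩ : ∃ r, b' = E.edges.card + r := ⟨b' - E.edges.card, by omega⟩
  rw [hr, Nat.add_sub_cancel_left, show E.edges.card + r + 2 - 1 = E.edges.card + r + 1 by omega]
  generalize E.edges.card = e
  -- With `e` edges in `E`, of degree `r`, the exponents other than those in `u` and `v` add up to
  -- an even number.
  have key : (-1) ^ ((i + 1) * (e + r + 2 + 1) + (b + 2) * r) *
      (u * v * (-1) ^ ((i + p) * (e + r + 2 + 1) + s)) *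
      (-1) ^ (s + (p + 1) * (e + r + 1) + b * (e + r) + b * e) =
      u * v * (-1) ^ (2 * (i * (e + r + 3) + p * (e + r + 2) + (e + r + 2) + b * r + r +
        b * e + s)) := by
    ring
  rw [key, pow_mul, neg_one_sq, one_pow, mul_one]

/-! ### Compositions evaluated on units and diagrams -/

variable (R : Type*) [CommRing R]

theorem C.comp_mk (i : ℕ) (s : CIndex) (ω : Orientation s.edges) (t : CIndex)
    (ω' : Orientation t.edges) :
    C.comp R i (OrMod.mk R s ω) (OrMod.mk R t ω') = C.compGen R i s ω t ω' := by
  rw [C.comp, OrMod.lift_mk, OrMod.lift_mk]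

theorem Q.comp_mk (i : ℕ) (s : QIndex) (ω : Orientation s.metric) (t : QIndex)
    (ω' : Orientation t.metric) :
    Q.comp R i (OrMod.mk R s ω) (OrMod.mk R t ω') = Q.compGen R i s ω t ω' := by
  rw [Q.comp, OrMod.lift_mk, OrMod.lift_mk]

theorem C.comp_unit_unit (i : ℕ) (a b : Color) : C.comp R i (C.unit R a) (C.unit R b) =
    if i = 1 ∧ b = a then C.unit R b else 0 :=
  (C.comp_mk R i (.unit a) _ (.unit b) _).trans
    (if_congr Iff.rfl (OrMod.mk_congr R (one_mul _)) rfl)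

theorem Q.comp_unit_unit (i : ℕ) (a b : Color) : Q.comp R i (Q.unit R a) (Q.unit R b) =
    if i = 1 ∧ b = a then Q.unit R b else 0 :=
  (Q.comp_mk R i (.unit a) _ (.unit b) _).trans
    (if_congr Iff.rfl (OrMod.mk_congr R (one_mul _)) rfl)

theorem C.comp_unit_left (i : ℕ) (a : Color) (D : Diagram c) (f : Equiv.Perm (Fin c.arity))
    {ω : Ext} (hω : IsOrientation D.edges ω) : C.comp R i (C.unit R a) (C.ofData R D f ω) =
      if i = 1 ∧ c.root = a then C.ofData R D f ω else 0 := by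
  rw [C.ofData_of_valid R D f hω]
  exact (C.comp_mk R i (.unit a) _ (.diag c D f) ⟨ω, hω⟩).trans
    (if_congr Iff.rfl (OrMod.mk_congr R (one_mul _)) rfl)

theorem Q.comp_unit_left (i : ℕ) (a : Color) (D : Diagram c) (f : Equiv.Perm (Fin c.arity))
    (m : Finset Block) (ω : Ext) : Q.comp R i (Q.unit R a) (Q.ofData R D f m ω) =
      if i = 1 ∧ c.root = a then Q.ofData R D f m ω else 0 := by
  by_cases hv : m ⊆ D.edges ∧ IsOrientation m ω
  · rw [Q.ofData_of_valid R D f hv.1 hv.2]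
    exact (Q.comp_mk R i (.unit a) _ (.diag c D f m hv.1) ⟨ω, hv.2⟩).trans
      (if_congr Iff.rfl (OrMod.mk_congr R (one_mul _)) rfl)
  · rw [Q.ofData, dif_neg hv, map_zero, ite_self]

open Classical in
theorem C.comp_unit_right (i : ℕ) (D : Diagram c) (f : Equiv.Perm (Fin c.arity)) {ω : Ext}
    (hω : IsOrientation D.edges ω) (a : Color) :
    C.comp R i (C.ofData R D f ω) (C.unit R a) =
      if ∃ h : 1 ≤ i ∧ i ≤ c.arity, c.leafColor (f (pos h)) = a then C.ofData R D f ω else 0 := by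
  rw [C.ofData_of_valid R D f hω]
  refine (C.comp_mk R i (.diag c D f) ⟨ω, hω⟩ (.unit a) _).trans ?_
  by_cases h : 1 ≤ i ∧ i ≤ c.arity
  · by_cases h' : c.leafColor (f (pos h)) = a
    · rw [if_pos ⟨h, h'⟩]
      exact (dif_pos h).trans ((if_pos h').trans (OrMod.mk_congr R (mul_one _)))
    · rw [if_neg fun ⟨_, h''⟩ => h' h'']
      exact (dif_pos h).trans (if_neg h')
  · rw [if_neg fun h'' => h h''.1]
    exact dif_neg h

open Classical in
theorem Q.comp_unit_right (i : ℕ) (D : Diagram c) (f : Equiv.Perm (Fin c.arity))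
    (m : Finset Block) (ω : Ext) (a : Color) :
    Q.comp R i (Q.ofData R D f m ω) (Q.unit R a) =
      if ∃ h : 1 ≤ i ∧ i ≤ c.arity, c.leafColor (f (pos h)) = a then Q.ofData R D f m ω else 0 := by
  by_cases hv : m ⊆ D.edges ∧ IsOrientation m ω
  · rw [Q.ofData_of_valid R D f hv.1 hv.2]
    refine (Q.comp_mk R i (.diag c D f m hv.1) ⟨ω, hv.2⟩ (.unit a) _).trans ?_
    by_cases h : 1 ≤ i ∧ i ≤ c.arity
    · by_cases h' : c.leafColor (f (pos h)) = a
      · rw [if_pos ⟨h, h'⟩]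
        exact (dif_pos h).trans ((if_pos h').trans (OrMod.mk_congr R (mul_one _)))
      · rw [if_neg fun ⟨_, h''⟩ => h' h'']
        exact (dif_pos h).trans (if_neg h')
    · rw [if_neg fun h'' => h h''.1]
      exact dif_neg h
  · rw [Q.ofData, dif_neg hv, map_zero, LinearMap.zero_apply, ite_self]

theorem C.comp_ofData {i : ℕ} {D : Diagram c} (f : Equiv.Perm (Fin c.arity)) {ω : Ext}
    {E : Diagram d} (g : Equiv.Perm (Fin d.arity)) {ω' : Ext} (hω : IsOrientation D.edges ω)
    (hω' : IsOrientation E.edges ω') (h : 1 ≤ i ∧ i ≤ c.arity) (h' : CanGraft c d (f (pos h))) :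
    C.comp R i (C.ofData R D f ω) (C.ofData R E g ω') =
      Int.negOnePow (i * (d.arity + 1) + c.arity * E.degree) •
        C.ofData R (graft h' D E) (graftLabel f g (pos h) h')
          (relabel (hostBlock c d (f (pos h))) ω * relabel (guestBlock c d (f (pos h))) ω' *
            edgeVec (newEdge c d (f (pos h)))) := by
  rw [C.ofData_of_valid R D f hω, C.ofData_of_valid R E g hω',
    C.ofData_of_valid R _ _ (isOrientation_graft h' D E hω hω')]
  exact (C.comp_mk R i (.diag c D f) ⟨ω, hω⟩ (.diag d E g) ⟨ω', hω'⟩).trans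
    ((dif_pos h).trans (dif_pos h'))

theorem C.comp_ofData_eq_zero {i : ℕ} {D : Diagram c} (f : Equiv.Perm (Fin c.arity)) {ω : Ext}
    {E : Diagram d} (g : Equiv.Perm (Fin d.arity)) {ω' : Ext} (hω : IsOrientation D.edges ω)
    (hω' : IsOrientation E.edges ω') (h : ∀ h : 1 ≤ i ∧ i ≤ c.arity, ¬ CanGraft c d (f (pos h))) :
    C.comp R i (C.ofData R D f ω) (C.ofData R E g ω') = 0 := by
  rw [C.ofData_of_valid R D f hω, C.ofData_of_valid R E g hω']
  refine (C.comp_mk R i (.diag c D f) ⟨ω, hω⟩ (.diag d E g) ⟨ω', hω'⟩).trans ?_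
  by_cases h1 : 1 ≤ i ∧ i ≤ c.arity
  · exact (dif_pos h1).trans (dif_neg (h h1))
  · exact dif_neg h1

theorem Q.comp_ofData {i : ℕ} {D : Diagram c} (f : Equiv.Perm (Fin c.arity)) {m : Finset Block}
    {ω : Ext} {E : Diagram d} (g : Equiv.Perm (Fin d.arity)) {m' : Finset Block} {ω' : Ext}
    (hm : m ⊆ D.edges) (hω : IsOrientation m ω) (hm' : m' ⊆ E.edges) (hω' : IsOrientation m' ω')
    (h : 1 ≤ i ∧ i ≤ c.arity) (h' : CanGraft c d (f (pos h))) :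
    Q.comp R i (Q.ofData R D f m ω) (Q.ofData R E g m' ω') =
      Q.ofData R (graft h' D E) (graftLabel f g (pos h) h')
        (graftMetric c d (f (pos h)) m m')
        (relabel (hostBlock c d (f (pos h))) ω * relabel (guestBlock c d (f (pos h))) ω') := by
  rw [Q.ofData_of_valid R D f hm hω, Q.ofData_of_valid R E g hm' hω',
    Q.ofData_of_valid R _ _ (graftMetric_subset h' D E hm hm')
      (isOrientation_graftMetric h' D E hm hm' hω hω')]
  refine (Q.comp_mk R i (.diag c D f m hm) ⟨ω, hω⟩ (.diag d E g m' hm') ⟨ω', hω'⟩).trans ((dif_pos h).trans (dif_pos h'))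

theorem Q.comp_ofData_eq_zero {i : ℕ} (D : Diagram c) (f : Equiv.Perm (Fin c.arity))
    (m : Finset Block) (ω : Ext) (E : Diagram d) (g : Equiv.Perm (Fin d.arity))
    (m' : Finset Block) (ω' : Ext)
    (h : ∀ h : 1 ≤ i ∧ i ≤ c.arity, ¬ CanGraft c d (f (pos h))) :
    Q.comp R i (Q.ofData R D f m ω) (Q.ofData R E g m' ω') = 0 := by
  by_cases hv : m ⊆ D.edges ∧ IsOrientation m ω
  · by_cases hv' : m' ⊆ E.edges ∧ IsOrientation m' ω'
    · rw [Q.ofData_of_valid R D f hv.1 hv.2, Q.ofData_of_valid R E g hv'.1 hv'.2]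
      refine (Q.comp_mk R i (.diag c D f m hv.1) ⟨ω, hv.2⟩ (.diag d E g m' hv'.1)
        ⟨ω', hv'.2⟩).trans ?_
      by_cases h1 : 1 ≤ i ∧ i ≤ c.arity
      · exact (dif_pos h1).trans (dif_neg (h h1))
      · exact dif_neg h1
    · rw [Q.ofData, Q.ofData, dif_neg hv', map_zero]
  · rw [Q.ofData, dif_neg hv, map_zero, LinearMap.zero_apply]

/-- Cutting at the new edge (`CanGraft.exists_graft_eq`) identifies the binary diagrams that contain
it with pairs of binary diagrams. -/
theorem sum_binary_graft {M : Type*} [AddCommMonoid M] (h : CanGraft c d p)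
    (F : BinaryDiagram (graftCorolla c d p) → M)
    (hF : ∀ G, newEdge c d p ∉ G.1.edges → F G = 0) :
    ∑ G, F G = ∑ B : BinaryDiagram c, ∑ B' : BinaryDiagram d, F (graftBinary h B B') := by
  rw [← Fintype.sum_prod_type' fun B B' => F (graftBinary h B B')]
  refine (Fintype.sum_of_injective (fun x : BinaryDiagram c × BinaryDiagram d =>
    graftBinary h x.1 x.2) ?_ _ _ ?_ fun _ => rfl).symm
  · intro x y hxy
    have := graft_injective (h := h) (congrArg Subtype.val hxy)
    exact Prod.ext (Subtype.ext this.1) (Subtype.ext this.2)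
  · intro G hG
    refine hF G fun hn => hG ?_
    obtain ⟨D, E, hDE⟩ := h.exists_graft_eq G.1 hn
    have hb := isBinary_graft.1 ((congrArg Diagram.degree hDE).trans G.2)
    exact ⟨(⟨D, hb.1⟩, ⟨E, hb.2⟩), Subtype.ext hDE⟩

theorem map_units_smul_sum₂ {M N P ι κ : Type*} [AddCommGroup M] [AddCommGroup N] [AddCommGroup P]
    [Module R M] [Module R N] [Module R P] [Fintype ι] [Fintype κ] (φ : M →ₗ[R] N →ₗ[R] P)
    (u v : ℤˣ) (x : ι → M) (y : κ → N) :
    φ (u • ∑ a, x a) (v • ∑ b, y b) = (u * v) • ∑ a, ∑ b, φ (x a) (y b) := by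
  rw [map_units_smul, map_units_smul, Units.smul_def u, LinearMap.smul_apply, ← Units.smul_def,
    smul_smul, mul_comm, map_sum φ, LinearMap.sum_apply]
  simp only [map_sum]

/-- Compatibility with compositions holds term by term: the underlying data agree by `graft_sdiff`
and `contr_graft`, and the signs by `sign_comp`. -/
theorem subdivisionTerm_graft {i : ℕ} {D : Diagram c} (f : Equiv.Perm (Fin c.arity)) {ω : Ext}
    {E : Diagram d} (g : Equiv.Perm (Fin d.arity)) {ω' : Ext} (hω : IsOrientation D.edges ω)
    (hω' : IsOrientation E.edges ω') (h : 1 ≤ i ∧ i ≤ c.arity) (h' : CanGraft c d (f (pos h)))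
    (B : BinaryDiagram c) (B' : BinaryDiagram d) :
    (Int.negOnePow (i * (d.arity + 1) + c.arity * E.degree) *
      Equiv.Perm.sign (graftLabel f g (pos h) h')) •
        subdivisionTerm R (graft h' D E) (graftLabel f g (pos h) h')
          (relabel (hostBlock c d (f (pos h))) ω * relabel (guestBlock c d (f (pos h))) ω' *
            edgeVec (newEdge c d (f (pos h)))) (graftBinary h' B B') =
      (Equiv.Perm.sign f * Equiv.Perm.sign g) •
        Q.comp R i (subdivisionTerm R D f ω B) (subdivisionTerm R E g ω' B') := by
  by_cases hD : D.edges ⊆ B.1.edges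
  · by_cases hE : E.edges ⊆ B'.1.edges
    · have hs : (graft h' D E).edges ⊆ (graftBinary h' B B').1.edges :=
        graft_subset_iff.2 ⟨hD, hE⟩
      have hsd : (graftBinary h' B B').1.edges \ (graft h' D E).edges = _ := graft_sdiff h' hD hE
      have hsign := sign_comp (g := g) h h' E B.card B'.card
      rw [subdivisionTerm_of_subset R _ _ hs, subdivisionTerm_of_subset R _ _ hD,
        subdivisionTerm_of_subset R _ _ hE, Q.comp_ofData R f g Finset.sdiff_subset
          (hω.contr (stdOrientation c B).2 hD) Finset.sdiff_subset
          (hω'.contr (stdOrientation d B').2 hE) h h', hsd, contr_graft h' B B' hD hE hω hω']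
      generalize (graftShift c d (f (pos h)) * (graftArity c d - graftShift c d (f (pos h))) +
        ((f (pos h) : ℕ) + 1) * (d.arity - 1) + B.1.edges.card * B'.1.edges.card +
        B.1.edges.card * E.edges.card) = r at hsign ⊢
      have hr : ((-1 : ℤ) ^ r) = (((-1) ^ r : ℤˣ) : ℤ) := by simp
      rw [hr, Q.ofData_smul, smul_smul]
      rw [hr] at hsign
      congr 1
      exact Units.ext hsign
    · have hs : ¬ (graft h' D E).edges ⊆ (graftBinary h' B B').1.edges :=
        fun hs => hE (graft_subset_iff.1 hs).2
      rw [subdivisionTerm_of_not_subset R _ _ hs, subdivisionTerm_of_not_subset R _ _ hE,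
        map_zero, smul_zero, smul_zero]
  · have hs : ¬ (graft h' D E).edges ⊆ (graftBinary h' B B').1.edges :=
      fun hs => hD (graft_subset_iff.1 hs).1
    rw [subdivisionTerm_of_not_subset R _ _ hs, subdivisionTerm_of_not_subset R _ _ hD,
      map_zero, LinearMap.zero_apply, smul_zero, smul_zero]

theorem subdivision_comp_ofData (i : ℕ) (D : Diagram c) (f : Equiv.Perm (Fin c.arity)) {ω : Ext}
    (hω : IsOrientation D.edges ω) (E : Diagram d) (g : Equiv.Perm (Fin d.arity)) {ω' : Ext}
    (hω' : IsOrientation E.edges ω') :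
    subdivision R (C.comp R i (C.ofData R D f ω) (C.ofData R E g ω')) =
      Q.comp R i (subdivision R (C.ofData R D f ω)) (subdivision R (C.ofData R E g ω')) := by
  rw [subdivision_ofData R D f hω, subdivision_ofData R E g hω', map_units_smul_sum₂]
  by_cases hh : ∃ h : 1 ≤ i ∧ i ≤ c.arity, CanGraft c d (f (pos h))
  · obtain ⟨h, h'⟩ := hh
    rw [C.comp_ofData R f g hω hω' h h', map_units_smul,
      subdivision_ofData R _ _ (isOrientation_graft h' D E hω hω'), smul_smul,
      sum_binary_graft h', Finset.smul_sum, Finset.smul_sum]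
    · refine Finset.sum_congr rfl fun B _ => ?_
      rw [Finset.smul_sum, Finset.smul_sum]
      exact Finset.sum_congr rfl fun B' _ => subdivisionTerm_graft R f g hω hω' h h' B B'
    · intro G hG
      exact subdivisionTerm_of_not_subset R _ _
        fun hs => hG (hs (mem_graft.2 (Or.inr (Or.inr rfl))))
  · have hh' : ∀ h : 1 ≤ i ∧ i ≤ c.arity, ¬ CanGraft c d (f (pos h)) := fun h h' => hh ⟨h, h'⟩
    rw [C.comp_ofData_eq_zero R f g hω hω' hh', map_zero, Finset.sum_eq_zero, smul_zero]
    refine fun B _ => Finset.sum_eq_zero fun B' _ => ?_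
    by_cases hD : D.edges ⊆ B.1.edges
    · by_cases hE : E.edges ⊆ B'.1.edges
      · rw [subdivisionTerm_of_subset R _ _ hD, subdivisionTerm_of_subset R _ _ hE,
          Q.comp_ofData_eq_zero R _ _ _ _ _ _ _ _ hh']
      · rw [subdivisionTerm_of_not_subset R _ _ hE, map_zero]
    · rw [subdivisionTerm_of_not_subset R _ _ hD, map_zero, LinearMap.zero_apply]

theorem subdivision_comp (i : ℕ) (z z' : C R) :
    subdivision R (C.comp R i z z') = Q.comp R i (subdivision R z) (subdivision R z') := by
  have key : (C.comp R i).compr₂ (subdivision R) =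
      (Q.comp R i).compl₁₂ (subdivision R) (subdivision R) := by
    refine C.hom_ext R (fun a => C.hom_ext R (fun b => ?_) fun d E g ω' hω' => ?_)
      fun c D f ω hω => C.hom_ext R (fun b => ?_) fun d E g ω' hω' => ?_ <;>
      rw [LinearMap.compr₂_apply, LinearMap.compl₁₂_apply]
    · rw [C.comp_unit_unit, subdivision_unit, subdivision_unit, Q.comp_unit_unit]
      split_ifs
      · exact subdivision_unit R b
      · exact map_zero _
    · rw [C.comp_unit_left R i a E g hω', subdivision_unit, apply_ite (subdivision R), map_zero,
        subdivision_ofData R E g hω', map_units_smul, map_sum, ← smul_zero (Equiv.Perm.sign g),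
        ← smul_ite]
      congr 1
      rw [← Finset.sum_const_zero, ← Finset.sum_ite_irrel]
      refine Finset.sum_congr rfl fun B _ => ?_
      by_cases hE : E.edges ⊆ B.1.edges
      · rw [subdivisionTerm_of_subset R _ _ hE, Q.comp_unit_left]
      · rw [subdivisionTerm_of_not_subset R _ _ hE, map_zero, ite_self]
    · classical
      rw [C.comp_unit_right R i D f hω, subdivision_unit, apply_ite (subdivision R), map_zero,
        subdivision_ofData R D f hω, ← LinearMap.flip_apply, map_units_smul, map_sum,
        ← smul_zero (Equiv.Perm.sign f), ← smul_ite]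
      congr 1
      rw [← Finset.sum_const_zero, ← Finset.sum_ite_irrel]
      refine Finset.sum_congr rfl fun B _ => ?_
      rw [LinearMap.flip_apply]
      by_cases hD : D.edges ⊆ B.1.edges
      · rw [subdivisionTerm_of_subset R _ _ hD, Q.comp_unit_right]
      · rw [subdivisionTerm_of_not_subset R _ _ hD, map_zero, LinearMap.zero_apply, ite_self]
    · exact subdivision_comp_ofData R i D f hω E g hω'
  exact LinearMap.congr_fun₂ key z z'

end
end Pairahedra

namespace Pairahedra
noncomputable section

/-! ## The subdivision map is a chain map -/

variable {c : Corolla}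

/-- The contracted diagram has no third resolution (`Resolves.eq_of_ne`). -/
theorem IsLocalMove.unique {B B₁ B₂ : BinaryDiagram c} {e e₁ e₂ : Block}
    (h₁ : IsLocalMove B B₁ e e₁) (h₂ : IsLocalMove B B₂ e e₂) : B₁ = B₂ ∧ e₁ = e₂ := by
  obtain ⟨n₁, r, r₁⟩ := isLocalMove_iff.1 h₁
  obtain ⟨n₂, -, r₂⟩ := isLocalMove_iff.1 h₂
  have he := r.eq_of_ne (B.card_contract r.mem) r₁ r₂ n₁ n₂
  exact ⟨Subtype.ext (Diagram.ext (by rw [r₁.2, r₂.2, he])), he⟩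

theorem IsLocalMove.erase_eq {B B' : BinaryDiagram c} {e e' : Block} (h : IsLocalMove B B' e e') :
    B.1.edges.erase e = B'.1.edges.erase e' := congrArg Diagram.edges h.2.2.2

/-- The faces of two binary diagrams which are related by a local move cancel. -/
theorem IsLocalMove.remove_contr {B B' : BinaryDiagram c} {e e' : Block}
    (h : IsLocalMove B B' e e') {D : Diagram c} (hD : D.edges ⊆ B.1.edges) (he : e ∉ D.edges)
    {ω : Ext} (hω : IsOrientation D.edges ω) :
    remove e' (contr ω (stdOrientation c B').1) = - remove e (contr ω (stdOrientation c B).1) := by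
  obtain ⟨-, he1, he2, -⟩ := id h
  have hE := h.erase_eq
  have hne : ∀ x ∈ B.1.edges, x ≠ e → x ≠ e' := by
    rintro x hx hxe rfl
    exact Finset.notMem_erase x B'.1.edges (hE ▸ Finset.mem_erase.2 ⟨hxe, hx⟩)
  have hB := (stdOrientation c B).2
  have hX := hω.contr hB hD
  have hφ : ∀ x, x ≠ e → Function.update id e e' x = x := fun x hx => Function.update_of_ne hx _ _
  have hφe : Function.update id e e' e = e' := Function.update_self _ _ _
  have e1 : relabel (Function.update id e e') ω = ω :=
    relabel_eq_self (S := D.edges) (fun x hx => hφ x fun hxe => he (hxe ▸ hx)) hω.mem_wedgeSpan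
  have e2 := contr_relabel (φ := Function.update id e e') (S := B.1.edges) (T := D.edges)
    (fun a ha x hx hxa => by
      have hae : a ≠ e := fun hae => he (hae ▸ ha)
      rw [hφ a hae] at hxa
      by_cases hxe : x = e
      · subst hxe
        rw [hφe] at hxa
        exact absurd hxa.symm (hne a (hD ha) hae)
      · rwa [hφ x hxe] at hxa) hω.mem_wedgeSpan hB.mem_wedgeSpan
  have e3 := relabel_remove (φ := Function.update id e e') (S := B.1.edges) (e := e)
    (fun x hx hxe => by
      by_contra hne'
      rw [hφ x hne', hφe] at hxe
      exact hne x hx hne' hxe) (contr_mem_wedgeSpan hω.mem_wedgeSpan hB.mem_wedgeSpan)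
  -- Once `e` has been removed, the renaming moves none of the remaining edges.
  have e4 := relabel_eq_self (φ := Function.update id e e') (fun x hx => hφ x fun hxe =>
    Finset.notMem_erase e _ (hxe ▸ Finset.mem_coe.1 hx))
    (hX.remove (e := e) (Finset.mem_sdiff.2 ⟨he1, he⟩)).mem_wedgeSpan
  rw [isStandard_stdOrientation.move c B B' e e' h, map_neg, map_neg, neg_inj]
  rw [e1] at e2
  rw [hφe] at e3
  rw [e2, e3, e4]

theorem finset_erase_sdiff {S T : Finset Block} (e : Block) :
    (S \ T).erase e = S.erase e \ T := by
  ext x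
  simp only [Finset.mem_erase, Finset.mem_sdiff]
  tauto

/-- The edges of `B` which belong to `S`. -/
def Diagram.restrict (B : Diagram c) (S : Finset Block) : Diagram c where
  edges := B.edges ∩ S
  isBlock b hb := B.isBlock b (Finset.mem_inter.1 hb).1
  compatible b hb b' hb' :=
    B.compatible b (Finset.mem_inter.1 hb).1 b' (Finset.mem_inter.1 hb').1

variable (R : Type*) [CommRing R]

/-- The minus sign in the definition of the boundary makes the non-metric faces positive and the
contracted faces negative. -/
theorem Q.boundary_ofData {D : Diagram c} (f : Equiv.Perm (Fin c.arity)) {m : Finset Block}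
    {ω : Ext} (hm : m ⊆ D.edges) (hω : IsOrientation m ω) :
    Q.boundary R (Q.ofData R D f m ω) =
      ∑ e ∈ m, (Q.ofData R D f (m.erase e) (remove e ω) -
        Q.ofData R (D.contract e) f (m.erase e) (remove e ω)) := by
  rw [Q.ofData_of_valid R D f hm hω]
  refine (OrMod.lift_mk _ _ (QIndex.diag c D f m hm) _).trans ?_
  rw [← Finset.sum_coe_sort]
  refine Finset.sum_congr rfl fun e _ => ?_
  rw [neg_sub, Q.ofData_of_valid R D f ((Finset.erase_subset _ _).trans hm) (hω.remove e.2),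
    Q.ofData_of_valid R (D.contract e.1) f (Finset.erase_subset_erase _ hm) (hω.remove e.2)]

open Classical in
theorem C.boundary_ofData (D : Diagram c) (f : Equiv.Perm (Fin c.arity)) {ω : Ext}
    (hω : IsOrientation D.edges ω) : C.boundary R (C.ofData R D f ω) =
      ∑ D' : Diagram c, ∑ e ∈ D'.edges,
        if D'.contract e = D then C.ofData R D' f (edgeVec e * ω) else 0 := by
  rw [C.ofData_of_valid R D f hω]
  refine (OrMod.lift_mk _ _ (CIndex.diag c D f) _).trans ?_
  refine Finset.sum_congr rfl fun D' _ => ?_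
  rw [← Finset.sum_coe_sort D'.edges]
  refine Finset.sum_congr rfl fun e _ => ?_
  by_cases h : D'.contract e.1 = D
  · rw [if_pos h, C.ofData_of_valid R D' f (isOrientation_insert e.2 h hω)]
    exact dif_pos h
  · rw [if_neg h]
    exact dif_neg h

open Classical in
-- The diagrams between `D` and `B` with one edge more than `D` correspond to the edges `e` of `B`
-- not in `D`, and contraction by `e ∧ ω` is contraction by `ω` followed by removal of `e`. So the
-- terms of `∂_C` become the non-metric faces.
theorem sum_subdivisionTerm_insert (D : Diagram c) (f : Equiv.Perm (Fin c.arity)) (ω : Ext)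
    (B : BinaryDiagram c) :
    ∑ D' : Diagram c, ∑ e ∈ D'.edges,
        (if D'.contract e = D then subdivisionTerm R D' f (edgeVec e * ω) B else 0) =
      if D.edges ⊆ B.1.edges then ∑ e ∈ B.1.edges \ D.edges,
        Q.ofData R B.1 f ((B.1.edges \ D.edges).erase e)
          (remove e (contr ω (stdOrientation c B).1)) else 0 := by
  rw [Finset.sum_sigma']
  split_ifs with hD
  · symm
    refine Finset.sum_of_injOn
      (fun e => (⟨B.1.restrict (insert e D.edges), e⟩ : Σ _ : Diagram c, Block)) ?_ ?_ ?_ ?_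
    · intro e _ e' _ he
      exact congrArg Sigma.snd he
    · intro e he
      rw [Finset.mem_coe, Finset.mem_sdiff] at he
      simp [Diagram.restrict, he.1]
    · rintro ⟨D', e⟩ he hn
      rw [Finset.mem_sigma] at he
      refine ite_eq_right_iff.2 fun hc => subdivisionTerm_of_not_subset R _ _ fun hs => hn ?_
      have hr : Resolves D D' e := hc ▸ resolves_contract he.2
      refine ⟨e, Finset.mem_sdiff.2 ⟨hs he.2, hr.1⟩, ?_⟩
      refine Sigma.ext (Diagram.ext ?_) HEq.rfl
      change B.1.edges ∩ insert e D.edges = D'.edges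
      rw [← hr.2]
      exact Finset.inter_eq_right.2 hs
    · intro e he
      have he' := Finset.mem_sdiff.1 he
      have hr : Resolves D (B.1.restrict (insert e D.edges)) e :=
        ⟨he'.2, Finset.inter_eq_right.2 (Finset.insert_subset he'.1 hD)⟩
      have hs : (B.1.restrict (insert e D.edges)).edges ⊆ B.1.edges := Finset.inter_subset_left
      dsimp only
      rw [if_pos hr.contract, subdivisionTerm_of_subset R _ _ hs, contr_edgeVec_mul, hr.2,
        Finset.sdiff_insert]
  · refine Finset.sum_eq_zero ?_
    rintro ⟨D', e⟩ he
    refine ite_eq_right_iff.2 fun hc => subdivisionTerm_of_not_subset R _ _ fun hs => hD ?_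
    rw [← hc]
    exact (Finset.erase_subset _ _).trans hs

open Classical in
-- A contracted face arises from exactly two pairs `(B, e)`, related by a local move, and with
-- opposite orientations by `IsLocalMove.remove_contr`.
theorem sum_contract_eq_zero (D : Diagram c) (f : Equiv.Perm (Fin c.arity)) {ω : Ext}
    (hω : IsOrientation D.edges ω) :
    ∑ B : BinaryDiagram c, (if D.edges ⊆ B.1.edges then ∑ e ∈ B.1.edges \ D.edges,
        Q.ofData R (B.1.contract e) f ((B.1.edges \ D.edges).erase e)
          (remove e (contr ω (stdOrientation c B).1)) else 0) = 0 := by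
  rw [← Finset.sum_filter, Finset.sum_sigma']
  have hex : ∀ a : (Σ _ : BinaryDiagram c, Block),
      a ∈ (Finset.univ.filter fun B : BinaryDiagram c => D.edges ⊆ B.1.edges).sigma
        (fun B => B.1.edges \ D.edges) →
      ∃ a' : (Σ _ : BinaryDiagram c, Block), IsLocalMove a.1 a'.1 a.2 a'.2 := by
    rintro ⟨B, e⟩ ha
    rw [Finset.mem_sigma, Finset.mem_sdiff] at ha
    obtain ⟨B', e', h⟩ := B.exists_localMove ha.2.1
    exact ⟨⟨B', e'⟩, h⟩
  choose g hg using hex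
  have hmem : ∀ a ha, g a ha ∈
      (Finset.univ.filter fun B : BinaryDiagram c => D.edges ⊆ B.1.edges).sigma
        (fun B => B.1.edges \ D.edges) := by
    intro a ha
    have h := hg a ha
    rw [Finset.mem_sigma, Finset.mem_sdiff, Finset.mem_filter] at ha ⊢
    have hs : D.edges ⊆ (g a ‹_›).1.1.edges.erase (g a ‹_›).2 := by
      rw [← h.erase_eq]
      exact fun x hx => Finset.mem_erase.2 ⟨fun hxe => ha.2.2 (hxe ▸ hx), ha.1.2 hx⟩
    exact ⟨⟨Finset.mem_univ _, hs.trans (Finset.erase_subset _ _)⟩, h.2.2.1,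
      fun hx => Finset.notMem_erase _ _ (hs hx)⟩
  -- The partner is never the diagram itself, and uniqueness of the local move at an edge makes the
  -- pairing an involution.
  refine Finset.sum_involution g ?_ ?_ hmem ?_
  · intro a ha
    have h := hg a ha
    rw [Finset.mem_sigma, Finset.mem_sdiff, Finset.mem_filter] at ha
    rw [h.remove_contr ha.1.2 ha.2.2 hω, Q.ofData_neg, finset_erase_sdiff, finset_erase_sdiff,
      h.erase_eq, h.2.2.2, add_neg_cancel]
  · intro a ha _ heq
    exact (hg a ha).1 (congrArg Sigma.fst heq).symm
  · intro a ha
    obtain ⟨h1, h2⟩ := (hg (g a ha) (hmem a ha)).unique (hg a ha).symm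
    exact Sigma.ext h1 (heq_of_eq h2)

theorem boundary_subdivision (z : C R) :
    Q.boundary R (subdivision R z) = subdivision R (C.boundary R z) := by
  classical
  have key : (Q.boundary R).comp (subdivision R) = (subdivision R).comp (C.boundary R) := by
    refine C.hom_ext R (fun a => ?_) fun c D f ω hω => ?_ <;>
      rw [LinearMap.comp_apply, LinearMap.comp_apply]
    · have h1 : C.boundary R (C.unit R a) = 0 := OrMod.lift_mk _ _ (CIndex.unit a) _
      have h2 : Q.boundary R (Q.unit R a) = 0 := OrMod.lift_mk _ _ (QIndex.unit a) _
      rw [subdivision_unit, h1, h2, map_zero]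
    · have e1 : subdivision R (C.boundary R (C.ofData R D f ω)) = Equiv.Perm.sign f •
          ∑ D' : Diagram c, ∑ e ∈ D'.edges, ∑ B : BinaryDiagram c,
            if D'.contract e = D then subdivisionTerm R D' f (edgeVec e * ω) B else 0 := by
        rw [C.boundary_ofData R D f hω, map_sum, Finset.smul_sum]
        refine Finset.sum_congr rfl fun D' _ => ?_
        rw [map_sum, Finset.smul_sum]
        refine Finset.sum_congr rfl fun e he => ?_
        by_cases h : D'.contract e = D
        · simp only [if_pos h]
          exact subdivision_ofData R D' f (isOrientation_insert he h hω)
        · simp only [if_neg h]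
          rw [map_zero, Finset.sum_const_zero, smul_zero]
      have e2 : ∀ B : BinaryDiagram c, Q.boundary R (subdivisionTerm R D f ω B) =
          (if D.edges ⊆ B.1.edges then ∑ e ∈ B.1.edges \ D.edges,
            Q.ofData R B.1 f ((B.1.edges \ D.edges).erase e)
              (remove e (contr ω (stdOrientation c B).1)) else 0) -
          (if D.edges ⊆ B.1.edges then ∑ e ∈ B.1.edges \ D.edges,
            Q.ofData R (B.1.contract e) f ((B.1.edges \ D.edges).erase e)
              (remove e (contr ω (stdOrientation c B).1)) else 0) := by
        intro B
        by_cases h : D.edges ⊆ B.1.edges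
        · rw [subdivisionTerm_of_subset R _ _ h, if_pos h, if_pos h, Q.boundary_ofData R f
            Finset.sdiff_subset (hω.contr (stdOrientation c B).2 h), Finset.sum_sub_distrib]
        · rw [subdivisionTerm_of_not_subset R _ _ h, if_neg h, if_neg h, map_zero, sub_zero]
      rw [e1, subdivision_ofData R D f hω, map_units_smul, map_sum]
      congr 1
      rw [Finset.sum_congr rfl fun B _ => e2 B, Finset.sum_sub_distrib,
        sum_contract_eq_zero R D f hω, sub_zero,
        Finset.sum_congr rfl fun D' _ => Finset.sum_comm, Finset.sum_comm]
      exact Finset.sum_congr rfl fun B _ => (sum_subdivisionTerm_insert R D f ω B).symm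
  exact LinearMap.congr_fun key z

/-! ## Uniqueness of the subdivision map -/

theorem C.ofData_neg (D : Diagram c) (f : Equiv.Perm (Fin c.arity)) {ω : Ext}
    (hω : IsOrientation D.edges ω) : C.ofData R D f (-ω) = - C.ofData R D f ω := by
  rw [C.ofData_of_valid R D f hω, C.ofData_of_valid R D f hω.neg]
  exact OrMod.mk_eq_neg rfl

variable {R} in
/-- Equivariant maps which agree on one labeling and orientation of a diagram agree on all. -/
theorem C.eq_on_ofData {φ ψ : C R →ₗ[R] Q R}
    (hφ : ∀ (σ : ∀ n, Equiv.Perm (Fin n)) (z : C R), φ (C.act R σ z) = Q.act R σ (φ z))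
    (hψ : ∀ (σ : ∀ n, Equiv.Perm (Fin n)) (z : C R), ψ (C.act R σ z) = Q.act R σ (ψ z))
    {D : Diagram c} {f f' : Equiv.Perm (Fin c.arity)} {ω ω' : Ext}
    (hω : IsOrientation D.edges ω) (hω' : IsOrientation D.edges ω')
    (h : φ (C.ofData R D f ω) = ψ (C.ofData R D f ω)) :
    φ (C.ofData R D f' ω') = ψ (C.ofData R D f' ω') := by
  have key : φ (C.ofData R D f' ω) = ψ (C.ofData R D f' ω) := by
    have e : ∀ χ : C R →ₗ[R] Q R,
        (∀ (σ : ∀ n, Equiv.Perm (Fin n)) (z : C R), χ (C.act R σ z) = Q.act R σ (χ z)) →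
        -- The family of permutations is trivial except for `c.arity` leaves, where it turns the
        -- labeling `f` into `f'`.
        Q.act R (Function.update (fun _ => 1) c.arity (f⁻¹ * f')) (χ (C.ofData R D f ω)) =
          Equiv.Perm.sign (f⁻¹ * f') • χ (C.ofData R D f' ω) := by
      intro χ hχ
      rw [← hχ, C.act_ofData, map_units_smul, Function.update_self, mul_inv_cancel_left]
    have := e φ hφ
    rw [h, e ψ hψ] at this
    exact (smul_left_cancel _ this).symm
  rcases hω.eq_or hω' with rfl | rfl
  · exact key
  · rw [C.ofData_neg R D f' hω, map_neg, map_neg, key]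

theorem Diagram.exists_orientation (D : Diagram c) : ∃ ω, IsOrientation D.edges ω :=
  ⟨wedge D.edges.toList, _, D.edges.nodup_toList, Finset.toList_toFinset _, Or.inl rfl⟩

variable {R} in
-- Induction on the number of edges. A diagram without edges is a corolla; any other is cut at one
-- of its edges into two diagrams with fewer edges, whose composition it is up to sign, labeling and
-- orientation.
theorem IsSubdivisionMap.unique
    {std : ∀ (c : Corolla) (B : BinaryDiagram c), Orientation B.1.edges} {q q' : C R →ₗ[R] Q R}
    (hq : IsSubdivisionMap R std q) (hq' : IsSubdivisionMap R std q') : q = q' := by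
  refine C.hom_ext R (fun a => by rw [hq.unit, hq'.unit]) fun c D f ω hω => ?_
  induction hn : D.edges.card using Nat.strong_induction_on generalizing c D f ω with
  | _ n ih =>
    rcases D.edges.eq_empty_or_nonempty with h0 | ⟨b, hb⟩
    · obtain rfl : D = Diagram.ofCorolla c := Diagram.ext h0
      refine C.eq_on_ofData hq.act hq'.act (f := 1) isOrientation_empty_one hω ?_
      rw [C.ofData_of_valid R (Diagram.ofCorolla c) 1 isOrientation_empty_one]
      exact (hq.corolla c).trans (hq'.corolla c).symm
    · obtain ⟨c', d, p, h, rfl, rfl⟩ := (D.isBlock b hb).exists_newEdge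
      obtain ⟨D, E, rfl⟩ := h.exists_graft_eq D hb
      -- Inputs are counted from `1` and leaves from `0`, so under the identity labeling the leaf
      -- `p` is the input `p + 1`.
      obtain ⟨i, hi, rfl⟩ : ∃ (i : ℕ) (hi : 1 ≤ i ∧ i ≤ c'.arity),
          p = ((1 : Equiv.Perm (Fin c'.arity)) (pos hi) : ℕ) :=
        ⟨p + 1, ⟨by omega, h.1⟩, rfl⟩
      obtain ⟨ω₁, hω₁⟩ := D.exists_orientation
      obtain ⟨ω₂, hω₂⟩ := E.exists_orientation
      rw [card_graft] at hn
      have h1 := ih D.edges.card (by omega) c' D 1 ω₁ hω₁ rfl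
      have h2 := ih E.edges.card (by omega) d E 1 ω₂ hω₂ rfl
      have h3 := (hq.comp i (C.ofData R D 1 ω₁) (C.ofData R E 1 ω₂)).trans
        ((by rw [h1, h2] : _ = _).trans
          (hq'.comp i (C.ofData R D 1 ω₁) (C.ofData R E 1 ω₂)).symm)
      rw [C.comp_ofData R 1 1 hω₁ hω₂ hi h, map_units_smul, map_units_smul] at h3
      exact C.eq_on_ofData hq.act hq'.act (isOrientation_graft h D E hω₁ hω₂) hω
        (smul_left_cancel _ h3)

theorem isSubdivisionMap_subdivision : IsSubdivisionMap R stdOrientation (subdivision R) where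
  unit := subdivision_unit R
  corolla := subdivision_corolla R
  act := subdivision_act R
  comp := subdivision_comp R

end
end Pairahedra

/-! ### The theorem -/

theorem mainTheorem6 (R : Type*) [CommRing R] :
    (∃! std : (c : Pairahedra.Corolla) → (B : Pairahedra.BinaryDiagram c) →
        Pairahedra.Orientation B.1.edges, Pairahedra.IsStandard std) ∧
    ∀ std : (c : Pairahedra.Corolla) → (B : Pairahedra.BinaryDiagram c) →
        Pairahedra.Orientation B.1.edges, Pairahedra.IsStandard std →
      ∃ q : Pairahedra.C R →ₗ[R] Pairahedra.Q R,
        Pairahedra.IsSubdivisionMap R std q ∧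
        (∀ q' : Pairahedra.C R →ₗ[R] Pairahedra.Q R,
          Pairahedra.IsSubdivisionMap R std q' → q' = q) ∧
        (∀ (n : ℤ) (x : List Pairahedra.Color) (y : Pairahedra.Color),
          ∀ z ∈ Pairahedra.C.part R n x y, q z ∈ Pairahedra.Q.part R n x y) ∧
        ∀ z : Pairahedra.C R,
          Pairahedra.Q.boundary R (q z) = q (Pairahedra.C.boundary R z) := by
  refine ⟨⟨Pairahedra.stdOrientation, Pairahedra.isStandard_stdOrientation,
    fun _ h => h.unique Pairahedra.isStandard_stdOrientation⟩, fun std h => ?_⟩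
  -- Any standard choice is the constructed one, so it suffices to treat `stdOrientation`.
  obtain rfl := h.unique Pairahedra.isStandard_stdOrientation
  exact ⟨Pairahedra.subdivision R, Pairahedra.isSubdivisionMap_subdivision R,
    fun _ h' => h'.unique (Pairahedra.isSubdivisionMap_subdivision R),
    Pairahedra.subdivision_mem_part R, Pairahedra.boundary_subdivision R⟩
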